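/- **Setting.** Write $\hat\varphi(x)=\int\varphi(s)e^{-2\pi i xs}\,ds$. Let $\Phi$ be Gaussian white noise on the complex Schwartz functions $\mathcal S=\mathcal S(\mathbb R,\mathbb C)$, that is, a stationary generalized random process with centred Gaussian finite-dimensional laws and $$\mathbb E[\Phi(\varphi)\overline{\Phi(\psi)}]=\int\hat\varphi(x)\overline{\hat\psi(x)}\,dx,\qquad \mathbb E[\Phi(\varphi)\Phi(\psi)]=\int\hat\varphi(x)\hat\psi(-x)\,dx .$$ Let $f(s)=Ae^{2\pi i\xi_0 s}$ with $A\ge 0$, $\xi_0>0$ (null case: $A=0$; non-null case: $A>0$). Let $h(x)=(2\pi)^{-1/2}e^{-x^2/2}$. Fix $M>0$ and let $\psi\in C_c^\infty(\mathbb R;\mathbb R)$ be even, with $\psi=1$ on $[-M,M]$, $\psi(x)=0$ for $|x|>2M$, and $\psi$ decreasing on $[M,2M]$. Put $\mathsf h=\mathcal F^{-1}(\hat h\,\psi)$. For $t\in\mathbb R$ and $\eta>0$ let $\mathsf h_{t,\eta}(s)=\mathsf h(s-t)e^{-2\pi i\eta(s-t)}$, and $$\mathsf V_\eta=(f+\Phi)(\mathsf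 h_{t,\eta}),\qquad \partial_t\mathsf V_\eta=(f+\Phi)(\partial_t\mathsf h_{t,\eta}),\qquad \mathsf\Omega_\eta=\frac1{2\pi i}\frac{\partial_t\mathsf V_\eta}{\mathsf V_\eta},$$ where $f(\varphi)=\int f\varphi$. For $\xi>0$ and $\alpha>0$ let $$\mathsf Y_{\alpha,\eta}=\mathsf V_\eta\,\frac1{\pi\alpha}\exp\Big(-\frac1\alpha|\xi-\mathsf\Omega_\eta|^2\Big),$$ and $\mathsf Y_{\alpha,\eta}=0$ where $\mathsf V_\eta=0$. Let $\mathrm{Cov}(X,Z)=\mathbb E[(X-\mathbb EX)\overline{(Z-\mathbb EZ)}]$. **Theorem.** Fix $A,\xi_0,M,\psi,t$ as above, $\xi>0$ and an integer $k\ge 1$; implied constants and thresholds may depend on these. For all $\alpha,\eta>0$, $\mathsf Y_{\alpha,\eta}$ has finite $k$-th absolute moment and finite variance, and the following hold. 1. For every $\eta>0$, when $\alpha>0$ is sufficiently small (depending on $\eta$), $\mathbb E|\mathsf Y_{\alpha,\eta}|^k\asymp\alpha^{-k+1}$ and $\mathrm{Var}(\mathsf Y_{\alpha,\eta})\asymp\alpha^{-1}$.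 The implied constants depend on $\eta$, and the upper ones are $O(\eta^{-1/2})$ as $\eta\to0^+$. 2. In the null case, $\mathbb E\mathsf Y_{\alpha,\eta}=0$ for all $\alpha,\eta>0$. In the non-null case, $\mathbb E\mathsf Y_{\alpha,\eta}=O(e^{-|\eta-\xi_0|^2})$ when $|\eta-\xi_0|$ is sufficiently large, uniformly in $\alpha>0$. 3. For every $\alpha>0$, $\mathrm{Cov}(\mathsf Y_{\alpha,\eta},\mathsf Y_{\alpha,\eta'})$ and $\mathrm{Cov}(\mathsf Y_{\alpha,\eta},\overline{\mathsf Y_{\alpha,\eta'}})$ are continuous functions of $(\eta,\eta')\in(0,\infty)^2$. 4. There is a function $B(\eta,\eta')$ such that for all distinct $\eta,\eta'>0$, when $\alpha>0$ is sufficiently small (depending on $\eta,\eta'$), $$|\mathrm{Cov}(\mathsf Y_{\alpha,\eta},\mathsf Y_{\alpha,\eta'})|\le B(\eta,\eta')\,\alpha^{-1},\qquad|\mathrm{Cov}(\mathsf Y_{\alpha,\eta},\overline{\mathsf Y_{\alpha,\eta'}})|\le B(\eta,\eta')\,\alpha^{-1},$$ where, when $|\eta-\eta'|$ is sufficiently large,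 $B(\eta,\eta')$ is - $O\big((\eta+\eta')^2e^{-(\eta-\eta')^2}\big)$ when $\eta,\eta'\ge\delta$, for each fixed $\delta>0$; - $O\big((\eta+\eta')^2\eta^{-1/2}e^{-(\eta-\eta')^2}\big)$ when $\eta$ is sufficiently small; - $O\big((\eta+\eta')^2\eta'^{-1/2}e^{-(\eta-\eta')^2}\big)$ when $\eta'$ is sufficiently small. 5. For all $\alpha,\eta,\eta'>0$ with $|\eta-\eta'|>4M$, $\mathrm{Cov}(\mathsf Y_{\alpha,\eta},\mathsf Y_{\alpha,\eta'})=\mathrm{Cov}(\mathsf Y_{\alpha,\eta},\overline{\mathsf Y_{\alpha,\eta'}})=0$. -/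

import Mathlib

open MeasureTheory ProbabilityTheory Filter Topology Set
open scoped SchwartzMap FourierTransform ComplexConjugate

noncomputable section

namespace SST

/-! ### Windows -/

theorem polynomial_mul_gaussian_bounded (p : Polynomial ℝ) :
    ∃ C : ℝ, ∀ x : ℝ, |p.eval x * Real.exp (-(x ^ 2 / 2))| ≤ C := by
  induction p using Polynomial.induction_on' with
  | add p q hp hq =>
    obtain ⟨C, hC⟩ := hp
    obtain ⟨D, hD⟩ := hq
    refine ⟨C + D, fun x => ?_⟩
    rw [Polynomial.eval_add, add_mul]
    exact (abs_add_le _ _).trans (add_le_add (hC x) (hD x))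
  | monomial n a =>
    refine ⟨|a| * ((n.factorial : ℝ) * Real.exp 1), fun x => ?_⟩
    have h1 : |x| ^ n ≤ (n.factorial : ℝ) * Real.exp |x| := by
      have := Real.pow_div_factorial_le_exp |x| (abs_nonneg x) n
      rwa [div_le_iff₀ (by positivity), mul_comm] at this
    have h2 : Real.exp |x| * Real.exp (-(x ^ 2 / 2)) ≤ Real.exp 1 := by
      rw [← Real.exp_add]
      apply Real.exp_le_exp.mpr
      nlinarith [sq_nonneg (|x| - 1), sq_abs x]
    rw [Polynomial.eval_monomial, abs_mul, abs_mul, abs_pow, Real.abs_exp, mul_assoc]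
    refine mul_le_mul_of_nonneg_left ?_ (abs_nonneg a)
    calc |x| ^ n * Real.exp (-(x ^ 2 / 2))
        ≤ ((n.factorial : ℝ) * Real.exp |x|) * Real.exp (-(x ^ 2 / 2)) :=
          mul_le_mul_of_nonneg_right h1 (Real.exp_pos _).le
      _ = (n.factorial : ℝ) * (Real.exp |x| * Real.exp (-(x ^ 2 / 2))) := by ring
      _ ≤ (n.factorial : ℝ) * Real.exp 1 := by gcongr

/-- `x ↦ exp (-x² / 2)` as a real Schwartz function. -/
def realGaussian : 𝓢(ℝ, ℝ) where
  toFun x := Real.exp (-(x ^ 2 / 2))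
  smooth' := by fun_prop
  decay' k n := by
    obtain ⟨C, hC⟩ := polynomial_mul_gaussian_bounded
      (Polynomial.X ^ k * (Polynomial.hermite n).map (Int.castRingHom ℝ))
    refine ⟨C, fun x => le_trans (le_of_eq ?_) (hC x)⟩
    rw [norm_iteratedFDeriv_eq_norm_iteratedDeriv, iteratedDeriv_eq_iterate,
      Polynomial.deriv_gaussian_eq_hermite_mul_gaussian]
    simp only [Polynomial.eval_mul, Polynomial.eval_pow, Polynomial.eval_X, Real.norm_eq_abs,
      abs_mul, abs_pow, abs_neg, abs_one, one_pow, one_mul, Polynomial.eval_map,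
      Polynomial.aeval_def, mul_assoc]
    rfl

/-- The Gaussian window `h(x) = (2π)^{-1/2} exp (-x² / 2)`. -/
def gaussianWindow : 𝓢(ℝ, ℂ) :=
  (((2 * Real.pi) ^ (-(1 / 2) : ℝ) : ℝ) : ℂ) • realGaussian.postcompCLM Complex.ofRealCLM

theorem gaussianWindow_apply (x : ℝ) :
    gaussianWindow x = (((2 * Real.pi) ^ (-(1 / 2) : ℝ) * Real.exp (-(x ^ 2 / 2)) : ℝ) : ℂ) := by
  rw [Complex.ofReal_mul]
  rfl

/-- A smooth, compactly supported, even, real cutoff function that equals `1` on `[-M, M]`,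
vanishes where `|t| > 2M`, and is decreasing in `|t|` on `M ≤ |t| ≤ 2M`. -/
structure IsCutoff (M : ℝ) (ψ : ℝ → ℝ) : Prop where
  smooth : ContDiff ℝ (⊤ : ℕ∞) ψ
  hasCompactSupport : HasCompactSupport ψ
  even : ∀ x, ψ (-x) = ψ x
  antitoneOn : AntitoneOn ψ (Icc M (2 * M))
  eq_one : ∀ x, |x| ≤ M → ψ x = 1
  eq_zero : ∀ x, 2 * M < |x| → ψ x = 0

/-- The truncated window `𝓕⁻¹(ψ · 𝓕 h)`, for the Gaussian window `h`. -/
def truncatedWindow (ψ : ℝ → ℝ) : 𝓢(ℝ, ℂ) :=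
  𝓕⁻ (SchwartzMap.smulLeftCLM ℂ (fun x => (ψ x : ℂ)) (𝓕 gaussianWindow))

theorem fourier_truncatedWindow_apply {M : ℝ} {ψ : ℝ → ℝ} (hψ : IsCutoff M ψ) (x : ℝ) :
    (𝓕 (truncatedWindow ψ)) x = (ψ x : ℂ) * (𝓕 gaussianWindow) x := by
  have hg : Function.HasTemperateGrowth (fun x => (ψ x : ℂ)) :=
    Function.HasTemperateGrowth.comp Complex.ofRealCLM.hasTemperateGrowth
      (hψ.hasCompactSupport.hasTemperateGrowth hψ.smooth)
  rw [truncatedWindow, FourierTransform.fourier_fourierInv_eq,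
    SchwartzMap.smulLeftCLM_apply_apply hg, smul_eq_mul]

/-! ### Time-frequency atoms, short-time Fourier transform, synchrosqueezing integrand -/

theorem hasTemperateGrowth_modulation (η : ℝ) :
    Function.HasTemperateGrowth
      (fun s : ℝ => Complex.exp (-(2 * Real.pi * Complex.I * η * s))) := by
  have hc : ∀ n : ℕ, iteratedDeriv n
      (fun s : ℝ => Complex.exp (-(2 * Real.pi * Complex.I * η * s))) =
      fun s : ℝ => (-(2 * Real.pi * Complex.I * η)) ^ n *
        Complex.exp (-(2 * Real.pi * Complex.I * η * s)) := by
    intro n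
    induction n with
    | zero => ext s; simp
    | succ n ih =>
      rw [iteratedDeriv_succ, ih]
      ext s
      have h1 : HasDerivAt (fun s : ℝ => -(2 * Real.pi * Complex.I * η * (s : ℂ)))
          (-(2 * Real.pi * Complex.I * η * 1)) s :=
        ((Complex.ofRealCLM.hasDerivAt (x := s)).const_mul _).neg
      rw [(h1.cexp.const_mul _).deriv]
      ring
  refine ⟨?_, fun n => ⟨0, ‖(-(2 * Real.pi * Complex.I * η)) ^ n‖, fun s => ?_⟩⟩
  · exact (((contDiff_const (c := (2 * Real.pi * Complex.I * η : ℂ))).mul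
      Complex.ofRealCLM.contDiff).neg).cexp
  · rw [norm_iteratedFDeriv_eq_norm_iteratedDeriv, hc n, norm_mul, Complex.norm_exp]
    simp

/-- `h_{t,η}(s) = h(s - t) exp (-2πiη(s - t))`. -/
def atom (h : 𝓢(ℝ, ℂ)) (t η : ℝ) : 𝓢(ℝ, ℂ) :=
  SchwartzMap.compSubConstCLM ℂ t
    (SchwartzMap.smulLeftCLM ℂ
      (fun s : ℝ => Complex.exp (-(2 * Real.pi * Complex.I * η * s))) h)

theorem atom_apply (h : 𝓢(ℝ, ℂ)) (t η s : ℝ) :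
    atom h t η s =
      h (s - t) * Complex.exp (-(2 * Real.pi * Complex.I * η * ((s - t : ℝ) : ℂ))) := by
  rw [atom, SchwartzMap.compSubConstCLM_apply,
    SchwartzMap.smulLeftCLM_apply_apply (hasTemperateGrowth_modulation η), smul_eq_mul, mul_comm]

/-- `∂_t h_{t,η} = -(h')_{t,η} + 2πiη h_{t,η}`. -/
def atomDt (h : 𝓢(ℝ, ℂ)) (t η : ℝ) : 𝓢(ℝ, ℂ) :=
  -atom (SchwartzMap.derivCLM ℂ ℂ h) t η + (2 * Real.pi * Complex.I * η : ℂ) • atom h t η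

theorem hasDerivAt_atom (h : 𝓢(ℝ, ℂ)) (t η s : ℝ) :
    HasDerivAt (fun t => atom h t η s) (atomDt h t η s) t := by
  have h0 : HasDerivAt (fun t : ℝ => s - t) (-1) t := by
    simpa using (hasDerivAt_id t).const_sub s
  have h1 : HasDerivAt (fun t : ℝ => h (s - t)) (-(deriv h (s - t))) t := by
    have := (h.hasDerivAt (s - t)).scomp t h0
    rw [neg_one_smul] at this
    exact this
  have h2 : HasDerivAt (fun t : ℝ => -(2 * Real.pi * Complex.I * η * ((s - t : ℝ) : ℂ)))
      (-(2 * Real.pi * Complex.I * η * ((-1 : ℝ) : ℂ))) t :=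
    (h0.ofReal_comp.const_mul _).neg
  have h3 := h1.mul h2.cexp
  have e : (fun t => atom h t η s) = fun t : ℝ =>
      h (s - t) * Complex.exp (-(2 * Real.pi * Complex.I * η * ((s - t : ℝ) : ℂ))) := by
    ext t
    exact atom_apply h t η s
  rw [e]
  refine h3.congr_deriv ?_
  have e2 : atomDt h t η s = -atom (SchwartzMap.derivCLM ℂ ℂ h) t η s +
    (2 * Real.pi * Complex.I * η : ℂ) * atom h t η s := rfl
  rw [e2, atom_apply, atom_apply, SchwartzMap.derivCLM_apply]
  push_cast
  ring

variable {Ω : Type*}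

/-- The random functional `f + Φ`, where `f(s) = A exp (2πi ξ₀ s)` acts on Schwartz functions by
integration. -/
def noisySignal (A ξ₀ : ℝ) (Φ : 𝓢(ℝ, ℂ) → Ω → ℂ) (φ : 𝓢(ℝ, ℂ)) (ω : Ω) : ℂ :=
  (∫ s : ℝ, (A : ℂ) * Complex.exp (2 * Real.pi * Complex.I * ξ₀ * s) * φ s) + Φ φ ω

/-- The short-time Fourier transform `V_F^{(h)}(t, η) = F(h_{t,η})` of a random functional `F`. -/
def stft (F : 𝓢(ℝ, ℂ) → Ω → ℂ) (h : 𝓢(ℝ, ℂ)) (t η : ℝ) (ω : Ω) : ℂ :=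
  F (atom h t η) ω

/-- The time derivative `∂_t V_F^{(h)}(t, η) = F(∂_t h_{t,η})`. -/
def stftDt (F : 𝓢(ℝ, ℂ) → Ω → ℂ) (h : 𝓢(ℝ, ℂ)) (t η : ℝ) (ω : Ω) : ℂ :=
  F (atomDt h t η) ω

/-- The reassignment rule `Ω_F^{(h)}(t, η) = (2πi)⁻¹ ∂_t V / V`, meaningful where `V ≠ 0`. -/
def reassignment (F : 𝓢(ℝ, ℂ) → Ω → ℂ) (h : 𝓢(ℝ, ℂ)) (t η : ℝ) (ω : Ω) : ℂ :=
  1 / (2 * Real.pi * Complex.I) * (stftDt F h t η ω / stft F h t η ω)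

/-- `g_α(z) = (πα)⁻¹ exp (-|z|² / α)`. -/
def approxDelta (α : ℝ) (z : ℂ) : ℝ :=
  1 / (Real.pi * α) * Real.exp (-(‖z‖ ^ 2 / α))

open scoped Classical in
/-- The synchrosqueezing integrand `Y_F^{(h,α,ξ)}(t, η) = V · g_α(ξ - Ω)`; it is `0` where
`V = 0`, in accordance with the convention `Ω = -∞` there. -/
def sstIntegrand (F : 𝓢(ℝ, ℂ) → Ω → ℂ) (h : 𝓢(ℝ, ℂ)) (α ξ t η : ℝ) (ω : Ω) : ℂ :=
  if stft F h t η ω = 0 then 0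
  else stft F h t η ω * (approxDelta α ((ξ : ℂ) - reassignment F h t η ω) : ℂ)

/-! ### White noise -/

variable [MeasurableSpace Ω]

/-- A generalized random process: an (almost surely) linear map from Schwartz functions to complex
random variables, continuous in the sense of finite-dimensional distributions. -/
structure IsGRP (Φ : 𝓢(ℝ, ℂ) → Ω → ℂ) (P : Measure Ω) [IsProbabilityMeasure P] : Prop where
  aemeasurable : ∀ φ, AEMeasurable (Φ φ) P
  map_add : ∀ φ ψ, Φ (φ + ψ) =ᵐ[P] Φ φ + Φ ψ
  map_smul : ∀ (c : ℂ) φ, Φ (c • φ) =ᵐ[P] c • Φ φ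
  continuous_fdd : ∀ (n : ℕ) (φ : ℕ → Fin n → 𝓢(ℝ, ℂ)) (φ₀ : Fin n → 𝓢(ℝ, ℂ)),
    Tendsto φ atTop (𝓝 φ₀) →
    TendstoInDistribution (fun j ω i => Φ (φ j i) ω) atTop (fun ω i => Φ (φ₀ i) ω) (fun _ => P) P

/-- Stationarity: translating all test functions does not change the joint law. -/
def IsStationary (Φ : 𝓢(ℝ, ℂ) → Ω → ℂ) (P : Measure Ω) : Prop :=
  ∀ (n : ℕ) (φ : Fin n → 𝓢(ℝ, ℂ)) (τ : ℝ),
    IdentDistrib (fun ω i => Φ (SchwartzMap.compSubConstCLM ℂ τ (φ i)) ω)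
      (fun ω i => Φ (φ i) ω) P P

/-- Gaussian white noise on complex-valued test functions: a stationary generalized random process
with centred Gaussian finite-dimensional laws, whose covariance and pseudocovariance functionals are
`∫ φ̂(x) conj(ψ̂(x)) dx` and `∫ φ̂(x) ψ̂(-x) dx` (power spectrum equal to Lebesgue measure). -/
structure IsComplexGaussianWhiteNoise (Φ : 𝓢(ℝ, ℂ) → Ω → ℂ) (P : Measure Ω)
    [IsProbabilityMeasure P] : Prop where
  isGRP : IsGRP Φ P
  isStationary : IsStationary Φ P
  isGaussian : IsGaussianProcess Φ P
  mean_zero : ∀ φ, ∫ ω, Φ φ ω ∂P = 0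
  covariance_eq : ∀ φ ψ : 𝓢(ℝ, ℂ),
    ∫ ω, Φ φ ω * conj (Φ ψ ω) ∂P = ∫ x : ℝ, (𝓕 φ) x * conj ((𝓕 ψ) x)
  pseudocovariance_eq : ∀ φ ψ : 𝓢(ℝ, ℂ),
    ∫ ω, Φ φ ω * Φ ψ ω ∂P = ∫ x : ℝ, (𝓕 φ) x * (𝓕 ψ) (-x)

/-! ### Moments of complex random variables -/

/-- `Cov(X, Y) = 𝔼[(X - 𝔼X) conj(Y - 𝔼Y)]`. -/
def complexCov (X Y : Ω → ℂ) (P : Measure Ω) : ℂ :=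
  ∫ ω, (X ω - ∫ ω', X ω' ∂P) * conj (Y ω - ∫ ω', Y ω' ∂P) ∂P

/-- `Var(X) = 𝔼|X - 𝔼X|²`. -/
def complexVar (X : Ω → ℂ) (P : Measure Ω) : ℝ :=
  ∫ ω, ‖X ω - ∫ ω', X ω' ∂P‖ ^ 2 ∂P

end SST

end

noncomputable section

namespace SST

/-! ### Fourier transforms of the atoms -/

/-! Write `V` for the transform and `W = (2πi)⁻¹ ∂_t V`, so that `Ω = W / V` and `|Y|^k = (πα)^{-k}
|V|^k exp(-k|ξV - W|²/(α|V|²))`. The moment estimate says that the last kernel has expectation of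
order `α`. Heuristically, the exponential confines the two real coordinates of `ξV - W` to size `√α
|V|`, and each costs a factor `√α`.

The Fourier transforms of the two test functions are real amplitudes times the same phase
`exp(-2πixt)`. Hence the real parts of `(V, W)` are uncorrelated with the imaginary parts, and their
covariances are `L²` inner products of the even, respectively odd, parts of `q(x + η)` and `-x q(x +
η)`, where `q` is `windowHat ψ`. For `η > 0` the compact support of `q` makes both real pairs
nondegenerate (`isSplitGaussian_noisySignal`), which gives upper and lower bounds of order `α`
(`IsSplitGaussian.lintegral_momentKernel_le`, `IsSplitGaussian.exists_le_integral_momentKernel`).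

As `η → 0` the odd part of `q(x + η)` tends to zero, so the variances of `Im V` and `Re W`
degenerate. The upper bound therefore conditions on exactly these two variables and integrates out
`Re V` and `Im W`, whose conditional variances stay bounded below
(`exists_pos_le_integral_bumpEven`, `exists_pos_le_integral_bumpOdd`). The upper constant even stays
bounded, which is stronger than `O(η^{-1/2})`. The variance estimate follows from the moments of
orders two and one.

The remaining decay claims come from the support of `q`. If `|η - ξ₀| > 2M`, the signal contributes
nothing to `V` and `W`; as `Y` is odd in `(V, W)`, its mean vanishes. If `|η - η'| > 4M`, the two
spectra are disjoint, also after reflection, and the two values of `Y` are independent. So the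
exponential bounds hold far away with constant zero, and nearby `B` is merely an average of two
variance constants.

Continuity of the covariances is `L²` continuity of `Y` in `η`: `V` and `W` are `L²` continuous,
`|Y| ≤ |V|/(πα)`, and `V ≠ 0` almost surely, so Vitali's theorem applies. -/

/-- The Fourier transform of the truncated window, as a real function. -/
def windowHat (ψ : ℝ → ℝ) (x : ℝ) : ℝ := ψ x * Real.exp (-(2 * Real.pi ^ 2 * x ^ 2))

theorem fourier_gaussianWindow (x : ℝ) :
    (𝓕 gaussianWindow) x = (Real.exp (-(2 * Real.pi ^ 2 * x ^ 2)) : ℂ) := by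
  have hπ : (Real.pi : ℂ) ≠ 0 := by exact_mod_cast Real.pi_ne_zero
  rw [SchwartzMap.fourier_coe, Real.fourier_eq']
  have h1 := fourierIntegral_gaussian (b := (1 / 2 : ℂ)) (by norm_num) (-(2 * Real.pi * x))
  have h2 : ∀ v : ℝ, Complex.exp (↑(-2 * Real.pi * inner ℝ v x) * Complex.I) • gaussianWindow v =
      (((2 * Real.pi) ^ (-(1 / 2) : ℝ) : ℝ) : ℂ) *
      (Complex.exp (Complex.I * (-(2 * Real.pi * x)) * v) * Complex.exp (-(1 / 2) * (v : ℂ) ^ 2)) := by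
    intro v
    rw [gaussianWindow_apply, smul_eq_mul]
    have e1 : (↑(-2 * Real.pi * inner ℝ v x) * Complex.I : ℂ) =
        Complex.I * (-(2 * Real.pi * x)) * v := by
      simp only [RCLike.inner_apply, conj_trivial]
      push_cast
      ring
    rw [e1]
    push_cast
    ring_nf
  simp_rw [h2]
  rw [integral_const_mul, h1]
  have e3 : ((Real.pi : ℂ) / (1 / 2)) ^ (1 / 2 : ℂ) = (((2 * Real.pi) ^ (1 / 2 : ℝ) : ℝ) : ℂ) := by
    rw [Complex.ofReal_cpow (by positivity)]
    push_cast
    congr 1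
    field_simp
  rw [e3, ← mul_assoc, ← Complex.ofReal_mul, ← Real.rpow_add (by positivity)]
  norm_num
  congr 1
  ring

/-- `IsPhasedFourier t φ a` says that `𝓕 φ x = a x * exp (-2πi x t)` with `a` real-valued. -/
def IsPhasedFourier (t : ℝ) (φ : 𝓢(ℝ, ℂ)) (a : ℝ → ℝ) : Prop :=
  ∀ x : ℝ, (𝓕 φ) x = (a x : ℂ) * Complex.exp (-(2 * Real.pi * Complex.I * x * t))

/-- Because the modulation is centred at `t`, the phase does not involve `η`. All atoms at time `t`
thus share one phase, which cancels in every second moment. -/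
theorem fourier_atom (h : 𝓢(ℝ, ℂ)) (t η x : ℝ) :
    (𝓕 (atom h t η)) x = (𝓕 h) (x + η) * Complex.exp (-(2 * Real.pi * Complex.I * x * t)) := by
  rw [SchwartzMap.fourier_coe, SchwartzMap.fourier_coe, Real.fourier_eq', Real.fourier_eq',
    ← integral_sub_right_eq_self
      (fun v : ℝ => Complex.exp (↑(-2 * Real.pi * inner ℝ v (x + η)) * Complex.I) • h v) t,
    ← integral_mul_const]
  refine integral_congr_ae (.of_forall fun v => ?_)
  simp only [atom_apply, smul_eq_mul]
  have e : Complex.exp (↑(-2 * Real.pi * inner ℝ v x) * Complex.I) *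
      Complex.exp (-(2 * Real.pi * Complex.I * η * ((v - t : ℝ) : ℂ))) =
      Complex.exp (↑(-2 * Real.pi * inner ℝ (v - t) (x + η)) * Complex.I) *
      Complex.exp (-(2 * Real.pi * Complex.I * x * t)) := by
    rw [← Complex.exp_add, ← Complex.exp_add]
    congr 1
    simp only [RCLike.inner_apply, conj_trivial]
    push_cast
    ring
  linear_combination h (v - t) * e

theorem fourier_derivCLM (h : 𝓢(ℝ, ℂ)) (x : ℝ) :
    (𝓕 (SchwartzMap.derivCLM ℂ ℂ h)) x = 2 * Real.pi * Complex.I * x * (𝓕 h) x := by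
  have e : (SchwartzMap.derivCLM ℂ ℂ h : ℝ → ℂ) = deriv h := by
    ext y
    rw [SchwartzMap.derivCLM_apply]
  rw [SchwartzMap.fourier_coe, SchwartzMap.fourier_coe, e,
    Real.fourier_deriv h.integrable h.differentiable (e ▸ (SchwartzMap.derivCLM ℂ ℂ h).integrable)]
  simp

/-- The test function `(2πi)⁻¹ ∂_t h_{t,η}`. -/
def freqAtom (h : 𝓢(ℝ, ℂ)) (t η : ℝ) : 𝓢(ℝ, ℂ) :=
  (1 / (2 * Real.pi * Complex.I) : ℂ) • atomDt h t η

/-- The time `t` enters the transform of the atom only through its phase, so `(2πi)⁻¹ ∂_t` acts as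
multiplication by `-x`. The phase is kept and the amplitude stays real when that of `h` is. -/
theorem fourier_freqAtom (h : 𝓢(ℝ, ℂ)) (t η x : ℝ) :
    (𝓕 (freqAtom h t η)) x =
      -x * (𝓕 h) (x + η) * Complex.exp (-(2 * Real.pi * Complex.I * x * t)) := by
  have hπ : (Real.pi : ℂ) ≠ 0 := by exact_mod_cast Real.pi_ne_zero
  have hI := Complex.I_ne_zero
  rw [freqAtom, atomDt, FourierTransform.fourier_smul, FourierTransform.fourier_add,
    FourierTransform.fourier_neg, FourierTransform.fourier_smul, smul_apply,
    add_apply, neg_apply, smul_apply, fourier_atom,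
    fourier_atom, fourier_derivCLM, smul_eq_mul, smul_eq_mul]
  push_cast
  field_simp
  ring

section Window

variable {M : ℝ} {ψ : ℝ → ℝ}

theorem fourier_truncatedWindow (hψ : IsCutoff M ψ) (x : ℝ) :
    (𝓕 (truncatedWindow ψ)) x = (windowHat ψ x : ℂ) := by
  rw [fourier_truncatedWindow_apply hψ, fourier_gaussianWindow, windowHat]
  push_cast
  rfl

theorem isPhasedFourier_atom (hψ : IsCutoff M ψ) (t η : ℝ) :
    IsPhasedFourier t (atom (truncatedWindow ψ) t η) (fun x => windowHat ψ (x + η)) := fun x => by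
  rw [fourier_atom, fourier_truncatedWindow hψ]

theorem isPhasedFourier_freqAtom (hψ : IsCutoff M ψ) (t η : ℝ) :
    IsPhasedFourier t (freqAtom (truncatedWindow ψ) t η)
      (fun x => -x * windowHat ψ (x + η)) := fun x => by
  rw [fourier_freqAtom, fourier_truncatedWindow hψ]
  push_cast
  ring

theorem contDiff_windowHat (hψ : IsCutoff M ψ) : ContDiff ℝ 1 (windowHat ψ) :=
  (hψ.smooth.of_le (by exact_mod_cast le_top)).mul (by fun_prop)

theorem continuous_windowHat (hψ : IsCutoff M ψ) : Continuous (windowHat ψ) :=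
  (contDiff_windowHat hψ).continuous

theorem windowHat_neg (hψ : IsCutoff M ψ) (x : ℝ) : windowHat ψ (-x) = windowHat ψ x := by
  simp [windowHat, hψ.even]

theorem windowHat_eq_zero (hψ : IsCutoff M ψ) {x : ℝ} (hx : 2 * M < |x|) : windowHat ψ x = 0 := by
  simp [windowHat, hψ.eq_zero x hx]

theorem windowHat_zero (hψ : IsCutoff M ψ) (hM : 0 < M) : windowHat ψ 0 = 1 := by
  simp [windowHat, hψ.eq_one 0 (by simpa using hM.le)]

theorem abs_windowHat_le (hψ : IsCutoff M ψ) : ∃ C, ∀ x, |windowHat ψ x| ≤ C := by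
  obtain ⟨C, hC⟩ := (continuous_windowHat hψ).bounded_above_of_compact_support
    (hψ.hasCompactSupport.mul_right)
  exact ⟨C, hC⟩

end Window

/-! ### Lower bounds for Gram determinants -/

theorem integrable_of_eq_zero_of_lt_abs {f : ℝ → ℝ} {R : ℝ} (hf : Continuous f)
    (h0 : ∀ x, R < |x| → f x = 0) : Integrable f :=
  hf.integrable_of_hasCompactSupport <| HasCompactSupport.intro (isCompact_Icc (a := -R) (b := R))
    fun x hx => h0 x <| by
      by_contra! h
      exact hx (abs_le.mp h)

theorem integral_sq_pos {f : ℝ → ℝ} {R x : ℝ} (hf : Continuous f)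
    (h0 : ∀ x, R < |x| → f x = 0) (hx : f x ≠ 0) : 0 < ∫ x, f x ^ 2 := by
  refine Continuous.integral_pos_of_hasCompactSupport_nonneg_nonzero (x := x) (hf.pow 2) ?_
    (fun x => sq_nonneg (f x)) (pow_ne_zero 2 hx)
  refine HasCompactSupport.intro (isCompact_Icc (a := -R) (b := R)) fun x hx => ?_
  rw [h0 x, zero_pow two_ne_zero]
  by_contra! h
  exact hx (abs_le.mp h)

theorem integral_add_mul_sq {e d : ℝ → ℝ} {R : ℝ} (he : Continuous e) (hd : Continuous d)
    (he0 : ∀ x, R < |x| → e x = 0) (hd0 : ∀ x, R < |x| → d x = 0) (p q : ℝ) :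
    ∫ x, (p * e x + q * d x) ^ 2 =
      p ^ 2 * (∫ x, e x * e x) + 2 * p * q * (∫ x, e x * d x) + q ^ 2 * ∫ x, d x * d x := by
  have i1 : Integrable fun x => e x * e x :=
    integrable_of_eq_zero_of_lt_abs (he.mul he) (R := R) fun x hx => by simp [he0 x hx]
  have i2 : Integrable fun x => e x * d x :=
    integrable_of_eq_zero_of_lt_abs (he.mul hd) (R := R) fun x hx => by simp [he0 x hx]
  have i3 : Integrable fun x => d x * d x :=
    integrable_of_eq_zero_of_lt_abs (hd.mul hd) (R := R) fun x hx => by simp [hd0 x hx]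
  have e1 : ∀ x, (p * e x + q * d x) ^ 2 =
      p ^ 2 * (e x * e x) + 2 * p * q * (e x * d x) + q ^ 2 * (d x * d x) := fun x => by ring
  simp_rw [e1]
  rw [integral_add (f := fun x => p ^ 2 * (e x * e x) + 2 * p * q * (e x * d x))
      ((i1.const_mul _).add (i2.const_mul _)) (i3.const_mul _),
    integral_add (i1.const_mul _) (i2.const_mul _), integral_const_mul, integral_const_mul,
    integral_const_mul]

theorem continuousOn_integral_mul {R : ℝ} {e d : ℝ → ℝ → ℝ} {s : Set ℝ}
    (he : Continuous (Function.uncurry e)) (hd : Continuous (Function.uncurry d))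
    (he0 : ∀ η ∈ s, ∀ x, R < |x| → e η x = 0) :
    ContinuousOn (fun η => ∫ x, e η x * d η x) s :=
  continuousOn_integral_of_compact_support (isCompact_Icc (a := -R) (b := R))
    (he.mul hd).continuousOn fun η x hη hx => by
      have : R < |x| := by
        by_contra! h
        exact hx (abs_le.mp h)
      simp [he0 η hη x this]

/-- If `e 0` and `d 0` are linearly independent, the `L²` distance from `e η` to the line through
`d η` stays bounded below for small `η`. -/
theorem exists_pos_le_integral_sub_sq {R : ℝ} {e d : ℝ → ℝ → ℝ}
    (he : Continuous (Function.uncurry e)) (hd : Continuous (Function.uncurry d))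
    (he0 : ∀ η ∈ Icc (0 : ℝ) 1, ∀ x, R < |x| → e η x = 0)
    (hd0 : ∀ η ∈ Icc (0 : ℝ) 1, ∀ x, R < |x| → d η x = 0)
    (h0 : ∃ x, d 0 x ≠ 0) (h1 : ∀ c : ℝ, ∃ x, e 0 x ≠ c * d 0 x) :
    ∃ σ > 0, ∃ δ > 0, ∀ η, 0 < η → η < δ → ∀ c : ℝ, σ ≤ ∫ x, (e η x - c * d η x) ^ 2 := by
  have cA := continuousOn_integral_mul he he he0
  have cB := continuousOn_integral_mul he hd he0
  have cC := continuousOn_integral_mul hd hd hd0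
  set A : ℝ → ℝ := fun η => ∫ x, e η x * e η x
  set B : ℝ → ℝ := fun η => ∫ x, e η x * d η x
  set C : ℝ → ℝ := fun η => ∫ x, d η x * d η x
  have h01 : (0 : ℝ) ∈ Icc (0 : ℝ) 1 := by simp
  have ce : ∀ η, Continuous (e η) := fun η => he.comp (by fun_prop : Continuous fun x => (η, x))
  have cd : ∀ η, Continuous (d η) := fun η => hd.comp (by fun_prop : Continuous fun x => (η, x))
  have expand : ∀ η ∈ Icc (0 : ℝ) 1, ∀ c : ℝ,
      ∫ x, (e η x - c * d η x) ^ 2 = A η - 2 * c * B η + c ^ 2 * C η := by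
    intro η hη c
    have := integral_add_mul_sq (ce η) (cd η) (he0 η hη) (hd0 η hη) 1 (-c)
    have e2 : ∀ x, (e η x - c * d η x) ^ 2 = (1 * e η x + -c * d η x) ^ 2 := fun x => by ring
    simp_rw [e2, this]
    ring
  have hC0 : 0 < C 0 := by
    obtain ⟨x, hx⟩ := h0
    have := integral_sq_pos (cd 0) (hd0 0 h01) hx
    simpa only [C, sq] using this
  -- `A - B² / C` is the squared distance to the line, attained at `c = B / C`. It is positive at
  -- `0` by linear independence and continuous there, so half its value serves as `σ`.
  have hD0 : 0 < A 0 - B 0 ^ 2 / C 0 := by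
    obtain ⟨x, hx⟩ := h1 (B 0 / C 0)
    have := integral_sq_pos (f := fun x => e 0 x - B 0 / C 0 * d 0 x) (x := x) (R := R)
      ((ce 0).sub (continuous_const.mul (cd 0)))
      (fun x hx => by simp [he0 0 h01 x hx, hd0 0 h01 x hx]) (sub_ne_zero.mpr hx)
    rw [expand 0 h01] at this
    have e3 : A 0 - 2 * (B 0 / C 0) * B 0 + (B 0 / C 0) ^ 2 * C 0 = A 0 - B 0 ^ 2 / C 0 := by
      field_simp
      ring
    rwa [e3] at this
  have cD : ContinuousWithinAt (fun η => A η - B η ^ 2 / C η) (Icc 0 1) 0 :=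
    (cA 0 h01).sub (((cB 0 h01).pow 2).div (cC 0 h01) hC0.ne')
  have ev1 := cD.eventually (lt_mem_nhds (half_lt_self hD0))
  have ev2 := (cC 0 h01).eventually (lt_mem_nhds hC0)
  obtain ⟨δ, hδ, hball⟩ := Metric.mem_nhdsWithin_iff.mp (ev1.and ev2)
  refine ⟨_, half_pos hD0, min δ 1, lt_min hδ one_pos, fun η hη hηδ c => ?_⟩
  have hη1 : η ∈ Icc (0 : ℝ) 1 := ⟨hη.le, (hηδ.trans_le (min_le_right _ _)).le⟩
  obtain ⟨g1, g2⟩ := hball ⟨by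
    simpa [abs_of_pos hη] using hηδ.trans_le (min_le_left _ _), hη1⟩
  rw [expand η hη1]
  have g3 : 0 ≤ (c * C η - B η) ^ 2 / C η := by positivity
  have g4 : (c * C η - B η) ^ 2 / C η = c ^ 2 * C η - 2 * c * B η + B η ^ 2 / C η := by
    field_simp
    ring
  linarith

/-! ### Even and odd parts of a translated bump -/

/-- The even part of `x ↦ q (x + η)`, for even `q`. -/
def bumpEven (q : ℝ → ℝ) (η x : ℝ) : ℝ := (q (x + η) + q (x - η)) / 2

/-- The odd part of `x ↦ q (x + η)`, for even `q`. -/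
def bumpOdd (q : ℝ → ℝ) (η x : ℝ) : ℝ := (q (x + η) - q (x - η)) / 2

/-- The symmetric difference quotient of `q`, extended by `deriv q` at `η = 0`. -/
def bumpSlope (q : ℝ → ℝ) (η x : ℝ) : ℝ := (∫ s in (-1 : ℝ)..1, deriv q (x + η * s)) / 2

section Bump

variable {q : ℝ → ℝ} {R : ℝ}

/-- The fundamental theorem of calculus in `s`. This renormalizes the vanishing odd part so that it
has the nontrivial limit `q'` at `η = 0`. -/
theorem mul_bumpSlope (hq : ContDiff ℝ 1 q) (η x : ℝ) :
    η * bumpSlope q η x = bumpOdd q η x := by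
  have hd : Continuous (deriv q) := hq.continuous_deriv le_rfl
  have h := intervalIntegral.integral_eq_sub_of_hasDerivAt (a := -1) (b := 1)
    (f := fun s => q (x + η * s)) (f' := fun s => deriv q (x + η * s) * η)
    (fun s _ => by
      have h1 : HasDerivAt (fun s : ℝ => x + η * s) η s := by
        simpa using ((hasDerivAt_id s).const_mul η).const_add x
      exact ((hq.differentiable one_ne_zero _).hasDerivAt).comp s h1)
    (by
      apply Continuous.intervalIntegrable
      fun_prop)
  rw [intervalIntegral.integral_mul_const] at h
  rw [bumpSlope, bumpOdd, ← mul_div_assoc, mul_comm η, h]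
  ring_nf

theorem bumpSlope_zero (x : ℝ) : bumpSlope q 0 x = deriv q x := by
  simp [bumpSlope]
  ring

theorem continuous_bumpSlope (hq : ContDiff ℝ 1 q) :
    Continuous (Function.uncurry (bumpSlope q)) := by
  have hd : Continuous (deriv q) := hq.continuous_deriv le_rfl
  have := intervalIntegral.continuous_parametric_intervalIntegral_of_continuous' (μ := volume)
    (f := fun (p : ℝ × ℝ) s => deriv q (p.2 + p.1 * s)) (by unfold Function.uncurry; fun_prop) (-1) 1
  exact this.div_const 2

theorem continuous_bumpEven (hq : Continuous q) : Continuous (Function.uncurry (bumpEven q)) := by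
  unfold Function.uncurry bumpEven
  fun_prop

theorem continuous_bumpOdd (hq : Continuous q) : Continuous (Function.uncurry (bumpOdd q)) := by
  unfold Function.uncurry bumpOdd
  fun_prop

theorem translate_eq_zero (hR : ∀ x, R < |x| → q x = 0) {η x : ℝ} (hx : R + |η| < |x|) :
    q (x + η) = 0 ∧ q (x - η) = 0 := by
  refine ⟨hR _ ?_, hR _ ?_⟩
  · have := abs_sub_abs_le_abs_sub x (-η)
    rw [abs_neg, sub_neg_eq_add] at this
    linarith
  · have := abs_sub_abs_le_abs_sub x η
    linarith

theorem bumpEven_eq_zero (hR : ∀ x, R < |x| → q x = 0) {η x : ℝ} (hx : R + |η| < |x|) :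
    bumpEven q η x = 0 := by
  simp [bumpEven, translate_eq_zero hR hx]

theorem bumpOdd_eq_zero (hR : ∀ x, R < |x| → q x = 0) {η x : ℝ} (hx : R + |η| < |x|) :
    bumpOdd q η x = 0 := by
  simp [bumpOdd, translate_eq_zero hR hx]

theorem deriv_eq_zero_of_lt_abs (hR : ∀ x, R < |x| → q x = 0) {x : ℝ} (hx : R < |x|) :
    deriv q x = 0 := by
  have : q =ᶠ[𝓝 x] fun _ => 0 :=
    (continuous_abs.continuousAt.eventually (lt_mem_nhds hx)).mono fun y hy => hR y hy
  rw [this.deriv_eq, deriv_const]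

theorem bumpSlope_eq_zero (hR : ∀ x, R < |x| → q x = 0) {η x : ℝ} (hx : R + |η| < |x|) :
    bumpSlope q η x = 0 := by
  have : ∀ s ∈ uIcc (-1 : ℝ) 1, deriv q (x + η * s) = 0 := by
    intro s hs
    rw [uIcc_of_le (by norm_num)] at hs
    refine deriv_eq_zero_of_lt_abs hR ?_
    have h1 := abs_sub_abs_le_abs_sub x (-(η * s))
    have h2 : |η * s| ≤ |η| := by
      rw [abs_mul]
      exact mul_le_of_le_one_right (abs_nonneg _) (abs_le.mpr hs)
    rw [abs_neg, sub_neg_eq_add] at h1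
    linarith
  rw [bumpSlope, intervalIntegral.integral_congr (g := fun _ => 0) this]
  simp

theorem exists_deriv_ne_zero (hq : ContDiff ℝ 1 q) (hR : ∀ x, R < |x| → q x = 0) (h1 : q 0 ≠ 0) :
    ∃ x, x ≠ 0 ∧ deriv q x ≠ 0 := by
  by_contra! h
  have hd : Continuous (deriv q) := hq.continuous_deriv le_rfl
  have h' : ∀ x, deriv q x = 0 := by
    have : deriv q = fun _ => 0 := Continuous.ext_on (dense_compl_singleton (0 : ℝ)) hd
      continuous_const fun x hx => h x hx
    exact fun x => congrFun this x
  have := is_const_of_deriv_eq_zero (hq.differentiable one_ne_zero) h' 0 (|R| + 1)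
  rw [hR (|R| + 1)] at this
  · exact h1 this
  · rw [abs_of_nonneg (by positivity)]
    linarith [le_abs_self R]

/-- A function with `x q(x) = c q'(x)` is a Gaussian, which is not compactly supported. -/
theorem exists_id_mul_ne_mul_deriv (hq : ContDiff ℝ 1 q) (hR : ∀ x, R < |x| → q x = 0)
    (h1 : q 0 ≠ 0) (c : ℝ) : ∃ x, x * q x ≠ c * deriv q x := by
  by_contra! h
  rcases eq_or_ne c 0 with rfl | hc
  · have hz : ∀ x ∈ ({0}ᶜ : Set ℝ), q x = 0 := fun x hx =>
      (mul_eq_zero.mp ((h x).trans (zero_mul _))).resolve_left hx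
    have : q = fun _ => 0 := Continuous.ext_on (dense_compl_singleton (0 : ℝ)) hq.continuous
      continuous_const hz
    exact h1 (congrFun this 0)
  have hder : ∀ x, HasDerivAt (fun x => q x * Real.exp (-(x ^ 2 / (2 * c)))) 0 x := by
    intro x
    have g1 := (hq.differentiable one_ne_zero x).hasDerivAt
    have g2 : HasDerivAt (fun x : ℝ => -(x ^ 2 / (2 * c))) (-(2 * x / (2 * c))) x := by
      simpa using! (((hasDerivAt_id x).pow 2).div_const (2 * c)).neg
    refine (g1.mul g2.exp).congr_deriv ?_
    have g3 := h x
    field_simp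
    linear_combination -Real.exp (-(x ^ 2 / (2 * c))) * g3
  have := is_const_of_deriv_eq_zero (fun x => (hder x).differentiableAt)
    (fun x => (hder x).deriv) 0 (|R| + 1)
  simp only [hR (|R| + 1) (by
    rw [abs_of_nonneg (by positivity : 0 ≤ |R| + 1)]
    linarith [le_abs_self R])] at this
  simp [h1] at this

/-- Bounds the conditional variance of `Re V` given `Re W`. Since `c` is arbitrary, a factor `η` can
be absorbed in it and the degenerating direction replaced by `-x * bumpSlope`, with limit `-x
q'(x)`. The limit `q` of the even part is independent of it: at `x = 0` the former is nonzero and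
the latter vanishes. -/
theorem exists_pos_le_integral_bumpEven (hq : ContDiff ℝ 1 q) (hR : ∀ x, R < |x| → q x = 0)
    (h1 : q 0 ≠ 0) : ∃ σ > 0, ∃ δ > 0, ∀ η, 0 < η → η < δ → ∀ c : ℝ,
      σ ≤ ∫ x, (bumpEven q η x - c * (-x * bumpOdd q η x)) ^ 2 := by
  have aux : ∀ η ∈ Icc (0 : ℝ) 1, ∀ x : ℝ, R + 1 < |x| → R + |η| < |x| := fun η hη x hx => by
    rw [abs_of_nonneg hη.1]
    linarith [hη.2]
  obtain ⟨σ, hσ, δ, hδ, h⟩ := exists_pos_le_integral_sub_sq (R := R + 1) (e := bumpEven q)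
    (d := fun η x => -x * bumpSlope q η x) (continuous_bumpEven hq.continuous)
    (by
      have := continuous_bumpSlope hq
      unfold Function.uncurry at *
      fun_prop)
    (fun η hη x hx => bumpEven_eq_zero hR (aux η hη x hx))
    (fun η hη x hx => by simp [bumpSlope_eq_zero hR (aux η hη x hx)])
    (by
      obtain ⟨x, hx, hx'⟩ := exists_deriv_ne_zero hq hR h1
      exact ⟨x, by simp [bumpSlope_zero, hx, hx']⟩)
    (fun c => ⟨0, by simpa [bumpEven] using h1⟩)
  refine ⟨σ, hσ, δ, hδ, fun η hη hηδ c => (h η hη hηδ (c * η)).trans_eq ?_⟩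
  congr 1
  ext x
  rw [← mul_bumpSlope hq]
  ring

/-- The counterpart for `Im W` given `Im V`. After the same rescaling the limits are `-x q` and
`q'`, and proportionality would force `q` to be zero away from the origin or a Gaussian. -/
theorem exists_pos_le_integral_bumpOdd (hq : ContDiff ℝ 1 q) (hR : ∀ x, R < |x| → q x = 0)
    (h1 : q 0 ≠ 0) : ∃ σ > 0, ∃ δ > 0, ∀ η, 0 < η → η < δ → ∀ c : ℝ,
      σ ≤ ∫ x, (-x * bumpEven q η x - c * bumpOdd q η x) ^ 2 := by
  have aux : ∀ η ∈ Icc (0 : ℝ) 1, ∀ x : ℝ, R + 1 < |x| → R + |η| < |x| := fun η hη x hx => by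
    rw [abs_of_nonneg hη.1]
    linarith [hη.2]
  obtain ⟨σ, hσ, δ, hδ, h⟩ := exists_pos_le_integral_sub_sq (R := R + 1)
    (e := fun η x => -x * bumpEven q η x)
    (d := bumpSlope q)
    (by
      have := continuous_bumpEven hq.continuous
      unfold Function.uncurry at *
      fun_prop) (continuous_bumpSlope hq)
    (fun η hη x hx => by simp [bumpEven_eq_zero hR (aux η hη x hx)])
    (fun η hη x hx => bumpSlope_eq_zero hR (aux η hη x hx))
    (by
      obtain ⟨x, hx, hx'⟩ := exists_deriv_ne_zero hq hR h1
      exact ⟨x, by simp [bumpSlope_zero, hx']⟩)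
    (fun c => by
      obtain ⟨x, hx⟩ := exists_id_mul_ne_mul_deriv hq hR h1 (-c)
      refine ⟨x, fun h => hx ?_⟩
      simp only [bumpSlope_zero, bumpEven, add_zero, sub_zero] at h
      linear_combination -h)
  refine ⟨σ, hσ, δ, hδ, fun η hη hηδ c => (h η hη hηδ (c * η)).trans_eq ?_⟩
  congr 1
  ext x
  rw [← mul_bumpSlope hq]
  ring

/-- Near the right end of the support of `q (x - η)`, the other translate `q (x + η)` vanishes. -/
theorem exists_two_translate_ne_zero (hq : Continuous q) (hR : ∀ x, R < |x| → q x = 0)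
    (h1 : q 0 ≠ 0) {η : ℝ} (hη : 0 < η) :
    ∃ x y, x ≠ y ∧ (q (x - η) ≠ 0 ∧ q (x + η) = 0) ∧ (q (y - η) ≠ 0 ∧ q (y + η) = 0) := by
  set S : Set ℝ := {x | q x ≠ 0}
  have hbdd : BddAbove S := ⟨R, fun x hx => by
    by_contra! h
    exact hx (hR x (h.trans_le (le_abs_self x)))⟩
  have hne : S.Nonempty := ⟨0, h1⟩
  obtain ⟨y, hyS, hy⟩ := exists_lt_of_lt_csSup hne (sub_lt_self (sSup S) hη)
  have hopen : IsOpen S := isOpen_ne_fun hq continuous_const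
  obtain ⟨ε, hε, hball⟩ := Metric.isOpen_iff.mp hopen y hyS
  have hz : ∀ z, sSup S - η < z → q (z + 2 * η) = 0 := by
    intro z hz
    by_contra h
    have := le_csSup hbdd (show z + 2 * η ∈ S from h)
    linarith
  refine ⟨y + η, y + ε / 2 + η, by simp [hε.ne'], ⟨by simpa [S] using hyS, ?_⟩, ⟨?_, ?_⟩⟩
  · rw [add_assoc, ← two_mul]
    exact hz y hy
  · rw [add_sub_cancel_right]
    exact hball (by simp [abs_of_pos hε, hε])
  · rw [add_assoc, ← two_mul]
    exact hz _ (by linarith)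

/-- Where only the translate `q (x - η)` survives, the combination equals `(a + b x) q (x - η) / 2`.
Vanishing at two such points forces `a = b = 0`. The odd case below differs only by a sign. -/
theorem integral_bumpEven_sq_pos (hq : Continuous q) (hR : ∀ x, R < |x| → q x = 0)
    (h1 : q 0 ≠ 0) {η : ℝ} (hη : 0 < η) {a b : ℝ} (hab : a ≠ 0 ∨ b ≠ 0) :
    0 < ∫ x, (a * bumpEven q η x + b * (-x * bumpOdd q η x)) ^ 2 := by
  have c1 := continuous_bumpEven hq
  have c2 := continuous_bumpOdd hq
  obtain ⟨x, hx⟩ : ∃ x, a * bumpEven q η x + b * (-x * bumpOdd q η x) ≠ 0 := by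
    obtain ⟨x, y, hxy, ⟨h2, h3⟩, h4, h5⟩ := exists_two_translate_ne_zero hq hR h1 hη
    by_contra! h
    have e1 := h x
    have e2 := h y
    simp only [bumpEven, bumpOdd, h3, h5] at e1 e2
    have e3 : a + b * x = 0 := (mul_eq_zero.mp (by linear_combination 2 * e1 :
      (a + b * x) * q (x - η) = 0)).resolve_right h2
    have e4 : a + b * y = 0 := (mul_eq_zero.mp (by linear_combination 2 * e2 :
      (a + b * y) * q (y - η) = 0)).resolve_right h4
    have e5 : b = 0 := (mul_eq_zero.mp (by linear_combination e3 - e4 :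
      b * (x - y) = 0)).resolve_right (sub_ne_zero.mpr hxy)
    subst e5
    simp at e3 hab
    exact hab e3
  refine integral_sq_pos (R := R + |η|) ?_ (fun x hx => ?_) hx
  · unfold Function.uncurry at c1 c2
    have d1 : Continuous fun x => bumpEven q η x := c1.comp (by fun_prop : Continuous fun x => (η, x))
    have d2 : Continuous fun x => bumpOdd q η x := c2.comp (by fun_prop : Continuous fun x => (η, x))
    fun_prop
  · simp [bumpEven_eq_zero hR hx, bumpOdd_eq_zero hR hx]

theorem integral_bumpOdd_sq_pos (hq : Continuous q) (hR : ∀ x, R < |x| → q x = 0)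
    (h1 : q 0 ≠ 0) {η : ℝ} (hη : 0 < η) {a b : ℝ} (hab : a ≠ 0 ∨ b ≠ 0) :
    0 < ∫ x, (a * bumpOdd q η x + b * (-x * bumpEven q η x)) ^ 2 := by
  have c1 := continuous_bumpEven hq
  have c2 := continuous_bumpOdd hq
  obtain ⟨x, hx⟩ : ∃ x, a * bumpOdd q η x + b * (-x * bumpEven q η x) ≠ 0 := by
    obtain ⟨x, y, hxy, ⟨h2, h3⟩, h4, h5⟩ := exists_two_translate_ne_zero hq hR h1 hη
    by_contra! h
    have e1 := h x
    have e2 := h y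
    simp only [bumpEven, bumpOdd, h3, h5] at e1 e2
    have e3 : a + b * x = 0 := (mul_eq_zero.mp (by linear_combination -2 * e1 :
      (a + b * x) * q (x - η) = 0)).resolve_right h2
    have e4 : a + b * y = 0 := (mul_eq_zero.mp (by linear_combination -2 * e2 :
      (a + b * y) * q (y - η) = 0)).resolve_right h4
    have e5 : b = 0 := (mul_eq_zero.mp (by linear_combination e3 - e4 :
      b * (x - y) = 0)).resolve_right (sub_ne_zero.mpr hxy)
    subst e5
    simp at e3 hab
    exact hab e3
  refine integral_sq_pos (R := R + |η|) ?_ (fun x hx => ?_) hx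
  · unfold Function.uncurry at c1 c2
    have d1 : Continuous fun x => bumpEven q η x := c1.comp (by fun_prop : Continuous fun x => (η, x))
    have d2 : Continuous fun x => bumpOdd q η x := c2.comp (by fun_prop : Continuous fun x => (η, x))
    fun_prop
  · simp [bumpEven_eq_zero hR hx, bumpOdd_eq_zero hR hx]

end Bump

/-! ### One-dimensional Gaussian estimates -/

/-- The Gaussian density is at most `(2πσ)^{-1/2}` and the Lebesgue integral is `√(π/κ)`. The bound
does not see the centre `a`, so it can be used with `a` depending on conditioning variables. -/
theorem lintegral_exp_neg_mul_sq_gaussianReal_le (m a : ℝ) {v : NNReal} {σ κ : ℝ} (hσ : 0 < σ)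
    (hv : σ ≤ v) (hκ : 0 < κ) :
    ∫⁻ u, ENNReal.ofReal (Real.exp (-(κ * (u - a) ^ 2))) ∂gaussianReal m v ≤
      ENNReal.ofReal (1 / √(2 * σ * κ)) := by
  have hv0 : (0 : ℝ) < v := hσ.trans_le hv
  have hv' : v ≠ 0 := by
    rintro rfl
    simp at hv0
  have hi : Integrable fun u : ℝ => Real.exp (-(κ * (u - a) ^ 2)) := by
    simpa [neg_mul] using (integrable_exp_neg_mul_sq hκ).comp_sub_right a
  have h1 : ∫⁻ u : ℝ, ENNReal.ofReal (Real.exp (-(κ * (u - a) ^ 2))) =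
      ENNReal.ofReal √(Real.pi / κ) := by
    rw [← ofReal_integral_eq_lintegral_ofReal hi (.of_forall fun u => (Real.exp_pos _).le),
      integral_sub_right_eq_self (fun u : ℝ => Real.exp (-(κ * u ^ 2))) a, ← integral_gaussian]
    simp [neg_mul]
  have h2 : ∀ u, gaussianPDF m v u ≤ ENNReal.ofReal (√(2 * Real.pi * σ))⁻¹ := fun u => by
    refine ENNReal.ofReal_le_ofReal ?_
    rw [gaussianPDFReal]
    refine (mul_le_of_le_one_right (by positivity) (Real.exp_le_one_iff.mpr ?_)).trans ?_
    · rw [neg_div]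
      exact neg_nonpos.mpr (by positivity)
    · gcongr
  rw [gaussianReal_of_var_ne_zero _ hv', lintegral_withDensity_eq_lintegral_mul _
    (measurable_gaussianPDF m v) (by fun_prop)]
  calc ∫⁻ u, (gaussianPDF m v * fun u => ENNReal.ofReal (Real.exp (-(κ * (u - a) ^ 2)))) u
      ≤ ∫⁻ u, ENNReal.ofReal (√(2 * Real.pi * σ))⁻¹ *
          ENNReal.ofReal (Real.exp (-(κ * (u - a) ^ 2))) :=
        lintegral_mono fun u => mul_le_mul_left (h2 u) _
    _ = ENNReal.ofReal (1 / √(2 * σ * κ)) := by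
        rw [lintegral_const_mul _ (by fun_prop), h1, ← ENNReal.ofReal_mul (by positivity),
          ← Real.sqrt_inv, ← Real.sqrt_mul (by positivity), one_div, ← Real.sqrt_inv]
        congr 2
        have := Real.pi_pos
        field_simp

/-- All the intervals lie in one compact interval, on which the density has a positive minimum. -/
theorem exists_pos_le_gaussianReal_Icc (m : ℝ) {v : NNReal} (hv : v ≠ 0) (R : ℝ) :
    ∃ d : ℝ, 0 < d ∧ ∀ a ε : ℝ, |a| ≤ R → 0 < ε → ε ≤ 1 →
      ENNReal.ofReal (d * ε) ≤ gaussianReal m v (Icc (a - ε) (a + ε)) := by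
  have hc : ContinuousOn (gaussianPDFReal m v) (Icc (-(|R| + 1)) (|R| + 1)) := by
    unfold gaussianPDFReal
    fun_prop
  obtain ⟨x₀, -, hx₀⟩ := isCompact_Icc.exists_isMinOn
    (nonempty_Icc.mpr (by linarith [abs_nonneg R])) hc
  refine ⟨2 * gaussianPDFReal m v x₀, by
    have := gaussianPDFReal_pos m v x₀ hv
    positivity, fun a ε ha hε hε1 => ?_⟩
  rw [gaussianReal_apply _ hv]
  calc ENNReal.ofReal (2 * gaussianPDFReal m v x₀ * ε)
      = ∫⁻ _ in Icc (a - ε) (a + ε), ENNReal.ofReal (gaussianPDFReal m v x₀) := by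
        rw [setLIntegral_const, Real.volume_Icc,
          ← ENNReal.ofReal_mul (gaussianPDFReal_nonneg _ _ _)]
        congr 1
        ring
    _ ≤ _ := by
        refine setLIntegral_mono (measurable_gaussianPDF m v) fun x hx =>
          ENNReal.ofReal_le_ofReal (hx₀ ?_)
        have h1 := abs_le.mp ha
        have h2 := le_abs_self R
        exact ⟨by linarith [hx.1], by linarith [hx.2]⟩

theorem gaussianReal_eq_map (m : ℝ) (v : NNReal) :
    gaussianReal m v = (gaussianReal 0 1).map fun x => √v * x + m := by
  have h : (fun x : ℝ => √v * x + m) = (fun x => x + m) ∘ fun x => √v * x := rfl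
  rw [h, ← Measure.map_map (by fun_prop) (by fun_prop), gaussianReal_map_const_mul,
    gaussianReal_map_add_const]
  congr 1
  · simp
  · ext
    simp

/-- The moments of a real Gaussian variable are bounded in terms of its mean and variance. -/
theorem exists_moment_bound (L : ℝ) (j : ℕ) : ∃ G : ℝ, 0 ≤ G ∧
    ∀ {Ω : Type*} [MeasurableSpace Ω] {P : Measure Ω} {Z : Ω → ℝ}, HasGaussianLaw Z P →
      |∫ ω, Z ω ∂P| ≤ L → Var[Z; P] ≤ L ^ 2 →
      ∫⁻ ω, ENNReal.ofReal (|Z ω| ^ j) ∂P ≤ ENNReal.ofReal G := by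
  -- `Z` has the law of `√v N + m` with `N` standard, and `√v` and `|m|` are both at most `|L|`.
  refine ⟨∫ x, (|L| * (|x| + 1)) ^ j ∂gaussianReal 0 1,
    integral_nonneg fun x => by positivity, ?_⟩
  intro Ω _ P Z hZ hm hv
  have hi : Integrable (fun x : ℝ => (|L| * (|x| + 1)) ^ j) (gaussianReal 0 1) := by
    simp_rw [mul_pow]
    refine Integrable.const_mul ?_ _
    have h1 : MemLp (fun x : ℝ => |x| + 1) j (gaussianReal 0 1) :=
      ((IsGaussian.memLp_id (gaussianReal 0 1) j (by simp)).norm).add (memLp_const 1)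
    refine (h1.integrable_norm_pow').congr (.of_forall fun x => ?_)
    simp only [Real.norm_eq_abs]
    rw [abs_of_nonneg (by positivity : 0 ≤ |x| + 1)]
  rw [ofReal_integral_eq_lintegral_ofReal hi (.of_forall fun x => by positivity),
    ← lintegral_map' (f := fun z : ℝ => ENNReal.ofReal (|z| ^ j)) (by fun_prop) hZ.aemeasurable,
    hZ.map_eq_gaussianReal, gaussianReal_eq_map, lintegral_map (by fun_prop) (by fun_prop)]
  refine lintegral_mono fun x => ENNReal.ofReal_le_ofReal ?_
  have hs : √(Var[Z; P].toNNReal : ℝ) ≤ |L| := by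
    rw [Real.coe_toNNReal _ (variance_nonneg _ _), ← Real.sqrt_sq_eq_abs]
    exact Real.sqrt_le_sqrt hv
  gcongr
  calc |√(Var[Z; P].toNNReal : ℝ) * x + ∫ ω, Z ω ∂P|
      ≤ |√(Var[Z; P].toNNReal : ℝ) * x| + |∫ ω, Z ω ∂P| := abs_add_le _ _
    _ ≤ |L| * |x| + |L| := by
        rw [abs_mul, abs_of_nonneg (Real.sqrt_nonneg _)]
        exact add_le_add (by gcongr) (hm.trans (le_abs_self L))
    _ = |L| * (|x| + 1) := by ring

/-! ### The kernel of the absolute moments -/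

/-- `|v|^k exp (-k |ξ v - w|² / (α |v|²))`. -/
def momentKernel (k : ℕ) (ξ α : ℝ) (v w : ℂ) : ℝ :=
  ‖v‖ ^ k * Real.exp (-(k * ‖(ξ : ℂ) * v - w‖ ^ 2 / (α * ‖v‖ ^ 2)))

theorem momentKernel_nonneg (k : ℕ) (ξ α : ℝ) (v w : ℂ) : 0 ≤ momentKernel k ξ α v w := by
  unfold momentKernel
  positivity

theorem momentKernel_le_norm_pow (k : ℕ) (ξ : ℝ) {α : ℝ} (hα : 0 ≤ α) (v w : ℂ) :
    momentKernel k ξ α v w ≤ ‖v‖ ^ k := by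
  refine mul_le_of_le_one_right (by positivity) (Real.exp_le_one_iff.mpr ?_)
  exact neg_nonpos.mpr (by positivity)

theorem measurable_momentKernel (k : ℕ) (ξ α : ℝ) :
    Measurable fun p : ℂ × ℂ => momentKernel k ξ α p.1 p.2 := by
  unfold momentKernel
  fun_prop

theorem norm_sq_smul_sub (ξ : ℝ) (v w : ℂ) :
    ‖(ξ : ℂ) * v - w‖ ^ 2 = (ξ * v.re - w.re) ^ 2 + (ξ * v.im - w.im) ^ 2 := by
  rw [← Complex.normSq_eq_norm_sq, Complex.normSq_apply]
  simp
  ring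

theorem norm_sq_eq_re_im (v : ℂ) : ‖v‖ ^ 2 = v.re ^ 2 + v.im ^ 2 := by
  rw [← Complex.normSq_eq_norm_sq, Complex.normSq_apply]
  ring

/-- Removes `Re v` and `Im w` from the denominators, so that they can be integrated out with the
other two variables frozen. If `|Re v| ≤ T`, then `|v| ≤ 2T`, and `2T` may replace `|v|`. Otherwise
`|ξ Re v - Re w| ≥ ξ|Re v|/2` and `|v|² ≤ 2 (Re v)²`, so the exponential is at most `exp(-ξ²/(8α))`.
-/
theorem momentKernel_le {k : ℕ} (hk : 1 ≤ k) {ξ α : ℝ} (hξ : 0 < ξ) (hα : 0 < α) (v w : ℂ)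
    {T : ℝ} (hT : T = 2 * |w.re| / ξ + |v.im|) :
    momentKernel k ξ α v w ≤
      (2 * T) ^ k * Real.exp (-(k * (ξ * v.re - w.re) ^ 2 / (α * (2 * T) ^ 2))) *
        Real.exp (-(k * (ξ * v.im - w.im) ^ 2 / (α * (2 * T) ^ 2))) + 8 / ξ ^ 2 * α * ‖v‖ ^ k := by
  have hT0 : 0 ≤ T := by rw [hT]; positivity
  have hk' : (1 : ℝ) ≤ k := by exact_mod_cast hk
  have hTim : |v.im| ≤ T := by
    rw [hT]
    exact le_add_of_nonneg_left (by positivity)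
  have hTre : 2 * |w.re| ≤ ξ * T := by
    have : ξ * T = 2 * |w.re| + ξ * |v.im| := by
      rw [hT]
      field_simp
    rw [this]
    exact le_add_of_nonneg_right (by positivity)
  have hr := norm_sq_eq_re_im v
  have him : v.im ^ 2 ≤ T ^ 2 := sq_le_sq.mpr (by rwa [abs_of_nonneg hT0])
  rcases le_or_gt |v.re| T with h | h
  · have hre : v.re ^ 2 ≤ T ^ 2 := sq_le_sq.mpr (by rwa [abs_of_nonneg hT0])
    refine le_add_of_le_of_nonneg ?_ (by positivity)
    -- At `v = 0` the quotient is `0` by convention and the exponential is `1`; the kernel vanishes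
    -- only through the factor `0 ^ k` with `k ≥ 1`.
    rcases eq_or_ne v 0 with rfl | hv
    · rw [momentKernel, norm_zero, zero_pow (by omega), zero_mul]
      positivity
    have hv0 : 0 < ‖v‖ := norm_pos_iff.mpr hv
    have hr2 : ‖v‖ ^ 2 ≤ (2 * T) ^ 2 := by nlinarith [sq_nonneg T]
    have hr1 : ‖v‖ ≤ 2 * T := (pow_le_pow_iff_left₀ hv0.le (by positivity) two_ne_zero).mp hr2
    rw [mul_assoc, ← Real.exp_add, momentKernel, norm_sq_smul_sub, ← neg_add, ← add_div, ← mul_add]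
    gcongr
  · refine le_add_of_nonneg_of_le (by positivity) ?_
    have hre0 : 0 < |v.re| := hT0.trans_lt h
    have hre : T ^ 2 ≤ v.re ^ 2 := sq_le_sq.mpr (by rw [abs_of_nonneg hT0]; exact h.le)
    have hv0 : 0 < ‖v‖ ^ 2 := by
      rw [hr, ← sq_abs v.re]
      positivity
    have h1 : ξ * |v.re| / 2 ≤ |ξ * v.re - w.re| := by
      have := abs_sub_abs_le_abs_sub (ξ * v.re) w.re
      rw [abs_mul, abs_of_pos hξ] at this
      have h2 : ξ * T ≤ ξ * |v.re| := by gcongr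
      linarith
    have h2 : ξ ^ 2 / 4 * v.re ^ 2 ≤ (ξ * v.re - w.re) ^ 2 := by
      have := pow_le_pow_left₀ (by positivity) h1 2
      rw [sq_abs, div_pow, mul_pow, sq_abs] at this
      linarith
    have h3 : ξ ^ 2 / (8 * α) ≤ k * ‖(ξ : ℂ) * v - w‖ ^ 2 / (α * ‖v‖ ^ 2) := by
      rw [div_le_div_iff₀ (by positivity) (by positivity), norm_sq_smul_sub]
      have h4 : ξ ^ 2 * ‖v‖ ^ 2 ≤ 8 * ((ξ * v.re - w.re) ^ 2 + (ξ * v.im - w.im) ^ 2) := by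
        rw [hr]
        nlinarith [sq_nonneg (ξ * v.im - w.im), sq_nonneg ξ]
      have h5 : (0 : ℝ) ≤ (ξ * v.re - w.re) ^ 2 + (ξ * v.im - w.im) ^ 2 := by positivity
      nlinarith [mul_le_mul_of_nonneg_right hk' (mul_nonneg h5 hα.le),
        mul_le_mul_of_nonneg_right h4 hα.le]
    have h6 : Real.exp (-(k * ‖(ξ : ℂ) * v - w‖ ^ 2 / (α * ‖v‖ ^ 2))) ≤ 8 / ξ ^ 2 * α := by
      refine (Real.exp_le_exp.mpr (neg_le_neg h3)).trans ?_
      -- The crude bound `exp(-y) ≤ 1/y` suffices, as only a factor `α` is needed.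
      have h7 : ξ ^ 2 / (8 * α) ≤ Real.exp (ξ ^ 2 / (8 * α)) := by
        linarith [Real.add_one_le_exp (ξ ^ 2 / (8 * α))]
      rw [Real.exp_neg]
      calc (Real.exp (ξ ^ 2 / (8 * α)))⁻¹ ≤ (ξ ^ 2 / (8 * α))⁻¹ :=
            inv_anti₀ (by positivity) h7
        _ = 8 / ξ ^ 2 * α := by field_simp
    rw [momentKernel, mul_comm]
    gcongr

/-- Here `|v|² ≥ 2` and `|ξv - w|² ≤ 2α`, so the exponent is at least `-k`. -/
theorem le_momentKernel (k : ℕ) {ξ α : ℝ} (hα : 0 < α) {v w : ℂ}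
    (h1 : 1 ≤ v.re) (h2 : 1 ≤ v.im) (h3 : |ξ * v.re - w.re| ≤ √α) (h4 : |ξ * v.im - w.im| ≤ √α) :
    Real.exp (-k) ≤ momentKernel k ξ α v w := by
  have hr := norm_sq_eq_re_im v
  have hr2 : 2 ≤ ‖v‖ ^ 2 := by nlinarith
  have hr1 : 1 ≤ ‖v‖ := by nlinarith [norm_nonneg v]
  have g3 := pow_le_pow_left₀ (abs_nonneg _) h3 2
  have g4 := pow_le_pow_left₀ (abs_nonneg _) h4 2
  rw [sq_abs, Real.sq_sqrt hα.le] at g3 g4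
  rw [momentKernel]
  refine le_trans (Real.exp_le_exp.mpr (neg_le_neg ?_))
    (le_mul_of_one_le_left (Real.exp_pos _).le (one_le_pow₀ hr1))
  rw [div_le_iff₀ (by positivity), norm_sq_smul_sub]
  have : (ξ * v.re - w.re) ^ 2 + (ξ * v.im - w.im) ^ 2 ≤ α * ‖v‖ ^ 2 := by nlinarith
  gcongr

/-! ### Kernel moments of a nondegenerate complex Gaussian pair -/

section Independence

variable {Ω : Type*} [MeasurableSpace Ω] {P : Measure Ω}

theorem lintegral_four_of_iIndepFun [IsProbabilityMeasure P] {f₀ f₁ f₂ f₃ : Ω → ℝ}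
    (h0 : AEMeasurable f₀ P) (h1 : AEMeasurable f₁ P) (h2 : AEMeasurable f₂ P)
    (h3 : AEMeasurable f₃ P) (hf : iIndepFun ![f₀, f₁, f₂, f₃] P)
    {g : (ℝ × ℝ) × (ℝ × ℝ) → ENNReal} (hg : Measurable g) :
    ∫⁻ ω, g ((f₀ ω, f₁ ω), (f₂ ω, f₃ ω)) ∂P =
      ∫⁻ a, ∫⁻ b, ∫⁻ c, ∫⁻ d, g ((a, b), (c, d))
        ∂(P.map f₃) ∂(P.map f₂) ∂(P.map f₁) ∂(P.map f₀) := by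
  have hm : ∀ i, AEMeasurable (![f₀, f₁, f₂, f₃] i) P := by
    intro i
    fin_cases i <;> assumption
  have i1 := hf.indepFun_prodMk_prodMk₀ hm 0 1 2 3 (by decide) (by decide) (by decide) (by decide)
  have i2 := hf.indepFun (i := 0) (j := 1) (by decide)
  have i3 := hf.indepFun (i := 2) (j := 3) (by decide)
  rw [indepFun_iff_map_prod_eq_prod_map_map ((hm 0).prodMk (hm 1)) ((hm 2).prodMk (hm 3))] at i1
  rw [indepFun_iff_map_prod_eq_prod_map_map (hm 0) (hm 1)] at i2
  rw [indepFun_iff_map_prod_eq_prod_map_map (hm 2) (hm 3)] at i3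
  rw [i2, i3] at i1
  rw [← lintegral_map' (f := g) hg.aemeasurable ((h0.prodMk h1).prodMk (h2.prodMk h3))]
  have := i1
  simp only [Matrix.cons_val] at this
  rw [this, lintegral_prod _ hg.aemeasurable, lintegral_prod]
  · refine lintegral_congr fun a => lintegral_congr fun b => ?_
    rw [lintegral_prod]
    exact (hg.comp (by fun_prop : Measurable fun y : ℝ × ℝ => ((a, b), y))).aemeasurable
  · exact hg.lintegral_prod_right'.aemeasurable

/-- Regressing the first component of each of two uncorrelated Gaussian pairs on the second
produces four independent variables. -/
theorem exists_iIndepFun_regression [IsProbabilityMeasure P] {A B A' B' : Ω → ℝ}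
    (hG : HasGaussianLaw (fun ω => ![A ω, B ω, A' ω, B' ω]) P)
    (h1 : cov[A, A'; P] = 0) (h2 : cov[A, B'; P] = 0) (h3 : cov[B, A'; P] = 0)
    (h4 : cov[B, B'; P] = 0) (hB : 0 < Var[B; P]) (hB' : 0 < Var[B'; P]) :
    ∃ c c' : ℝ, iIndepFun
      ![B, B', fun ω => A ω - c * B ω, fun ω => A' ω - c' * B' ω] P := by
  have hX : HasGaussianLaw (fun ω i => ![A, B, A', B'] i ω) P := by
    convert hG using 3 with ω i
    fin_cases i <;> rfl
  have mA : MemLp A 2 P := (hX.eval 0).memLp_two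
  have mB : MemLp B 2 P := (hX.eval 1).memLp_two
  have mA' : MemLp A' 2 P := (hX.eval 2).memLp_two
  have mB' : MemLp B' 2 P := (hX.eval 3).memLp_two
  have aB : AEMeasurable B P := mB.aemeasurable
  have aB' : AEMeasurable B' P := mB'.aemeasurable
  set c := cov[A, B; P] / Var[B; P] with hc
  set c' := cov[A', B'; P] / Var[B'; P] with hc'
  refine ⟨c, c', ?_⟩
  have mcB : MemLp (fun ω => c * B ω) 2 P := mB.const_mul c
  have mcB' : MemLp (fun ω => c' * B' ω) 2 P := mB'.const_mul c'
  have mU : MemLp (fun ω => A ω - c * B ω) 2 P := mA.sub mcB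
  have mU' : MemLp (fun ω => A' ω - c' * B' ω) 2 P := mA'.sub mcB'
  have k1 : cov[fun ω => A ω - c * B ω, B; P] = 0 := by
    rw [covariance_fun_sub_left mA mcB mB, covariance_const_mul_left, covariance_self aB, hc]
    field_simp
    ring
  have k2 : cov[fun ω => A' ω - c' * B' ω, B'; P] = 0 := by
    rw [covariance_fun_sub_left mA' mcB' mB', covariance_const_mul_left, covariance_self aB', hc']
    field_simp
    ring
  have k3 : cov[fun ω => A ω - c * B ω, B'; P] = 0 := by
    rw [covariance_fun_sub_left mA mcB mB', covariance_const_mul_left, h2, h4]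
    ring
  have k4 : cov[fun ω => A' ω - c' * B' ω, B; P] = 0 := by
    rw [covariance_fun_sub_left mA' mcB' mB, covariance_const_mul_left, covariance_comm, h3,
      covariance_comm, h4]
    ring
  have k5 : cov[fun ω => A ω - c * B ω, A'; P] = 0 := by
    rw [covariance_fun_sub_left mA mcB mA', covariance_const_mul_left, h1, h3]
    ring
  have k6 : cov[fun ω => A ω - c * B ω, fun ω => A' ω - c' * B' ω; P] = 0 := by
    rw [covariance_fun_sub_right mU mA' mcB', covariance_const_mul_right, k5, k3]
    ring
  have hgauss : HasGaussianLaw (fun ω i =>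
      ![B, B', fun ω => A ω - c * B ω, fun ω => A' ω - c' * B' ω] i ω) P := by
    have := hX.map_fun (ContinuousLinearMap.pi ![ContinuousLinearMap.proj 1,
      ContinuousLinearMap.proj 3, ContinuousLinearMap.proj 0 - c • ContinuousLinearMap.proj 1,
      ContinuousLinearMap.proj 2 - c' • ContinuousLinearMap.proj 3] : (Fin 4 → ℝ) →L[ℝ] Fin 4 → ℝ)
    refine this.congr (.of_forall fun ω => ?_)
    funext i
    fin_cases i <;> simp
  refine hgauss.iIndepFun_of_covariance_eq_zero fun i j hij => ?_
  fin_cases i <;> fin_cases j <;> first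
    | exact absurd rfl hij
    | simpa using h4
    | simpa using (covariance_comm _ _).trans h4
    | simpa using k1
    | simpa using (covariance_comm _ _).trans k1
    | simpa using k2
    | simpa using (covariance_comm _ _).trans k2
    | simpa using k3
    | simpa using (covariance_comm _ _).trans k3
    | simpa using k4
    | simpa using (covariance_comm _ _).trans k4
    | simpa using k6
    | simpa using (covariance_comm _ _).trans k6

/-- A jointly Gaussian complex pair whose real and imaginary parts are uncorrelated and
separately nondegenerate. -/
structure IsSplitGaussian (V W : Ω → ℂ) (P : Measure Ω) : Prop where
  hasGaussianLaw : HasGaussianLaw (fun ω => (V ω, W ω)) P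
  cov_V_V : cov[fun ω => (V ω).re, fun ω => (V ω).im; P] = 0
  cov_V_W : cov[fun ω => (V ω).re, fun ω => (W ω).im; P] = 0
  cov_W_V : cov[fun ω => (W ω).re, fun ω => (V ω).im; P] = 0
  cov_W_W : cov[fun ω => (W ω).re, fun ω => (W ω).im; P] = 0
  var_re_pos : ∀ a b : ℝ, a ≠ 0 ∨ b ≠ 0 → 0 < Var[fun ω => a * (V ω).re + b * (W ω).re; P]
  var_im_pos : ∀ a b : ℝ, a ≠ 0 ∨ b ≠ 0 → 0 < Var[fun ω => a * (V ω).im + b * (W ω).im; P]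

namespace IsSplitGaussian

variable {V W : Ω → ℂ}

theorem re_V (h : IsSplitGaussian V W P) : HasGaussianLaw (fun ω => (V ω).re) P :=
  h.hasGaussianLaw.map_fun (Complex.reCLM ∘L ContinuousLinearMap.fst ℝ ℂ ℂ)

theorem im_V (h : IsSplitGaussian V W P) : HasGaussianLaw (fun ω => (V ω).im) P :=
  h.hasGaussianLaw.map_fun (Complex.imCLM ∘L ContinuousLinearMap.fst ℝ ℂ ℂ)

theorem re_W (h : IsSplitGaussian V W P) : HasGaussianLaw (fun ω => (W ω).re) P :=
  h.hasGaussianLaw.map_fun (Complex.reCLM ∘L ContinuousLinearMap.snd ℝ ℂ ℂ)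

theorem im_W (h : IsSplitGaussian V W P) : HasGaussianLaw (fun ω => (W ω).im) P :=
  h.hasGaussianLaw.map_fun (Complex.imCLM ∘L ContinuousLinearMap.snd ℝ ℂ ℂ)

theorem re_sub (h : IsSplitGaussian V W P) (c : ℝ) :
    HasGaussianLaw (fun ω => (V ω).re - c * (W ω).re) P :=
  h.hasGaussianLaw.map_fun (Complex.reCLM ∘L ContinuousLinearMap.fst ℝ ℂ ℂ -
    c • (Complex.reCLM ∘L ContinuousLinearMap.snd ℝ ℂ ℂ))

theorem re_sub' (h : IsSplitGaussian V W P) (c : ℝ) :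
    HasGaussianLaw (fun ω => (W ω).re - c * (V ω).re) P :=
  h.hasGaussianLaw.map_fun (Complex.reCLM ∘L ContinuousLinearMap.snd ℝ ℂ ℂ -
    c • (Complex.reCLM ∘L ContinuousLinearMap.fst ℝ ℂ ℂ))

theorem im_sub (h : IsSplitGaussian V W P) (c : ℝ) :
    HasGaussianLaw (fun ω => (W ω).im - c * (V ω).im) P :=
  h.hasGaussianLaw.map_fun (Complex.imCLM ∘L ContinuousLinearMap.snd ℝ ℂ ℂ -
    c • (Complex.imCLM ∘L ContinuousLinearMap.fst ℝ ℂ ℂ))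

theorem integrable_momentKernel (h : IsSplitGaussian V W P) [IsProbabilityMeasure P] (k : ℕ)
    (ξ : ℝ) {α : ℝ} (hα : 0 ≤ α) : Integrable (fun ω => momentKernel k ξ α (V ω) (W ω)) P := by
  have hV : MemLp V k P := h.hasGaussianLaw.fst.memLp (by simp)
  refine hV.integrable_norm_pow'.mono' ?_ (.of_forall fun ω => ?_)
  · exact ((measurable_momentKernel k ξ α).comp_aemeasurable
      h.hasGaussianLaw.aemeasurable).aestronglyMeasurable
  · rw [Real.norm_of_nonneg (momentKernel_nonneg _ _ _ _ _)]
    exact momentKernel_le_norm_pow k ξ hα _ _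

theorem var_re_V_pos (h : IsSplitGaussian V W P) : 0 < Var[fun ω => (V ω).re; P] := by
  simpa using h.var_re_pos 1 0 (by simp)

theorem var_re_W_pos (h : IsSplitGaussian V W P) : 0 < Var[fun ω => (W ω).re; P] := by
  simpa using h.var_re_pos 0 1 (by simp)

theorem var_im_V_pos (h : IsSplitGaussian V W P) : 0 < Var[fun ω => (V ω).im; P] := by
  simpa using h.var_im_pos 1 0 (by simp)

theorem var_re_sub_pos (h : IsSplitGaussian V W P) (c : ℝ) :
    0 < Var[fun ω => (W ω).re - c * (V ω).re; P] := by
  have := h.var_re_pos (-c) 1 (by simp)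
  simpa [neg_add_eq_sub] using this

theorem var_im_sub_pos (h : IsSplitGaussian V W P) (c : ℝ) :
    0 < Var[fun ω => (W ω).im - c * (V ω).im; P] := by
  have := h.var_im_pos (-c) 1 (by simp)
  simpa [neg_add_eq_sub] using this

/-- Used for the upper bound: the variables kept, `Re W` and `Im V`, are those whose variances
degenerate as `η → 0`, while the residuals of `Re V` and `Im W` do not. -/
theorem exists_iIndepFun_re_W [IsProbabilityMeasure P] (h : IsSplitGaussian V W P) :
    ∃ c c' : ℝ, iIndepFun ![fun ω => (W ω).re, fun ω => (V ω).im,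
      fun ω => (V ω).re - c * (W ω).re, fun ω => (W ω).im - c' * (V ω).im] P := by
  refine exists_iIndepFun_regression (A := fun ω => (V ω).re) (A' := fun ω => (W ω).im) ?_
    h.cov_V_W h.cov_V_V h.cov_W_W h.cov_W_V h.var_re_W_pos h.var_im_V_pos
  have := h.hasGaussianLaw.map_fun (ContinuousLinearMap.pi
    ![Complex.reCLM ∘L ContinuousLinearMap.fst ℝ ℂ ℂ, Complex.reCLM ∘L ContinuousLinearMap.snd ℝ ℂ ℂ,
    Complex.imCLM ∘L ContinuousLinearMap.snd ℝ ℂ ℂ, Complex.imCLM ∘L ContinuousLinearMap.fst ℝ ℂ ℂ] :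
      ℂ × ℂ →L[ℝ] Fin 4 → ℝ)
  refine this.congr (.of_forall fun ω => ?_)
  funext i
  fin_cases i <;> simp

/-- Used for the lower bound at fixed `η`, where uniformity is not needed and `V` itself can be
localized first. -/
theorem exists_iIndepFun_re_V [IsProbabilityMeasure P] (h : IsSplitGaussian V W P) :
    ∃ c c' : ℝ, iIndepFun ![fun ω => (V ω).re, fun ω => (V ω).im,
      fun ω => (W ω).re - c * (V ω).re, fun ω => (W ω).im - c' * (V ω).im] P := by
  refine exists_iIndepFun_regression (A := fun ω => (W ω).re) (A' := fun ω => (W ω).im) ?_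
    h.cov_W_W h.cov_W_V h.cov_V_W h.cov_V_V h.var_re_V_pos h.var_im_V_pos
  have := h.hasGaussianLaw.map_fun (ContinuousLinearMap.pi
    ![Complex.reCLM ∘L ContinuousLinearMap.snd ℝ ℂ ℂ, Complex.reCLM ∘L ContinuousLinearMap.fst ℝ ℂ ℂ,
    Complex.imCLM ∘L ContinuousLinearMap.snd ℝ ℂ ℂ, Complex.imCLM ∘L ContinuousLinearMap.fst ℝ ℂ ℂ] :
      ℂ × ℂ →L[ℝ] Fin 4 → ℝ)
  refine this.congr (.of_forall fun ω => ?_)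
  funext i
  fin_cases i <;> simp

end IsSplitGaussian
end Independence

/-! ### Upper and lower bounds of order `α` for the kernel moments -/

section KernelBounds

/-- The conditional integral, with `z = Re W`, `y = Im V` frozen and `u`, `u'` the residuals. The
exponentials have rates `kξ²/(αT²)` and `k/(αT²)`; together they yield `αT²/(2ξσk)`, which turns
`T^k` into `T^(k+2)`. -/
theorem lintegral_two_gaussianReal_le {k : ℕ} (hk : 1 ≤ k) {ξ α σ T : ℝ} (hξ : 0 < ξ)
    (hα : 0 < α) (hσ : 0 < σ) (hT : 0 ≤ T) (m m' c c' z y : ℝ) {v v' : NNReal}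
    (hv : σ ≤ v) (hv' : σ ≤ v') :
    ∫⁻ u, ∫⁻ u', ENNReal.ofReal (T ^ k *
      Real.exp (-(k * (ξ * (u + c * z) - z) ^ 2 / (α * T ^ 2))) *
        Real.exp (-(k * (ξ * y - (u' + c' * y)) ^ 2 / (α * T ^ 2))))
        ∂gaussianReal m' v' ∂gaussianReal m v ≤
      ENNReal.ofReal (α / (2 * ξ * σ)) * ENNReal.ofReal (T ^ (k + 2)) := by
  -- The rates divide by `T²`, so `T = 0` is handled by the prefactor `T ^ k`.
  rcases hT.eq_or_lt with rfl | hT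
  · simp [zero_pow (by omega : k ≠ 0)]
  have hk' : (1 : ℝ) ≤ k := by exact_mod_cast hk
  set κ₁ : ℝ := k * ξ ^ 2 / (α * T ^ 2) with h₁
  set κ₂ : ℝ := k / (α * T ^ 2) with h₂
  have p₁ : 0 < κ₁ := by positivity
  have p₂ : 0 < κ₂ := by positivity
  have e : ∀ u u' : ℝ, ENNReal.ofReal (T ^ k *
      Real.exp (-(k * (ξ * (u + c * z) - z) ^ 2 / (α * T ^ 2))) *
        Real.exp (-(k * (ξ * y - (u' + c' * y)) ^ 2 / (α * T ^ 2)))) =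
      ENNReal.ofReal (T ^ k) * ENNReal.ofReal (Real.exp (-(κ₁ * (u - (z / ξ - c * z)) ^ 2))) *
        ENNReal.ofReal (Real.exp (-(κ₂ * (u' - (ξ * y - c' * y)) ^ 2))) := by
    intro u u'
    rw [ENNReal.ofReal_mul (by positivity), ENNReal.ofReal_mul (by positivity)]
    congr 5
    · rw [h₁]
      field_simp
      ring
    · rw [h₂]
      field_simp
      ring
  simp_rw [e]
  have m₁ : Measurable fun u : ℝ => ENNReal.ofReal (Real.exp (-(κ₁ * (u - (z / ξ - c * z)) ^ 2))) := by
    fun_prop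
  have m₂ : Measurable fun u : ℝ => ENNReal.ofReal (Real.exp (-(κ₂ * (u - (ξ * y - c' * y)) ^ 2))) := by
    fun_prop
  simp_rw [lintegral_const_mul _ m₂]
  rw [lintegral_mul_const _ (m₁.const_mul _), lintegral_const_mul _ m₁]
  refine (mul_le_mul' (mul_le_mul' le_rfl
    (lintegral_exp_neg_mul_sq_gaussianReal_le m _ hσ hv p₁))
    (lintegral_exp_neg_mul_sq_gaussianReal_le m' _ hσ hv' p₂)).trans ?_
  rw [← ENNReal.ofReal_mul (by positivity), ← ENNReal.ofReal_mul (by positivity),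
    ← ENNReal.ofReal_mul (by positivity)]
  refine ENNReal.ofReal_le_ofReal ?_
  have e2 : √(2 * σ * κ₁) * √(2 * σ * κ₂) = 2 * σ * ξ * k / (α * T ^ 2) := by
    rw [← Real.sqrt_mul (by positivity), ← Real.sqrt_sq (by positivity : 0 ≤ 2 * σ * ξ * k / (α * T ^ 2)),
      h₁, h₂]
    congr 1
    field_simp
  rw [mul_assoc, one_div_mul_one_div, e2]
  have e3 : T ^ k * (1 / (2 * σ * ξ * k / (α * T ^ 2))) = α / (2 * ξ * σ) * T ^ (k + 2) / k := by
    field_simp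
    ring
  rw [e3]
  exact div_le_self (by positivity) hk'

variable {Ω : Type*} [MeasurableSpace Ω] {P : Measure Ω} {V W : Ω → ℂ}

/-- The scale `T` in `momentKernel_le` depends only on `Re W` and `Im V`. By independence the main
term is integrated over the two residuals first; the remainder already carries a factor `α`. -/
theorem IsSplitGaussian.lintegral_momentKernel_le [IsProbabilityMeasure P]
    (h : IsSplitGaussian V W P) {k : ℕ} (hk : 1 ≤ k) {ξ α σ : ℝ} (hξ : 0 < ξ) (hα : 0 < α)
    (hσ : 0 < σ) (h1 : ∀ c, σ ≤ Var[fun ω => (V ω).re - c * (W ω).re; P])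
    (h2 : ∀ c, σ ≤ Var[fun ω => (W ω).im - c * (V ω).im; P]) :
    ∫⁻ ω, ENNReal.ofReal (momentKernel k ξ α (V ω) (W ω)) ∂P ≤
      ENNReal.ofReal (α / (2 * ξ * σ)) *
        ∫⁻ ω, ENNReal.ofReal ((2 * (2 * |(W ω).re| / ξ + |(V ω).im|)) ^ (k + 2)) ∂P +
      ENNReal.ofReal (8 / ξ ^ 2 * α) * ∫⁻ ω, ENNReal.ofReal (‖V ω‖ ^ k) ∂P := by
  obtain ⟨c, c', hind⟩ := h.exists_iIndepFun_re_W
  set A : (ℝ × ℝ) × (ℝ × ℝ) → ENNReal := fun p => ENNReal.ofReal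
    ((2 * (2 * |p.1.1| / ξ + |p.1.2|)) ^ k *
      Real.exp (-(k * (ξ * (p.2.1 + c * p.1.1) - p.1.1) ^ 2 /
        (α * (2 * (2 * |p.1.1| / ξ + |p.1.2|)) ^ 2))) *
      Real.exp (-(k * (ξ * p.1.2 - (p.2.2 + c' * p.1.2)) ^ 2 /
        (α * (2 * (2 * |p.1.1| / ξ + |p.1.2|)) ^ 2)))) with hA
  have mA : Measurable A := by fun_prop
  set G : (ℝ × ℝ) × (ℝ × ℝ) → ENNReal := fun p => ENNReal.ofReal
    ((2 * (2 * |p.1.1| / ξ + |p.1.2|)) ^ (k + 2)) with hGdef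
  have mG : Measurable G := by fun_prop
  have hV : AEMeasurable V P := h.hasGaussianLaw.fst.aemeasurable
  have a0 := h.re_W.aemeasurable
  have a1 := h.im_V.aemeasurable
  have a2 := (h.re_sub c).aemeasurable
  have a3 := (h.im_sub c').aemeasurable
  have hAG : ∫⁻ ω, A (((W ω).re, (V ω).im), ((V ω).re - c * (W ω).re, (W ω).im - c' * (V ω).im)) ∂P ≤
      ENNReal.ofReal (α / (2 * ξ * σ)) *
        ∫⁻ ω, G (((W ω).re, (V ω).im), ((V ω).re - c * (W ω).re, (W ω).im - c' * (V ω).im)) ∂P := by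
    have p2 := Measure.isProbabilityMeasure_map a2
    have p3 := Measure.isProbabilityMeasure_map a3
    rw [lintegral_four_of_iIndepFun a0 a1 a2 a3 hind mA,
      lintegral_four_of_iIndepFun a0 a1 a2 a3 hind mG, hGdef]
    simp only [lintegral_const, measure_univ, mul_one]
    rw [← lintegral_const_mul' _ _ ENNReal.ofReal_ne_top]
    refine lintegral_mono fun z => ?_
    rw [← lintegral_const_mul' _ _ ENNReal.ofReal_ne_top]
    refine lintegral_mono fun y => ?_
    rw [(h.re_sub c).map_eq_gaussianReal, (h.im_sub c').map_eq_gaussianReal]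
    exact lintegral_two_gaussianReal_le hk hξ hα hσ (by positivity) _ _ c c' z y
      (by rw [Real.coe_toNNReal _ (variance_nonneg _ _)]; exact h1 c)
      (by rw [Real.coe_toNNReal _ (variance_nonneg _ _)]; exact h2 c')
  calc ∫⁻ ω, ENNReal.ofReal (momentKernel k ξ α (V ω) (W ω)) ∂P
      ≤ ∫⁻ ω, (A (((W ω).re, (V ω).im), ((V ω).re - c * (W ω).re, (W ω).im - c' * (V ω).im)) +
          ENNReal.ofReal (8 / ξ ^ 2 * α) * ENNReal.ofReal (‖V ω‖ ^ k)) ∂P := by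
        refine lintegral_mono fun ω => ?_
        refine (ENNReal.ofReal_le_ofReal (momentKernel_le hk hξ hα (V ω) (W ω) rfl)).trans ?_
        rw [ENNReal.ofReal_add (by positivity) (by positivity),
          ENNReal.ofReal_mul (by positivity : 0 ≤ 8 / ξ ^ 2 * α)]
        simp [hA]
    _ ≤ _ := by
        rw [lintegral_add_right' _ (by fun_prop), lintegral_const_mul' _ _ ENNReal.ofReal_ne_top]
        exact add_le_add hAG le_rfl

/-- Upper bound for the kernel moments, uniform over split Gaussian pairs with bounded means and
variances, and with conditional variances bounded below. -/
theorem exists_integral_momentKernel_le {k : ℕ} (hk : 1 ≤ k) {ξ : ℝ} (hξ : 0 < ξ) (L : ℝ)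
    {σ : ℝ} (hσ : 0 < σ) :
    ∃ K : ℝ, ∀ (V W : Ω → ℂ) (P : Measure Ω) [IsProbabilityMeasure P], IsSplitGaussian V W P →
      |∫ ω, (V ω).re ∂P| ≤ L → |∫ ω, (V ω).im ∂P| ≤ L → |∫ ω, (W ω).re ∂P| ≤ L →
      Var[fun ω => (V ω).re; P] ≤ L ^ 2 → Var[fun ω => (V ω).im; P] ≤ L ^ 2 →
      Var[fun ω => (W ω).re; P] ≤ L ^ 2 →
      (∀ c, σ ≤ Var[fun ω => (V ω).re - c * (W ω).re; P]) →
      (∀ c, σ ≤ Var[fun ω => (W ω).im - c * (V ω).im; P]) →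
      ∀ α > 0, ∫ ω, momentKernel k ξ α (V ω) (W ω) ∂P ≤ K * α := by
  obtain ⟨G, hG0, hG⟩ := exists_moment_bound L k
  obtain ⟨H, hH0, hH⟩ := exists_moment_bound L (k + 2)
  -- The powers of two beyond `2T` come from the convexity bound `(a + b)^n ≤ 2^(n-1) (a^n + b^n)`,
  -- with `n = k + 2` for `T` and `n = k` for `|V|`.
  refine ⟨1 / (2 * ξ * σ) * (2 ^ (k + 2) * (2 ^ (k + 1) * ((2 / ξ) ^ (k + 2) * H + H))) +
    8 / ξ ^ 2 * (2 ^ (k - 1) * (G + G)), ?_⟩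
  intro V W P _ h m1 m2 m3 v1 v2 v3 s1 s2 α hα
  have hVW := h.integrable_momentKernel k ξ hα.le
  have b1 : ∫⁻ ω, ENNReal.ofReal (‖V ω‖ ^ k) ∂P ≤ ENNReal.ofReal (2 ^ (k - 1) * (G + G)) := by
    calc ∫⁻ ω, ENNReal.ofReal (‖V ω‖ ^ k) ∂P
        ≤ ∫⁻ ω, ENNReal.ofReal (2 ^ (k - 1)) * (ENNReal.ofReal (|(V ω).re| ^ k) +
            ENNReal.ofReal (|(V ω).im| ^ k)) ∂P := by
          refine lintegral_mono fun ω => ?_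
          rw [← ENNReal.ofReal_add (by positivity) (by positivity),
            ← ENNReal.ofReal_mul (by positivity)]
          refine ENNReal.ofReal_le_ofReal ?_
          exact (pow_le_pow_left₀ (norm_nonneg _) (Complex.norm_le_abs_re_add_abs_im _) k).trans
            (add_pow_le (abs_nonneg _) (abs_nonneg _) k)
      _ ≤ _ := by
          have a1 := h.im_V.aemeasurable
          rw [lintegral_const_mul' _ _ ENNReal.ofReal_ne_top, lintegral_add_right' _ (by fun_prop),
            ENNReal.ofReal_mul (by positivity), ENNReal.ofReal_add hG0 hG0]
          exact mul_le_mul' le_rfl (add_le_add (hG h.re_V m1 v1) (hG h.im_V m2 v2))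
  have b2 : ∫⁻ ω, ENNReal.ofReal ((2 * (2 * |(W ω).re| / ξ + |(V ω).im|)) ^ (k + 2)) ∂P ≤
      ENNReal.ofReal (2 ^ (k + 2) * (2 ^ (k + 1) * ((2 / ξ) ^ (k + 2) * H + H))) := by
    calc ∫⁻ ω, ENNReal.ofReal ((2 * (2 * |(W ω).re| / ξ + |(V ω).im|)) ^ (k + 2)) ∂P
        ≤ ∫⁻ ω, ENNReal.ofReal (2 ^ (k + 2)) * (ENNReal.ofReal (2 ^ (k + 1)) *
            (ENNReal.ofReal ((2 / ξ) ^ (k + 2)) * ENNReal.ofReal (|(W ω).re| ^ (k + 2)) +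
            ENNReal.ofReal (|(V ω).im| ^ (k + 2)))) ∂P := by
          refine lintegral_mono fun ω => ?_
          rw [← ENNReal.ofReal_mul (by positivity), ← ENNReal.ofReal_add (by positivity) (by positivity),
            ← ENNReal.ofReal_mul (by positivity), ← ENNReal.ofReal_mul (by positivity)]
          refine ENNReal.ofReal_le_ofReal ?_
          rw [mul_pow, ← mul_pow (2 / ξ)]
          refine mul_le_mul_of_nonneg_left ?_ (by positivity)
          have := add_pow_le (a := 2 / ξ * |(W ω).re|) (b := |(V ω).im|) (by positivity)
            (abs_nonneg _) (k + 2)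
          rwa [show 2 * |(W ω).re| / ξ = 2 / ξ * |(W ω).re| by ring]
      _ ≤ _ := by
          have a1 := h.im_V.aemeasurable
          rw [lintegral_const_mul' _ _ ENNReal.ofReal_ne_top,
            lintegral_const_mul' _ _ ENNReal.ofReal_ne_top, lintegral_add_right' _ (by fun_prop),
            lintegral_const_mul' _ _ ENNReal.ofReal_ne_top,
            ENNReal.ofReal_mul (by positivity), ENNReal.ofReal_mul (by positivity),
            ENNReal.ofReal_add (by positivity) hH0, ENNReal.ofReal_mul (by positivity)]
          exact mul_le_mul' le_rfl (mul_le_mul' le_rfl (add_le_add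
            (mul_le_mul' le_rfl (hH h.re_W m3 v3)) (hH h.im_V m2 v2)))
  have hmain := h.lintegral_momentKernel_le hk hξ hα hσ s1 s2
  rw [← ofReal_integral_eq_lintegral_ofReal hVW
    (.of_forall fun ω => momentKernel_nonneg _ _ _ _ _)] at hmain
  have := hmain.trans (add_le_add (mul_le_mul' le_rfl b2) (mul_le_mul' le_rfl b1))
  rw [← ENNReal.ofReal_mul (by positivity), ← ENNReal.ofReal_mul (by positivity),
    ← ENNReal.ofReal_add (by positivity) (by positivity),
    ENNReal.ofReal_le_ofReal_iff (by positivity)] at this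
  refine this.trans_eq ?_
  field_simp

/-- Consider the event that `Re V` and `Im V` lie in `[1, 2]` and both coordinates of `ξV - W` are
at most `√α` in absolute value. The kernel is at least `exp(-k)` there, and each residual
contributes a factor `√α` to its probability. -/
theorem IsSplitGaussian.exists_le_integral_momentKernel [IsProbabilityMeasure P]
    (h : IsSplitGaussian V W P) (k : ℕ) (ξ : ℝ) :
    ∃ c : ℝ, 0 < c ∧ ∀ α : ℝ, 0 < α → α ≤ 1 →
      c * α ≤ ∫ ω, momentKernel k ξ α (V ω) (W ω) ∂P := by
  obtain ⟨c, c', hind⟩ := h.exists_iIndepFun_re_V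
  have nz : ∀ {x : ℝ}, 0 < x → x.toNNReal ≠ 0 := fun hx => (Real.toNNReal_pos.mpr hx).ne'
  obtain ⟨d₀, p₀, H₀⟩ := exists_pos_le_gaussianReal_Icc (∫ ω, (V ω).re ∂P) (nz h.var_re_V_pos) 2
  obtain ⟨d₁, p₁, H₁⟩ := exists_pos_le_gaussianReal_Icc (∫ ω, (V ω).im ∂P) (nz h.var_im_V_pos) 2
  -- The residual of `Re W` must lie within `√α` of `(ξ - c) Re V`, and `|Re V| ≤ 2` bounds this
  -- centre.
  obtain ⟨d₂, p₂, H₂⟩ := exists_pos_le_gaussianReal_Icc (∫ ω, ((W ω).re - c * (V ω).re) ∂P)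
    (nz (h.var_re_sub_pos c)) (2 * |ξ - c|)
  obtain ⟨d₃, p₃, H₃⟩ := exists_pos_le_gaussianReal_Icc (∫ ω, ((W ω).im - c' * (V ω).im) ∂P)
    (nz (h.var_im_sub_pos c')) (2 * |ξ - c'|)
  refine ⟨Real.exp (-k) * (d₀ * (1 / 2) * (d₁ * (1 / 2)) * d₂ * d₃), by positivity, fun α hα hα1 => ?_⟩
  have hs : 0 < √α := Real.sqrt_pos.mpr hα
  have hs1 : √α ≤ 1 := Real.sqrt_le_one.mpr hα1
  have a0 := h.re_V.aemeasurable
  have a1 := h.im_V.aemeasurable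
  have a2 := (h.re_sub' c).aemeasurable
  have a3 := (h.im_sub c').aemeasurable
  set S : Set ((ℝ × ℝ) × (ℝ × ℝ)) := {p | p.1.1 ∈ Icc (3 / 2 - 1 / 2 : ℝ) (3 / 2 + 1 / 2) ∧
    p.1.2 ∈ Icc (3 / 2 - 1 / 2 : ℝ) (3 / 2 + 1 / 2) ∧
    p.2.1 ∈ Icc ((ξ - c) * p.1.1 - √α) ((ξ - c) * p.1.1 + √α) ∧
    p.2.2 ∈ Icc ((ξ - c') * p.1.2 - √α) ((ξ - c') * p.1.2 + √α)} with hS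
  have mS : MeasurableSet S := by
    simp only [hS, mem_Icc]
    measurability
  have hlow : ENNReal.ofReal (d₀ * (1 / 2)) * ENNReal.ofReal (d₁ * (1 / 2)) *
      ENNReal.ofReal (d₂ * √α) * ENNReal.ofReal (d₃ * √α) ≤
      ∫⁻ ω, S.indicator 1 (((V ω).re, (V ω).im),
        ((W ω).re - c * (V ω).re, (W ω).im - c' * (V ω).im)) ∂P := by
    rw [lintegral_four_of_iIndepFun a0 a1 a2 a3 hind (measurable_one.indicator mS),
      h.re_V.map_eq_gaussianReal, h.im_V.map_eq_gaussianReal, (h.re_sub' c).map_eq_gaussianReal,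
      (h.im_sub c').map_eq_gaussianReal]
    set μ₀ := gaussianReal (∫ ω, (V ω).re ∂P) Var[fun ω => (V ω).re; P].toNNReal
    set μ₁ := gaussianReal (∫ ω, (V ω).im ∂P) Var[fun ω => (V ω).im; P].toNNReal
    set I : Set ℝ := Icc (3 / 2 - 1 / 2) (3 / 2 + 1 / 2) with hI
    have hI2 : ∀ x ∈ I, |x| ≤ 2 := fun x hx => by
      rw [hI, mem_Icc] at hx
      rw [abs_le]
      constructor <;> linarith [hx.1, hx.2]
    have mI : MeasurableSet I := measurableSet_Icc
    have g0 := H₀ (3 / 2) (1 / 2) (by norm_num [abs_of_pos]) (by norm_num) (by norm_num)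
    have g1 := H₁ (3 / 2) (1 / 2) (by norm_num [abs_of_pos]) (by norm_num) (by norm_num)
    set D := ENNReal.ofReal (d₂ * √α) * ENNReal.ofReal (d₃ * √α) with hD
    calc _ ≤ ∫⁻ x, I.indicator 1 x * (∫⁻ y, I.indicator 1 y * D ∂μ₁) ∂μ₀ := by
          rw [lintegral_mul_const _ (measurable_one.indicator mI),
            lintegral_mul_const _ (measurable_one.indicator mI), lintegral_indicator_one mI,
            lintegral_indicator_one mI, mul_assoc _ (ENNReal.ofReal (d₂ * √α)), mul_assoc]
          exact mul_le_mul' g0 (mul_le_mul' g1 le_rfl)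
      _ ≤ _ := by
          refine lintegral_mono fun x => ?_
          by_cases hx : x ∈ I
          · rw [indicator_of_mem hx, Pi.one_apply, one_mul]
            refine lintegral_mono fun y => ?_
            by_cases hy : y ∈ I
            · rw [indicator_of_mem hy, Pi.one_apply, one_mul]
              have g2 := H₂ ((ξ - c) * x) (√α) (by
                rw [abs_mul, mul_comm]
                gcongr
                exact hI2 x hx) hs hs1
              have g3 := H₃ ((ξ - c') * y) (√α) (by
                rw [abs_mul, mul_comm]
                gcongr
                exact hI2 y hy) hs hs1
              refine (mul_le_mul' g2 g3).trans ?_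
              rw [← lintegral_indicator_one measurableSet_Icc,
                ← lintegral_mul_const _ (measurable_one.indicator measurableSet_Icc)]
              refine lintegral_mono fun u => ?_
              rw [← lintegral_indicator_one measurableSet_Icc,
                ← lintegral_const_mul _ (measurable_one.indicator measurableSet_Icc)]
              refine lintegral_mono fun u' => ?_
              by_cases q1 : u ∈ Icc ((ξ - c) * x - √α) ((ξ - c) * x + √α)
              · by_cases q2 : u' ∈ Icc ((ξ - c') * y - √α) ((ξ - c') * y + √α)
                · have q3 : ((x, y), (u, u')) ∈ S := ⟨hx, hy, q1, q2⟩
                  rw [indicator_of_mem q1, indicator_of_mem q2, indicator_of_mem q3, Pi.one_apply,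
                    Pi.one_apply, Pi.one_apply, one_mul]
                · rw [indicator_of_notMem q2, mul_zero]
                  exact zero_le
              · rw [indicator_of_notMem q1, zero_mul]
                exact zero_le
            · rw [indicator_of_notMem hy, zero_mul]
              exact zero_le
          · rw [indicator_of_notMem hx, zero_mul]
            exact zero_le
  have hup : ENNReal.ofReal (Real.exp (-k)) * ∫⁻ ω, S.indicator 1 (((V ω).re, (V ω).im),
        ((W ω).re - c * (V ω).re, (W ω).im - c' * (V ω).im)) ∂P ≤
      ∫⁻ ω, ENNReal.ofReal (momentKernel k ξ α (V ω) (W ω)) ∂P := by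
    rw [← lintegral_const_mul' _ _ ENNReal.ofReal_ne_top]
    refine lintegral_mono fun ω => ?_
    simp only [indicator]
    split_ifs with hω
    · rw [Pi.one_apply, mul_one]
      obtain ⟨⟨q1, -⟩, ⟨q2, -⟩, ⟨q3, q4⟩, ⟨q5, q6⟩⟩ := hω
      dsimp only at q1 q2 q3 q4 q5 q6
      refine ENNReal.ofReal_le_ofReal (le_momentKernel k hα (by linarith) (by linarith) ?_ ?_)
      · rw [abs_le]
        constructor <;> linarith
      · rw [abs_le]
        constructor <;> linarith
    · simp
  have := (mul_le_mul' le_rfl hlow).trans hup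
  rw [← ofReal_integral_eq_lintegral_ofReal (h.integrable_momentKernel k ξ hα.le)
    (.of_forall fun ω => momentKernel_nonneg _ _ _ _ _), ← ENNReal.ofReal_mul (by positivity),
    ← ENNReal.ofReal_mul (by positivity), ← ENNReal.ofReal_mul (by positivity),
    ← ENNReal.ofReal_mul (by positivity), ENNReal.ofReal_le_ofReal_iff
      (integral_nonneg fun ω => momentKernel_nonneg _ _ _ _ _)] at this
  refine le_trans (le_of_eq ?_) this
  linear_combination -(Real.exp (-k) * (d₀ * (1 / 2) * (d₁ * (1 / 2)) * d₂ * d₃)) *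
    Real.mul_self_sqrt hα.le

end KernelBounds

/-! ### Second moments of white noise -/

/-- The even part of a function. -/
def evenPart (a : ℝ → ℝ) (x : ℝ) : ℝ := (a x + a (-x)) / 2

/-- The odd part of a function. -/
def oddPart (a : ℝ → ℝ) (x : ℝ) : ℝ := (a x - a (-x)) / 2

section Parts

variable {a b : ℝ → ℝ} {R : ℝ}

/-- Of the four integrals in the expansion, two pairs agree under `x ↦ -x`. The right side is half
the sum of the covariance and the pseudocovariance; the odd parts give half the difference. -/
theorem integral_evenPart_mul (ha : Continuous a) (hb : Continuous b)
    (ha0 : ∀ x, R < |x| → a x = 0) :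
    ∫ x, evenPart a x * evenPart b x = ((∫ x, a x * b x) + ∫ x, a x * b (-x)) / 2 := by
  have i1 : Integrable fun x => a x * b x :=
    integrable_of_eq_zero_of_lt_abs (R := R) (by fun_prop) fun x hx => by simp [ha0 x hx]
  have i2 : Integrable fun x => a x * b (-x) :=
    integrable_of_eq_zero_of_lt_abs (R := R) (by fun_prop) fun x hx => by simp [ha0 x hx]
  have i3 := i1.comp_neg
  have i4 := i2.comp_neg
  have e1 : ∫ x, a (-x) * b (-x) = ∫ x, a x * b x := integral_neg_eq_self (fun x => a x * b x) volume
  have e2 : ∫ x, a (-x) * b (- -x) = ∫ x, a x * b (-x) :=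
    integral_neg_eq_self (fun x => a x * b (-x)) volume
  have e3 : ∀ x, evenPart a x * evenPart b x =
      (a x * b x + a x * b (-x) + (a (-x) * b (-x) + a (-x) * b (- -x))) / 4 := fun x => by
    rw [evenPart, evenPart, neg_neg]
    ring
  simp_rw [e3]
  rw [integral_div, integral_add (f := fun x => a x * b x + a x * b (-x))
      (g := fun x => a (-x) * b (-x) + a (-x) * b (- -x)) (i1.add i2) (i3.add i4),
    integral_add i1 i2, integral_add i3 i4, e1, e2]
  ring

theorem integral_oddPart_mul (ha : Continuous a) (hb : Continuous b)
    (ha0 : ∀ x, R < |x| → a x = 0) :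
    ∫ x, oddPart a x * oddPart b x = ((∫ x, a x * b x) - ∫ x, a x * b (-x)) / 2 := by
  have i1 : Integrable fun x => a x * b x :=
    integrable_of_eq_zero_of_lt_abs (R := R) (by fun_prop) fun x hx => by simp [ha0 x hx]
  have i2 : Integrable fun x => a x * b (-x) :=
    integrable_of_eq_zero_of_lt_abs (R := R) (by fun_prop) fun x hx => by simp [ha0 x hx]
  have i3 := i1.comp_neg
  have i4 := i2.comp_neg
  have e1 : ∫ x, a (-x) * b (-x) = ∫ x, a x * b x := integral_neg_eq_self (fun x => a x * b x) volume
  have e2 : ∫ x, a (-x) * b (- -x) = ∫ x, a x * b (-x) :=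
    integral_neg_eq_self (fun x => a x * b (-x)) volume
  have e3 : ∀ x, oddPart a x * oddPart b x =
      (a x * b x - a x * b (-x) + (a (-x) * b (-x) - a (-x) * b (- -x))) / 4 := fun x => by
    rw [oddPart, oddPart, neg_neg]
    ring
  simp_rw [e3]
  rw [integral_div, integral_add (f := fun x => a x * b x - a x * b (-x))
      (g := fun x => a (-x) * b (-x) - a (-x) * b (- -x)) (i1.sub i2) (i3.sub i4),
    integral_sub i1 i2, integral_sub i3 i4, e1, e2]
  ring

end Parts

/-- The deterministic part of the noisy signal. -/
theorem noisySignal_eq {Ω : Type*} (A ξ₀ : ℝ) (Φ : 𝓢(ℝ, ℂ) → Ω → ℂ) (φ : 𝓢(ℝ, ℂ)) (ω : Ω) :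
    noisySignal A ξ₀ Φ φ ω = A * (𝓕 φ) (-ξ₀) + Φ φ ω := by
  rw [noisySignal, SchwartzMap.fourier_coe, Real.fourier_eq']
  congr 1
  rw [← integral_const_mul]
  congr 1
  ext s
  rw [smul_eq_mul, mul_assoc]
  congr 3
  simp only [RCLike.inner_apply, conj_trivial]
  push_cast
  ring

section WhiteNoise

variable {Ω : Type*} [MeasurableSpace Ω] {P : Measure Ω} [IsProbabilityMeasure P]
  {Φ : 𝓢(ℝ, ℂ) → Ω → ℂ} {φ χ : 𝓢(ℝ, ℂ)} {a b : ℝ → ℝ} {t R : ℝ}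

theorem IsComplexGaussianWhiteNoise.memLp (hΦ : IsComplexGaussianWhiteNoise Φ P) (φ : 𝓢(ℝ, ℂ))
    {p : ENNReal} (hp : p ≠ ⊤) : MemLp (Φ φ) p P :=
  (hΦ.isGaussian.hasGaussianLaw_eval φ).memLp hp

theorem IsComplexGaussianWhiteNoise.integral_re_mul (hΦ : IsComplexGaussianWhiteNoise Φ P)
    (φ : 𝓢(ℝ, ℂ)) (c : ℂ) : ∫ ω, (c * Φ φ ω).re ∂P = 0 := by
  have h := (hΦ.memLp φ (p := 1) (by simp)).integrable le_rfl
  have := integral_re (h.const_mul c)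
  simp only [RCLike.re_to_complex] at this
  rw [this, integral_const_mul, hΦ.mean_zero]
  simp

/-- Covariance of real-linear functionals of white noise. -/
theorem IsComplexGaussianWhiteNoise.cov_re_mul (hΦ : IsComplexGaussianWhiteNoise Φ P)
    (φ χ : 𝓢(ℝ, ℂ)) (c d : ℂ) :
    cov[fun ω => (c * Φ φ ω).re, fun ω => (d * Φ χ ω).re; P] =
      (c * d * (∫ x : ℝ, (𝓕 φ) x * (𝓕 χ) (-x)) +
        c * conj d * ∫ x : ℝ, (𝓕 φ) x * conj ((𝓕 χ) x)).re / 2 := by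
  have m1 := hΦ.memLp φ (p := 2) (by simp)
  have m2 := hΦ.memLp χ (p := 2) (by simp)
  have i1 : Integrable (fun ω => Φ φ ω * Φ χ ω) P := m1.integrable_mul m2
  have i2 : Integrable (fun ω => Φ φ ω * conj (Φ χ ω)) P := m1.integrable_mul m2.star
  rw [covariance]
  simp only [hΦ.integral_re_mul, sub_zero]
  -- Pointwise, `Re(cX) Re(dZ) = ½ Re(cd XZ + c conj(d) X conj(Z))`.
  rw [← hΦ.covariance_eq, ← hΦ.pseudocovariance_eq, ← integral_const_mul, ← integral_const_mul,
    ← integral_add (i1.const_mul _) (i2.const_mul _)]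
  have := integral_re ((i1.const_mul (c * d)).add (i2.const_mul (c * conj d)))
  simp only [RCLike.re_to_complex] at this
  change _ = (∫ ω, ((fun ω => c * d * (Φ φ ω * Φ χ ω)) +
    fun ω => c * conj d * (Φ φ ω * conj (Φ χ ω))) ω ∂P).re / 2
  rw [← this, ← integral_div]
  congr 1
  ext ω
  simp
  ring

/-- Conjugation inverts the common phase, as does the reflection `x ↦ -x` in the next lemma; hence
both second moments are real. -/
theorem IsPhasedFourier.integral_mul_conj (hφ : IsPhasedFourier t φ a) (hχ : IsPhasedFourier t χ b) :
    ∫ x : ℝ, (𝓕 φ) x * conj ((𝓕 χ) x) = ((∫ x, a x * b x : ℝ) : ℂ) := by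
  rw [← integral_complex_ofReal]
  congr 1
  ext x
  rw [hφ x, hχ x, map_mul, Complex.conj_ofReal, ← Complex.exp_conj]
  have : Complex.exp (-(2 * Real.pi * Complex.I * x * t)) *
      Complex.exp (conj (-(2 * Real.pi * Complex.I * x * t))) = 1 := by
    rw [← Complex.exp_add, ← Complex.exp_zero]
    congr 1
    simp only [map_neg, map_mul, Complex.conj_I, Complex.conj_ofReal, map_ofNat]
    ring
  push_cast
  linear_combination (a x : ℂ) * b x * this

theorem IsPhasedFourier.integral_mul_neg (hφ : IsPhasedFourier t φ a) (hχ : IsPhasedFourier t χ b) :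
    ∫ x : ℝ, (𝓕 φ) x * (𝓕 χ) (-x) = ((∫ x, a x * b (-x) : ℝ) : ℂ) := by
  rw [← integral_complex_ofReal]
  congr 1
  ext x
  rw [hφ x, hχ (-x)]
  have : Complex.exp (-(2 * Real.pi * Complex.I * x * t)) *
      Complex.exp (-(2 * Real.pi * Complex.I * (-x : ℝ) * t)) = 1 := by
    rw [← Complex.exp_add, ← Complex.exp_zero]
    congr 1
    push_cast
    ring
  push_cast at this ⊢
  linear_combination (a x : ℂ) * b (-x) * this

theorem IsComplexGaussianWhiteNoise.cov_re_re (hΦ : IsComplexGaussianWhiteNoise Φ P)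
    (hφ : IsPhasedFourier t φ a) (hχ : IsPhasedFourier t χ b) (ha : Continuous a)
    (hb : Continuous b) (ha0 : ∀ x, R < |x| → a x = 0) :
    cov[fun ω => (Φ φ ω).re, fun ω => (Φ χ ω).re; P] = ∫ x, evenPart a x * evenPart b x := by
  have := hΦ.cov_re_mul φ χ 1 1
  rw [hφ.integral_mul_conj hχ, hφ.integral_mul_neg hχ] at this
  simp only [one_mul] at this
  rw [this, integral_evenPart_mul ha hb ha0]
  simp
  ring

theorem IsComplexGaussianWhiteNoise.cov_im_im (hΦ : IsComplexGaussianWhiteNoise Φ P)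
    (hφ : IsPhasedFourier t φ a) (hχ : IsPhasedFourier t χ b) (ha : Continuous a)
    (hb : Continuous b) (ha0 : ∀ x, R < |x| → a x = 0) :
    cov[fun ω => (Φ φ ω).im, fun ω => (Φ χ ω).im; P] = ∫ x, oddPart a x * oddPart b x := by
  have := hΦ.cov_re_mul φ χ (-Complex.I) (-Complex.I)
  rw [hφ.integral_mul_conj hχ, hφ.integral_mul_neg hχ] at this
  have e : ∀ z : ℂ, (-Complex.I * z).re = z.im := fun z => by simp
  simp only [e] at this
  rw [this, integral_oddPart_mul ha hb ha0]
  simp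
  ring

/-- For `c = 1`, `d = -i` the coefficients `cd` and `c conj(d)` are purely imaginary, whereas both
second moments are real. -/
theorem IsComplexGaussianWhiteNoise.cov_re_im (hΦ : IsComplexGaussianWhiteNoise Φ P)
    (hφ : IsPhasedFourier t φ a) (hχ : IsPhasedFourier t χ b) :
    cov[fun ω => (Φ φ ω).re, fun ω => (Φ χ ω).im; P] = 0 := by
  have := hΦ.cov_re_mul φ χ 1 (-Complex.I)
  rw [hφ.integral_mul_conj hχ, hφ.integral_mul_neg hχ] at this
  have e : ∀ z : ℂ, (-Complex.I * z).re = z.im := fun z => by simp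
  simp only [e, one_mul] at this
  rw [this]
  simp

/-! ### Gaussianity, means and covariances of signal plus noise -/

theorem IsComplexGaussianWhiteNoise.hasGaussianLaw_noisySignal
    (hΦ : IsComplexGaussianWhiteNoise Φ P) (A ξ₀ : ℝ) (φ χ : 𝓢(ℝ, ℂ)) :
    HasGaussianLaw (fun ω => (noisySignal A ξ₀ Φ φ ω, noisySignal A ξ₀ Φ χ ω)) P := by
  have h : HasGaussianLaw (fun ω => (Φ φ ω, Φ χ ω)) P := hΦ.isGaussian.hasGaussianLaw_prodMk
  have hm := h.aemeasurable
  have := h.isGaussian_map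
  constructor
  have e : (fun ω => (noisySignal A ξ₀ Φ φ ω, noisySignal A ξ₀ Φ χ ω)) =
      (fun z : ℂ × ℂ => ((A * (𝓕 φ) (-ξ₀) : ℂ), (A * (𝓕 χ) (-ξ₀) : ℂ)) + z) ∘
        fun ω => (Φ φ ω, Φ χ ω) := by
    ext ω <;> simp [noisySignal_eq]
  rw [e, ← AEMeasurable.map_map_of_aemeasurable (by fun_prop) hm]
  infer_instance

variable {A ξ₀ : ℝ}

theorem IsComplexGaussianWhiteNoise.integrable_re (hΦ : IsComplexGaussianWhiteNoise Φ P)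
    (φ : 𝓢(ℝ, ℂ)) : Integrable (fun ω => (Φ φ ω).re) P :=
  ((hΦ.memLp φ (p := 1) (by simp)).integrable le_rfl).re

theorem IsComplexGaussianWhiteNoise.integrable_im (hΦ : IsComplexGaussianWhiteNoise Φ P)
    (φ : 𝓢(ℝ, ℂ)) : Integrable (fun ω => (Φ φ ω).im) P :=
  ((hΦ.memLp φ (p := 1) (by simp)).integrable le_rfl).im

theorem IsComplexGaussianWhiteNoise.cov_noisySignal_re (hΦ : IsComplexGaussianWhiteNoise Φ P) :
    cov[fun ω => (noisySignal A ξ₀ Φ φ ω).re, fun ω => (noisySignal A ξ₀ Φ χ ω).re; P] =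
      cov[fun ω => (Φ φ ω).re, fun ω => (Φ χ ω).re; P] := by
  simp only [noisySignal_eq, Complex.add_re]
  rw [covariance_const_add_left (hΦ.integrable_re φ), covariance_const_add_right (hΦ.integrable_re χ)]

theorem IsComplexGaussianWhiteNoise.cov_noisySignal_im (hΦ : IsComplexGaussianWhiteNoise Φ P) :
    cov[fun ω => (noisySignal A ξ₀ Φ φ ω).im, fun ω => (noisySignal A ξ₀ Φ χ ω).im; P] =
      cov[fun ω => (Φ φ ω).im, fun ω => (Φ χ ω).im; P] := by
  simp only [noisySignal_eq, Complex.add_im]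
  rw [covariance_const_add_left (hΦ.integrable_im φ), covariance_const_add_right (hΦ.integrable_im χ)]

theorem IsComplexGaussianWhiteNoise.cov_noisySignal_re_im (hΦ : IsComplexGaussianWhiteNoise Φ P)
    (hφ : IsPhasedFourier t φ a) (hχ : IsPhasedFourier t χ b) :
    cov[fun ω => (noisySignal A ξ₀ Φ φ ω).re, fun ω => (noisySignal A ξ₀ Φ χ ω).im; P] = 0 := by
  simp only [noisySignal_eq, Complex.add_im, Complex.add_re]
  rw [covariance_const_add_left (hΦ.integrable_re φ), covariance_const_add_right (hΦ.integrable_im χ),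
    hΦ.cov_re_im hφ hχ]

theorem continuous_evenPart (ha : Continuous a) : Continuous (evenPart a) := by
  unfold evenPart
  fun_prop

theorem continuous_oddPart (ha : Continuous a) : Continuous (oddPart a) := by
  unfold oddPart
  fun_prop

theorem IsComplexGaussianWhiteNoise.variance_re (hΦ : IsComplexGaussianWhiteNoise Φ P)
    (hφ : IsPhasedFourier t φ a) (hχ : IsPhasedFourier t χ b) (ha : Continuous a)
    (hb : Continuous b) (ha0 : ∀ x, R < |x| → a x = 0) (hb0 : ∀ x, R < |x| → b x = 0) (p r : ℝ) :
    Var[fun ω => p * (noisySignal A ξ₀ Φ φ ω).re + r * (noisySignal A ξ₀ Φ χ ω).re; P] =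
      ∫ x, (p * evenPart a x + r * evenPart b x) ^ 2 := by
  have h := hΦ.hasGaussianLaw_noisySignal A ξ₀ φ χ
  have m1 : MemLp (fun ω => (noisySignal A ξ₀ Φ φ ω).re) 2 P := h.fst.memLp_two.re
  have m2 : MemLp (fun ω => (noisySignal A ξ₀ Φ χ ω).re) 2 P := h.snd.memLp_two.re
  rw [variance_fun_add (m1.const_mul p) (m2.const_mul r), variance_const_mul, variance_const_mul,
    covariance_const_mul_left, covariance_const_mul_right, ← covariance_self m1.aemeasurable,
    ← covariance_self m2.aemeasurable, hΦ.cov_noisySignal_re, hΦ.cov_noisySignal_re,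
    hΦ.cov_noisySignal_re, hΦ.cov_re_re hφ hφ ha ha ha0, hΦ.cov_re_re hφ hχ ha hb ha0,
    hΦ.cov_re_re hχ hχ hb hb hb0, integral_add_mul_sq (R := R) (continuous_evenPart ha)
      (continuous_evenPart hb) (fun x hx => by simp [evenPart, ha0 x hx, ha0 (-x) (by simpa using hx)])
      (fun x hx => by simp [evenPart, hb0 x hx, hb0 (-x) (by simpa using hx)])]
  ring

theorem IsComplexGaussianWhiteNoise.variance_im (hΦ : IsComplexGaussianWhiteNoise Φ P)
    (hφ : IsPhasedFourier t φ a) (hχ : IsPhasedFourier t χ b) (ha : Continuous a)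
    (hb : Continuous b) (ha0 : ∀ x, R < |x| → a x = 0) (hb0 : ∀ x, R < |x| → b x = 0) (p r : ℝ) :
    Var[fun ω => p * (noisySignal A ξ₀ Φ φ ω).im + r * (noisySignal A ξ₀ Φ χ ω).im; P] =
      ∫ x, (p * oddPart a x + r * oddPart b x) ^ 2 := by
  have h := hΦ.hasGaussianLaw_noisySignal A ξ₀ φ χ
  have m1 : MemLp (fun ω => (noisySignal A ξ₀ Φ φ ω).im) 2 P := h.fst.memLp_two.im
  have m2 : MemLp (fun ω => (noisySignal A ξ₀ Φ χ ω).im) 2 P := h.snd.memLp_two.im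
  rw [variance_fun_add (m1.const_mul p) (m2.const_mul r), variance_const_mul, variance_const_mul,
    covariance_const_mul_left, covariance_const_mul_right, ← covariance_self m1.aemeasurable,
    ← covariance_self m2.aemeasurable, hΦ.cov_noisySignal_im, hΦ.cov_noisySignal_im,
    hΦ.cov_noisySignal_im, hΦ.cov_im_im hφ hφ ha ha ha0, hΦ.cov_im_im hφ hχ ha hb ha0,
    hΦ.cov_im_im hχ hχ hb hb hb0, integral_add_mul_sq (R := R) (continuous_oddPart ha)
      (continuous_oddPart hb) (fun x hx => by simp [oddPart, ha0 x hx, ha0 (-x) (by simpa using hx)])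
      (fun x hx => by simp [oddPart, hb0 x hx, hb0 (-x) (by simpa using hx)])]
  ring

theorem IsComplexGaussianWhiteNoise.integral_noisySignal_re (hΦ : IsComplexGaussianWhiteNoise Φ P)
    (φ : 𝓢(ℝ, ℂ)) : ∫ ω, (noisySignal A ξ₀ Φ φ ω).re ∂P = (A * (𝓕 φ) (-ξ₀) : ℂ).re := by
  simp only [noisySignal_eq, Complex.add_re]
  have := hΦ.integral_re_mul φ 1
  simp only [one_mul] at this
  rw [integral_add (integrable_const _) (hΦ.integrable_re φ), this]
  simp

theorem IsComplexGaussianWhiteNoise.integral_noisySignal_im (hΦ : IsComplexGaussianWhiteNoise Φ P)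
    (φ : 𝓢(ℝ, ℂ)) : ∫ ω, (noisySignal A ξ₀ Φ φ ω).im ∂P = (A * (𝓕 φ) (-ξ₀) : ℂ).im := by
  simp only [noisySignal_eq, Complex.add_im]
  have := hΦ.integral_re_mul φ (-Complex.I)
  have e : ∀ z : ℂ, (-Complex.I * z).re = z.im := fun z => by simp
  simp only [e] at this
  rw [integral_add (integrable_const _) (hΦ.integrable_im φ), this]
  simp

end WhiteNoise

/-! ### Nondegeneracy of the noisy transform -/

/-- A quadratic in `c` with positive leading coefficient attains its minimum, here at the regression
coefficient. -/
theorem exists_pos_le_variance_sub {Ω : Type*} [MeasurableSpace Ω] {P : Measure Ω}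
    [IsProbabilityMeasure P] {X Z : Ω → ℝ} (hX : MemLp X 2 P) (hZ : MemLp Z 2 P)
    (hpos : 0 < Var[Z; P]) (h : ∀ c : ℝ, 0 < Var[fun ω => X ω - c * Z ω; P]) :
    ∃ σ : ℝ, 0 < σ ∧ ∀ c : ℝ, σ ≤ Var[fun ω => X ω - c * Z ω; P] := by
  have e : ∀ c : ℝ, Var[fun ω => X ω - c * Z ω; P] =
      Var[X; P] - 2 * (c * cov[X, Z; P]) + c ^ 2 * Var[Z; P] := fun c => by
    rw [variance_fun_sub hX (hZ.const_mul c), covariance_const_mul_right, variance_const_mul]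
  refine ⟨_, h (cov[X, Z; P] / Var[Z; P]), fun c => ?_⟩
  rw [e, e]
  have h1 : 0 ≤ (c * Var[Z; P] - cov[X, Z; P]) ^ 2 / Var[Z; P] := by positivity
  have h2 : (c * Var[Z; P] - cov[X, Z; P]) ^ 2 / Var[Z; P] =
      Var[X; P] - 2 * (c * cov[X, Z; P]) + c ^ 2 * Var[Z; P] -
      (Var[X; P] - 2 * (cov[X, Z; P] / Var[Z; P] * cov[X, Z; P]) +
        (cov[X, Z; P] / Var[Z; P]) ^ 2 * Var[Z; P]) := by
    field_simp
    ring
  linarith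

section Noisy

variable {Ω : Type*} [MeasurableSpace Ω] {P : Measure Ω} [IsProbabilityMeasure P]
  {Φ : 𝓢(ℝ, ℂ) → Ω → ℂ} {M : ℝ} {ψ : ℝ → ℝ}

theorem evenPart_translate {q : ℝ → ℝ} (hq : ∀ x, q (-x) = q x) (η : ℝ) :
    evenPart (fun x => q (x + η)) = bumpEven q η := by
  ext x
  rw [evenPart, bumpEven, ← hq (-x + η)]
  ring_nf

theorem oddPart_translate {q : ℝ → ℝ} (hq : ∀ x, q (-x) = q x) (η : ℝ) :
    oddPart (fun x => q (x + η)) = bumpOdd q η := by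
  ext x
  rw [oddPart, bumpOdd, ← hq (-x + η)]
  ring_nf

theorem evenPart_neg_mul_translate {q : ℝ → ℝ} (hq : ∀ x, q (-x) = q x) (η : ℝ) :
    evenPart (fun x => -x * q (x + η)) = fun x => -x * bumpOdd q η x := by
  ext x
  rw [evenPart, bumpOdd, ← hq (-x + η)]
  ring_nf

theorem oddPart_neg_mul_translate {q : ℝ → ℝ} (hq : ∀ x, q (-x) = q x) (η : ℝ) :
    oddPart (fun x => -x * q (x + η)) = fun x => -x * bumpEven q η x := by
  ext x
  rw [oddPart, bumpEven, ← hq (-x + η)]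
  ring_nf

theorem windowHat_translate_eq_zero (hψ : IsCutoff M ψ) {η x : ℝ} (hx : 2 * M + |η| < |x|) :
    windowHat ψ (x + η) = 0 :=
  (translate_eq_zero (fun _ => windowHat_eq_zero hψ) hx).1

theorem variance_re_atom (hΦ : IsComplexGaussianWhiteNoise Φ P) (hψ : IsCutoff M ψ)
    (A ξ₀ t η p r : ℝ) :
    Var[fun ω => p * (noisySignal A ξ₀ Φ (atom (truncatedWindow ψ) t η) ω).re +
        r * (noisySignal A ξ₀ Φ (freqAtom (truncatedWindow ψ) t η) ω).re; P] =
      ∫ x, (p * bumpEven (windowHat ψ) η x + r * (-x * bumpOdd (windowHat ψ) η x)) ^ 2 := by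
  have hq := continuous_windowHat hψ
  rw [hΦ.variance_re (R := 2 * M + |η|) (isPhasedFourier_atom hψ t η)
    (isPhasedFourier_freqAtom hψ t η) (by fun_prop) (by fun_prop)
    (fun x hx => windowHat_translate_eq_zero hψ hx)
    (fun x hx => by rw [windowHat_translate_eq_zero hψ hx, mul_zero]),
    evenPart_translate (windowHat_neg hψ), evenPart_neg_mul_translate (windowHat_neg hψ)]

theorem variance_im_atom (hΦ : IsComplexGaussianWhiteNoise Φ P) (hψ : IsCutoff M ψ)
    (A ξ₀ t η p r : ℝ) :
    Var[fun ω => p * (noisySignal A ξ₀ Φ (atom (truncatedWindow ψ) t η) ω).im +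
        r * (noisySignal A ξ₀ Φ (freqAtom (truncatedWindow ψ) t η) ω).im; P] =
      ∫ x, (p * bumpOdd (windowHat ψ) η x + r * (-x * bumpEven (windowHat ψ) η x)) ^ 2 := by
  have hq := continuous_windowHat hψ
  rw [hΦ.variance_im (R := 2 * M + |η|) (isPhasedFourier_atom hψ t η)
    (isPhasedFourier_freqAtom hψ t η) (by fun_prop) (by fun_prop)
    (fun x hx => windowHat_translate_eq_zero hψ hx)
    (fun x hx => by rw [windowHat_translate_eq_zero hψ hx, mul_zero]),
    oddPart_translate (windowHat_neg hψ), oddPart_neg_mul_translate (windowHat_neg hψ)]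

theorem isSplitGaussian_noisySignal (hΦ : IsComplexGaussianWhiteNoise Φ P) (hM : 0 < M)
    (hψ : IsCutoff M ψ) (A ξ₀ t : ℝ) {η : ℝ} (hη : 0 < η) :
    IsSplitGaussian (noisySignal A ξ₀ Φ (atom (truncatedWindow ψ) t η))
      (noisySignal A ξ₀ Φ (freqAtom (truncatedWindow ψ) t η)) P where
  hasGaussianLaw := hΦ.hasGaussianLaw_noisySignal A ξ₀ _ _
  cov_V_V := hΦ.cov_noisySignal_re_im (isPhasedFourier_atom hψ t η) (isPhasedFourier_atom hψ t η)
  cov_V_W := hΦ.cov_noisySignal_re_im (isPhasedFourier_atom hψ t η)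
    (isPhasedFourier_freqAtom hψ t η)
  cov_W_V := hΦ.cov_noisySignal_re_im (isPhasedFourier_freqAtom hψ t η)
    (isPhasedFourier_atom hψ t η)
  cov_W_W := hΦ.cov_noisySignal_re_im (isPhasedFourier_freqAtom hψ t η)
    (isPhasedFourier_freqAtom hψ t η)
  var_re_pos a b hab := by
    rw [variance_re_atom hΦ hψ]
    exact integral_bumpEven_sq_pos (continuous_windowHat hψ) (fun _ => windowHat_eq_zero hψ)
      (by simp [windowHat_zero hψ hM]) hη hab
  var_im_pos a b hab := by
    rw [variance_im_atom hΦ hψ]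
    exact integral_bumpOdd_sq_pos (continuous_windowHat hψ) (fun _ => windowHat_eq_zero hψ)
      (by simp [windowHat_zero hψ hM]) hη hab

theorem norm_fourier_atom_le (hψ : IsCutoff M ψ) : ∃ C, ∀ t η x : ℝ,
    ‖(𝓕 (atom (truncatedWindow ψ) t η)) x‖ ≤ C ∧
      ‖(𝓕 (freqAtom (truncatedWindow ψ) t η)) x‖ ≤ |x| * C := by
  obtain ⟨C, hC⟩ := abs_windowHat_le hψ
  have e : ∀ x t : ℝ, ‖Complex.exp (-(2 * Real.pi * Complex.I * x * t))‖ = 1 := fun x t => by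
    rw [Complex.norm_exp]
    simp
  refine ⟨C, fun t η x => ⟨?_, ?_⟩⟩
  · rw [isPhasedFourier_atom hψ t η x, norm_mul, e, mul_one, Complex.norm_real]
    exact hC _
  · rw [isPhasedFourier_freqAtom hψ t η x, norm_mul, e, mul_one, Complex.norm_real, norm_mul,
      norm_neg, Real.norm_eq_abs]
    gcongr
    exact hC _

/-- Bounds on means and variances, uniform for `η ≤ 1`. -/
theorem exists_mean_variance_bound (hΦ : IsComplexGaussianWhiteNoise Φ P)
    (hψ : IsCutoff M ψ) (A ξ₀ t : ℝ) :
    ∃ L : ℝ, ∀ η ∈ Icc (0 : ℝ) 1,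
      Var[fun ω => (noisySignal A ξ₀ Φ (atom (truncatedWindow ψ) t η) ω).re; P] ≤ L ∧
      Var[fun ω => (noisySignal A ξ₀ Φ (atom (truncatedWindow ψ) t η) ω).im; P] ≤ L ∧
      Var[fun ω => (noisySignal A ξ₀ Φ (freqAtom (truncatedWindow ψ) t η) ω).re; P] ≤ L := by
  have cE := continuous_bumpEven (continuous_windowHat hψ)
  have cO := continuous_bumpOdd (continuous_windowHat hψ)
  have cxO : Continuous (Function.uncurry fun η x : ℝ => -x * bumpOdd (windowHat ψ) η x) := by
    unfold Function.uncurry at *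
    fun_prop
  have aux : ∀ η ∈ Icc (0 : ℝ) 1, ∀ x : ℝ, 2 * M + 1 < |x| → 2 * M + |η| < |x| :=
    fun η hη x hx => by
      rw [abs_of_nonneg hη.1]
      linarith [hη.2]
  have k1 := continuousOn_integral_mul (R := 2 * M + 1) cE cE fun η hη x hx =>
    bumpEven_eq_zero (fun _ => windowHat_eq_zero hψ) (aux η hη x hx)
  have k2 := continuousOn_integral_mul (R := 2 * M + 1) cO cO fun η hη x hx =>
    bumpOdd_eq_zero (fun _ => windowHat_eq_zero hψ) (aux η hη x hx)
  have k3 := continuousOn_integral_mul (R := 2 * M + 1) cxO cxO fun η hη x hx => by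
    rw [bumpOdd_eq_zero (fun _ => windowHat_eq_zero hψ) (aux η hη x hx), mul_zero]
  obtain ⟨L1, h1⟩ := isCompact_Icc.bddAbove_image k1
  obtain ⟨L2, h2⟩ := isCompact_Icc.bddAbove_image k2
  obtain ⟨L3, h3⟩ := isCompact_Icc.bddAbove_image k3
  refine ⟨max L1 (max L2 L3), fun η hη => ⟨?_, ?_, ?_⟩⟩
  · have := variance_re_atom hΦ hψ A ξ₀ t η 1 0
    simp only [one_mul, zero_mul, add_zero, sq] at this
    rw [this]
    exact (h1 (mem_image_of_mem _ hη)).trans (le_max_left _ _)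
  · have := variance_im_atom hΦ hψ A ξ₀ t η 1 0
    simp only [one_mul, zero_mul, add_zero, sq] at this
    rw [this]
    exact (h2 (mem_image_of_mem _ hη)).trans ((le_max_left _ _).trans (le_max_right _ _))
  · have := variance_re_atom hΦ hψ A ξ₀ t η 0 1
    simp only [one_mul, zero_mul, zero_add, sq] at this
    rw [this]
    exact (h3 (mem_image_of_mem _ hη)).trans ((le_max_right _ _).trans (le_max_right _ _))

/-- The kernel moments are `O(α)`, with a constant that stays bounded as `η → 0`. -/
theorem exists_integral_momentKernel_noisySignal_le (hΦ : IsComplexGaussianWhiteNoise Φ P)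
    (hM : 0 < M) (hψ : IsCutoff M ψ) (A ξ₀ t : ℝ) {ξ : ℝ} (hξ : 0 < ξ) {k : ℕ} (hk : 1 ≤ k) :
    ∃ C : ℝ → ℝ, (∀ η > 0, ∀ α > 0,
      ∫ ω, momentKernel k ξ α (noisySignal A ξ₀ Φ (atom (truncatedWindow ψ) t η) ω)
        (noisySignal A ξ₀ Φ (freqAtom (truncatedWindow ψ) t η) ω) ∂P ≤ C η * α) ∧
      ∃ K δ : ℝ, 0 < δ ∧ ∀ η ∈ Ioo 0 δ, C η ≤ K := by
  have hR : ∀ x, 2 * M < |x| → windowHat ψ x = 0 := fun _ => windowHat_eq_zero hψ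
  have h1 : windowHat ψ 0 ≠ 0 := by simp [windowHat_zero hψ hM]
  obtain ⟨B, hB⟩ := norm_fourier_atom_le hψ
  have hB0 : 0 ≤ B := (norm_nonneg _).trans (hB 0 0 0).1
  have mean1 : ∀ η, |∫ ω, (noisySignal A ξ₀ Φ (atom (truncatedWindow ψ) t η) ω).re ∂P| ≤ |A| * B ∧
      |∫ ω, (noisySignal A ξ₀ Φ (atom (truncatedWindow ψ) t η) ω).im ∂P| ≤ |A| * B ∧
      |∫ ω, (noisySignal A ξ₀ Φ (freqAtom (truncatedWindow ψ) t η) ω).re ∂P| ≤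
        |A| * (|ξ₀| * B) := by
    intro η
    have n1 : ‖(A * (𝓕 (atom (truncatedWindow ψ) t η)) (-ξ₀) : ℂ)‖ ≤ |A| * B := by
      rw [norm_mul, Complex.norm_real, Real.norm_eq_abs]
      gcongr
      exact (hB t η _).1
    have n2 : ‖(A * (𝓕 (freqAtom (truncatedWindow ψ) t η)) (-ξ₀) : ℂ)‖ ≤ |A| * (|ξ₀| * B) := by
      rw [norm_mul, Complex.norm_real, Real.norm_eq_abs]
      gcongr
      simpa using (hB t η (-ξ₀)).2
    rw [hΦ.integral_noisySignal_re, hΦ.integral_noisySignal_im, hΦ.integral_noisySignal_re]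
    exact ⟨(Complex.abs_re_le_norm _).trans n1, (Complex.abs_im_le_norm _).trans n1,
      (Complex.abs_re_le_norm _).trans n2⟩
  obtain ⟨L, hL⟩ := exists_mean_variance_bound hΦ hψ A ξ₀ t
  obtain ⟨σ₁, p₁, δ₁, d₁, H₁⟩ := exists_pos_le_integral_bumpEven (contDiff_windowHat hψ) hR h1
  obtain ⟨σ₂, p₂, δ₂, d₂, H₂⟩ := exists_pos_le_integral_bumpOdd (contDiff_windowHat hψ) hR h1
  -- One number dominates the means, and its square dominates the variances; the summand `1` makes
  -- the square at least `|L|`.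
  obtain ⟨K, hK⟩ := exists_integral_momentKernel_le (Ω := Ω) hk hξ
    (1 + |A| * B + |A| * (|ξ₀| * B) + |L|) (lt_min p₁ p₂)
  have hAB : 0 ≤ |A| * B := by positivity
  have hAB' : 0 ≤ |A| * (|ξ₀| * B) := by positivity
  have hbound : ∀ η, 0 < η → η < min 1 (min δ₁ δ₂) → ∀ α > 0,
      ∫ ω, momentKernel k ξ α (noisySignal A ξ₀ Φ (atom (truncatedWindow ψ) t η) ω)
        (noisySignal A ξ₀ Φ (freqAtom (truncatedWindow ψ) t η) ω) ∂P ≤ K * α := by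
    intro η hη hηδ
    obtain ⟨g1, g2⟩ := lt_min_iff.mp hηδ
    obtain ⟨g3, g4⟩ := lt_min_iff.mp g2
    obtain ⟨l1, l2, l3⟩ := hL η ⟨hη.le, g1.le⟩
    obtain ⟨m1, m2, m3⟩ := mean1 η
    have hLL : L ≤ (1 + |A| * B + |A| * (|ξ₀| * B) + |L|) ^ 2 := by
      nlinarith [le_abs_self L, abs_nonneg L]
    refine hK _ _ P (isSplitGaussian_noisySignal hΦ hM hψ A ξ₀ t hη)
      (by linarith [abs_nonneg L]) (by linarith [abs_nonneg L]) (by linarith [abs_nonneg L])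
      (l1.trans hLL) (l2.trans hLL) (l3.trans hLL) (fun c => ?_) (fun c => ?_)
    · have := variance_re_atom hΦ hψ A ξ₀ t η 1 (-c)
      simp only [one_mul, neg_mul, ← sub_eq_add_neg] at this
      rw [this]
      refine (min_le_left _ _).trans ((H₁ η hη g3 c).trans_eq ?_)
      simp only [neg_mul]
    · have := variance_im_atom hΦ hψ A ξ₀ t η (-c) 1
      simp only [one_mul, neg_mul, neg_add_eq_sub] at this
      rw [this]
      refine (min_le_right _ _).trans ((H₂ η hη g4 c).trans_eq ?_)
      congr 1
      ext x
      ring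
  have hpt : ∀ η, ∃ K : ℝ, 0 < η → ∀ α > 0,
      ∫ ω, momentKernel k ξ α (noisySignal A ξ₀ Φ (atom (truncatedWindow ψ) t η) ω)
        (noisySignal A ξ₀ Φ (freqAtom (truncatedWindow ψ) t η) ω) ∂P ≤ K * α := by
    intro η
    rcases lt_or_ge 0 η with hη | hη
    · have hs := isSplitGaussian_noisySignal hΦ hM hψ A ξ₀ t hη
      obtain ⟨s₁, q₁, S₁⟩ := exists_pos_le_variance_sub hs.re_V.memLp_two hs.re_W.memLp_two
        hs.var_re_W_pos fun c => by simpa [← sub_eq_add_neg] using hs.var_re_pos 1 (-c) (by simp)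
      obtain ⟨s₂, q₂, S₂⟩ := exists_pos_le_variance_sub hs.im_W.memLp_two hs.im_V.memLp_two
        hs.var_im_V_pos hs.var_im_sub_pos
      obtain ⟨m1, m2, m3⟩ := mean1 η
      set v₁ := Var[fun ω => (noisySignal A ξ₀ Φ (atom (truncatedWindow ψ) t η) ω).re; P] with e1
      set v₂ := Var[fun ω => (noisySignal A ξ₀ Φ (atom (truncatedWindow ψ) t η) ω).im; P] with e2
      set v₃ := Var[fun ω => (noisySignal A ξ₀ Φ (freqAtom (truncatedWindow ψ) t η) ω).re; P]
        with e3
      have r1 : 0 ≤ v₁ := variance_nonneg _ _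
      have r2 : 0 ≤ v₂ := variance_nonneg _ _
      have r3 : 0 ≤ v₃ := variance_nonneg _ _
      set N := 1 + |A| * B + |A| * (|ξ₀| * B) + v₁ + v₂ + v₃ with hN
      obtain ⟨K', hK'⟩ := exists_integral_momentKernel_le (Ω := Ω) hk hξ N (lt_min q₁ q₂)
      have hN1 : N ≤ N ^ 2 := by nlinarith
      exact ⟨K', fun _ => hK' _ _ P hs (by linarith) (by linarith) (by linarith) (by linarith)
        (by linarith) (by linarith) (fun c => (min_le_left _ _).trans (S₁ c))
        (fun c => (min_le_right _ _).trans (S₂ c))⟩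
    · exact ⟨0, fun h => absurd h hη.not_gt⟩
  choose F hF using hpt
  -- The uniform constant near `0`, and an unspecified constant for each larger `η`.
  refine ⟨fun η => if η < min 1 (min δ₁ δ₂) then K else F η, fun η hη => ?_, K,
    min 1 (min δ₁ δ₂), lt_min one_pos (lt_min d₁ d₂), fun η hη => ?_⟩
  · dsimp only
    split_ifs with hlt
    · exact hbound η hη hlt
    · exact hF η hη
  · dsimp only
    rw [if_pos hη.2]

end Noisy

/-! ### The synchrosqueezing integrand as a function of the transform and its derivative -/

open scoped Classical in
/-- The synchrosqueezing integrand as a function of `v = V` and `w = (2πi)⁻¹ ∂_t V`. -/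
def sstValue (α ξ : ℝ) (v w : ℂ) : ℂ :=
  if v = 0 then 0 else v * (approxDelta α ((ξ : ℂ) - w / v) : ℂ)

theorem measurable_sstValue (α ξ : ℝ) : Measurable fun p : ℂ × ℂ => sstValue α ξ p.1 p.2 := by
  unfold sstValue approxDelta
  refine Measurable.ite (measurable_fst (measurableSet_singleton 0)) measurable_const ?_
  fun_prop

theorem norm_sstValue_le {α : ℝ} (hα : 0 < α) (ξ : ℝ) (v w : ℂ) :
    ‖sstValue α ξ v w‖ ≤ 1 / (Real.pi * α) * ‖v‖ := by
  have := Real.pi_pos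
  unfold sstValue
  split_ifs with h
  · simp only [norm_zero]
    positivity
  · rw [norm_mul, mul_comm, Complex.norm_real, approxDelta, norm_mul,
      Real.norm_of_nonneg (by positivity), Real.norm_of_nonneg (Real.exp_pos _).le]
    gcongr
    refine mul_le_of_le_one_right (by positivity) (Real.exp_le_one_iff.mpr ?_)
    exact neg_nonpos.mpr (by positivity)

/-- Away from `v = 0`, `|ξ - w/v| = |ξv - w|/|v|`; at `v = 0` both sides vanish because `k ≥ 1`. -/
theorem norm_sstValue_pow {α : ℝ} (hα : 0 < α) (ξ : ℝ) {k : ℕ} (hk : 1 ≤ k) (v w : ℂ) :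
    ‖sstValue α ξ v w‖ ^ k = (1 / (Real.pi * α)) ^ k * momentKernel k ξ α v w := by
  have := Real.pi_pos
  unfold sstValue momentKernel
  split_ifs with h
  · simp [h, zero_pow (by omega : k ≠ 0)]
  · have hv : ‖v‖ ≠ 0 := norm_ne_zero_iff.mpr h
    rw [norm_mul, Complex.norm_real, approxDelta, norm_mul,
      Real.norm_of_nonneg (by positivity), Real.norm_of_nonneg (Real.exp_pos _).le, mul_pow,
      mul_pow, ← Real.exp_nat_mul]
    have e1 : (ξ : ℂ) - w / v = (ξ * v - w) / v := by field_simp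
    have e2 : (k : ℝ) * -(‖(ξ : ℂ) - w / v‖ ^ 2 / α) =
        -(k * ‖(ξ : ℂ) * v - w‖ ^ 2 / (α * ‖v‖ ^ 2)) := by
      rw [e1, norm_div]
      field_simp
    rw [e2]
    ring

/-- The ratio `w / v` is unchanged by the common sign. This oddness makes the mean vanish when `(V,
W)` is centred. -/
theorem sstValue_neg (α ξ : ℝ) (v w : ℂ) : sstValue α ξ (-v) (-w) = -sstValue α ξ v w := by
  unfold sstValue
  by_cases h : v = 0 <;> simp [h, neg_div_neg_eq]

theorem continuousAt_sstValue (α ξ : ℝ) {v : ℂ} (hv : v ≠ 0) (w : ℂ) :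
    ContinuousAt (fun p : ℂ × ℂ => sstValue α ξ p.1 p.2) (v, w) := by
  have h1 : ∀ᶠ p : ℂ × ℂ in 𝓝 (v, w), p.1 ≠ 0 :=
    continuousAt_fst.eventually_ne hv
  have h2 : ContinuousAt
      (fun p : ℂ × ℂ => p.1 * (approxDelta α ((ξ : ℂ) - p.2 / p.1) : ℂ)) (v, w) := by
    unfold approxDelta
    have h3 : ContinuousAt (fun p : ℂ × ℂ => p.2 / p.1) (v, w) :=
      continuousAt_snd.div continuousAt_fst hv
    refine continuousAt_fst.mul (Complex.continuous_ofReal.continuousAt.comp ?_)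
    exact continuousAt_const.mul (Real.continuous_exp.continuousAt.comp
      ((((continuousAt_const.sub h3).norm.pow 2).div_const α).neg))
  refine h2.congr (h1.mono fun p hp => ?_)
  simp [sstValue, hp]

section Integrand

variable {Ω : Type*} [MeasurableSpace Ω] {P : Measure Ω} [IsProbabilityMeasure P]
  {Φ : 𝓢(ℝ, ℂ) → Ω → ℂ}

theorem noisySignal_smul (hΦ : IsGRP Φ P) (A ξ₀ : ℝ) (c : ℂ) (φ : 𝓢(ℝ, ℂ)) :
    noisySignal A ξ₀ Φ (c • φ) =ᵐ[P] fun ω => c * noisySignal A ξ₀ Φ φ ω := by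
  filter_upwards [hΦ.map_smul c φ] with ω hω
  rw [noisySignal_eq, noisySignal_eq, hω, FourierTransform.fourier_smul, smul_apply,
    Pi.smul_apply, smul_eq_mul, smul_eq_mul]
  ring

theorem noisySignal_sub (hΦ : IsGRP Φ P) (A ξ₀ : ℝ) (φ χ : 𝓢(ℝ, ℂ)) :
    noisySignal A ξ₀ Φ (φ - χ) =ᵐ[P]
      fun ω => noisySignal A ξ₀ Φ φ ω - noisySignal A ξ₀ Φ χ ω := by
  filter_upwards [hΦ.map_add φ ((-1 : ℂ) • χ), hΦ.map_smul (-1) χ] with ω h1 h2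
  have e : φ - χ = φ + (-1 : ℂ) • χ := by
    rw [neg_smul, one_smul, sub_eq_add_neg]
  rw [e, noisySignal_eq, noisySignal_eq, noisySignal_eq, h1, Pi.add_apply, h2,
    FourierTransform.fourier_add, FourierTransform.fourier_smul, add_apply, smul_apply,
    Pi.smul_apply, smul_eq_mul, smul_eq_mul]
  ring

/-- The factor `(2πi)⁻¹` is moved inside the test function, which is legitimate only almost surely,
as `Φ` is only almost surely linear. -/
theorem sstIntegrand_ae_eq (hΦ : IsGRP Φ P) (A ξ₀ : ℝ) (h : 𝓢(ℝ, ℂ)) (α ξ t η : ℝ) :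
    sstIntegrand (noisySignal A ξ₀ Φ) h α ξ t η =ᵐ[P] fun ω => sstValue α ξ
      (noisySignal A ξ₀ Φ (atom h t η) ω) (noisySignal A ξ₀ Φ (freqAtom h t η) ω) := by
  filter_upwards [noisySignal_smul hΦ A ξ₀ (1 / (2 * Real.pi * Complex.I)) (atomDt h t η)]
    with ω hω
  rw [freqAtom, hω, sstIntegrand, sstValue]
  by_cases h0 : stft (noisySignal A ξ₀ Φ) h t η ω = 0
  · rw [if_pos h0, if_pos (show noisySignal A ξ₀ Φ (atom h t η) ω = 0 from h0)]
  · rw [if_neg h0, if_neg (show ¬ noisySignal A ξ₀ Φ (atom h t η) ω = 0 from h0)]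
    simp only [stft, reassignment, stftDt, mul_div_assoc]

variable {M : ℝ} {ψ : ℝ → ℝ}

theorem memLp_noisySignal (hΦ : IsComplexGaussianWhiteNoise Φ P) (A ξ₀ : ℝ) (φ : 𝓢(ℝ, ℂ))
    {p : ENNReal} (hp : p ≠ ⊤) : MemLp (noisySignal A ξ₀ Φ φ) p P :=
  (hΦ.hasGaussianLaw_noisySignal A ξ₀ φ φ).fst.memLp hp

theorem memLp_sstIntegrand (hΦ : IsComplexGaussianWhiteNoise Φ P) (A ξ₀ : ℝ) (h : 𝓢(ℝ, ℂ))
    {α : ℝ} (hα : 0 < α) (ξ t η : ℝ) {p : ENNReal} (hp : p ≠ ⊤) :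
    MemLp (sstIntegrand (noisySignal A ξ₀ Φ) h α ξ t η) p P := by
  refine MemLp.ae_eq (sstIntegrand_ae_eq hΦ.isGRP A ξ₀ h α ξ t η).symm ?_
  refine ((memLp_noisySignal hΦ A ξ₀ (atom h t η) hp).const_mul
    ((1 / (Real.pi * α) : ℝ) : ℂ)).mono ?_ (.of_forall fun ω => ?_)
  · exact ((measurable_sstValue α ξ).comp_aemeasurable
      (hΦ.hasGaussianLaw_noisySignal A ξ₀ _ _).aemeasurable).aestronglyMeasurable
  · rw [norm_mul, Complex.norm_real, Real.norm_of_nonneg (by have := Real.pi_pos; positivity)]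
    exact norm_sstValue_le hα ξ _ _

/-- Two-sided bounds for the absolute moments of the synchrosqueezing integrand. -/
theorem exists_moment_bounds (hΦ : IsComplexGaussianWhiteNoise Φ P) (hM : 0 < M)
    (hψ : IsCutoff M ψ) (A ξ₀ t : ℝ) {ξ : ℝ} (hξ : 0 < ξ) {k : ℕ} (hk : 1 ≤ k) :
    ∃ c C : ℝ → ℝ, (∀ η > 0, 0 < c η ∧ ∀ α, 0 < α → α ≤ 1 →
        c η * α ^ (-(k : ℤ) + 1) ≤
          ∫ ω, ‖sstIntegrand (noisySignal A ξ₀ Φ) (truncatedWindow ψ) α ξ t η ω‖ ^ k ∂P ∧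
        ∫ ω, ‖sstIntegrand (noisySignal A ξ₀ Φ) (truncatedWindow ψ) α ξ t η ω‖ ^ k ∂P ≤
          C η * α ^ (-(k : ℤ) + 1)) ∧
      ∃ K δ : ℝ, 0 < δ ∧ ∀ η ∈ Ioo 0 δ, C η ≤ K * η ^ (-(1 / 2) : ℝ) := by
  have hπ := Real.pi_pos
  obtain ⟨C, hC, K, δ, hδ, hK⟩ :=
    exists_integral_momentKernel_noisySignal_le hΦ hM hψ A ξ₀ t hξ hk
  have hc : ∀ η, ∃ c : ℝ, 0 < η → 0 < c ∧ ∀ α : ℝ, 0 < α → α ≤ 1 →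
      c * α ≤ ∫ ω, momentKernel k ξ α (noisySignal A ξ₀ Φ (atom (truncatedWindow ψ) t η) ω)
        (noisySignal A ξ₀ Φ (freqAtom (truncatedWindow ψ) t η) ω) ∂P := by
    intro η
    rcases lt_or_ge 0 η with hη | hη
    · obtain ⟨c, h⟩ :=
        (isSplitGaussian_noisySignal hΦ hM hψ A ξ₀ t hη).exists_le_integral_momentKernel k ξ
      exact ⟨c, fun _ => h⟩
    · exact ⟨0, fun h => absurd h hη.not_gt⟩
  choose c hc using hc
  have hint : ∀ α > 0, ∀ η,
      ∫ ω, ‖sstIntegrand (noisySignal A ξ₀ Φ) (truncatedWindow ψ) α ξ t η ω‖ ^ k ∂P =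
      (1 / (Real.pi * α)) ^ k * ∫ ω, momentKernel k ξ α
        (noisySignal A ξ₀ Φ (atom (truncatedWindow ψ) t η) ω)
        (noisySignal A ξ₀ Φ (freqAtom (truncatedWindow ψ) t η) ω) ∂P := by
    intro α hα η
    rw [← integral_const_mul]
    refine integral_congr_ae ?_
    filter_upwards [sstIntegrand_ae_eq hΦ.isGRP A ξ₀ (truncatedWindow ψ) α ξ t η] with ω hω
    rw [hω, norm_sstValue_pow hα ξ hk]
  have hpow : ∀ α > 0, ∀ x : ℝ, (1 / Real.pi) ^ k * x * α ^ (-(k : ℤ) + 1) =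
      (1 / (Real.pi * α)) ^ k * (x * α) := by
    intro α hα x
    rw [zpow_add_one₀ hα.ne', zpow_neg, zpow_natCast, one_div_pow, one_div_pow, mul_pow]
    field_simp
  refine ⟨fun η => (1 / Real.pi) ^ k * c η, fun η => (1 / Real.pi) ^ k * C η, fun η hη =>
    ⟨mul_pos (by positivity) (hc η hη).1, fun α hα hα1 => ⟨?_, ?_⟩⟩,
    (1 / Real.pi) ^ k * |K|, min δ 1, lt_min hδ one_pos, fun η hη => ?_⟩
  · rw [hint α hα, hpow α hα]
    gcongr
    exact (hc η hη).2 α hα hα1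
  · rw [hint α hα, hpow α hα]
    gcongr
    exact hC η hη α hα
  -- The constant is bounded near `0`, and for `η ≤ 1` the factor `η^{-1/2}` only weakens the bound.
  · have h1 : 1 ≤ η ^ (-(1 / 2) : ℝ) := Real.one_le_rpow_of_pos_of_le_one_of_nonpos hη.1
      (hη.2.le.trans (min_le_right _ _)) (by norm_num)
    have h2 := hK η ⟨hη.1, hη.2.trans_le (min_le_left _ _)⟩
    rw [mul_assoc]
    refine mul_le_mul_of_nonneg_left ?_ (by positivity)
    exact (h2.trans (le_abs_self K)).trans (le_mul_of_one_le_right (abs_nonneg K) h1)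

end Integrand

/-! ### Variances and covariances of complex random variables -/

theorem complexVar_conj {Ω : Type*} [MeasurableSpace Ω] {P : Measure Ω}
    (X : Ω → ℂ) : complexVar (fun ω => conj (X ω)) P = complexVar X P := by
  rw [complexVar, complexVar]
  congr 1
  ext ω
  rw [integral_conj, ← map_sub, RCLike.norm_conj]

section Moments

variable {Ω : Type*} [MeasurableSpace Ω] {P : Measure Ω} [IsProbabilityMeasure P] {X Z : Ω → ℂ}

theorem complexVar_eq (hX : MemLp X 2 P) :
    complexVar X P = (∫ ω, ‖X ω‖ ^ 2 ∂P) - ‖∫ ω, X ω ∂P‖ ^ 2 := by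
  set m := ∫ ω, X ω ∂P with hm
  have i1 : Integrable (fun ω => ‖X ω‖ ^ 2) P := by simpa using hX.integrable_norm_pow two_ne_zero
  have i2 : Integrable X P := hX.integrable one_le_two
  have i3 : Integrable (fun ω => (X ω * conj m).re) P := (i2.mul_const _).re
  have e : ∀ ω, ‖X ω - m‖ ^ 2 = ‖X ω‖ ^ 2 + ‖m‖ ^ 2 - 2 * (X ω * conj m).re := fun ω => by
    rw [← Complex.normSq_eq_norm_sq, Complex.normSq_sub, Complex.normSq_eq_norm_sq,
      Complex.normSq_eq_norm_sq]
  have e2 : ∫ ω, (X ω * conj m).re ∂P = ‖m‖ ^ 2 := by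
    have := integral_re (i2.mul_const (conj m))
    simp only [RCLike.re_to_complex] at this
    rw [this, integral_mul_const, ← hm, Complex.mul_conj, Complex.ofReal_re,
      Complex.normSq_eq_norm_sq]
  rw [complexVar, ← hm]
  simp_rw [e]
  rw [integral_sub (f := fun ω => ‖X ω‖ ^ 2 + ‖m‖ ^ 2) (i1.add (integrable_const _))
      (i3.const_mul 2), integral_add i1 (integrable_const _), integral_const_mul, e2]
  simp
  ring

/-- The arithmetic-geometric form `|xz| ≤ (|x|² + |z|²)/2`, which keeps the bound linear in the
variances. -/
theorem norm_complexCov_le (hX : MemLp X 2 P) (hZ : MemLp Z 2 P) :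
    ‖complexCov X Z P‖ ≤ (complexVar X P + complexVar Z P) / 2 := by
  set m := ∫ ω, X ω ∂P with hm
  set n := ∫ ω, Z ω ∂P with hn
  have i1 : Integrable (fun ω => ‖X ω - m‖ ^ 2) P := by
    simpa using (hX.sub (memLp_const m)).integrable_norm_pow two_ne_zero
  have i2 : Integrable (fun ω => ‖Z ω - n‖ ^ 2) P := by
    simpa using (hZ.sub (memLp_const n)).integrable_norm_pow two_ne_zero
  rw [complexCov, complexVar, complexVar, ← hm, ← hn, ← integral_add i1 i2, ← integral_div]
  refine norm_integral_le_of_norm_le ((i1.add i2).div_const 2) (.of_forall fun ω => ?_)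
  rw [norm_mul, RCLike.norm_conj]
  nlinarith [sq_nonneg (‖X ω - m‖ - ‖Z ω - n‖)]

theorem complexCov_eq_zero_of_indepFun (hX : Integrable X P) (hZ : Integrable Z P)
    (h : IndepFun X Z P) : complexCov X Z P = 0 := by
  set m := ∫ ω, X ω ∂P with hm
  set n := ∫ ω, Z ω ∂P with hn
  have h1 : IndepFun (fun ω => X ω - m) (fun ω => conj (Z ω - n)) P :=
    h.comp (φ := fun z => z - m) (ψ := fun z => conj (z - n)) (by fun_prop) (by fun_prop)
  rw [complexCov, ← hm, ← hn, h1.integral_fun_mul_eq_mul_integral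
    (hX.sub (integrable_const _)).aestronglyMeasurable
    (Complex.continuous_conj.comp_aestronglyMeasurable
      (hZ.sub (integrable_const _)).aestronglyMeasurable),
    integral_sub hX (integrable_const _)]
  simp [hm]

end Moments

/-! ### Continuity in `L²` -/

section Continuity

variable {Ω : Type*} [MeasurableSpace Ω] {P : Measure Ω} [IsProbabilityMeasure P]

/-- In `L²`, the covariance is `⟨Z, X⟩ - ⟨1, X⟩⟨Z, 1⟩`, and the inner product is jointly continuous.
-/
theorem continuousOn_complexCov {X Z : ℝ → Ω → ℂ} {s : Set ℝ} (hX : ∀ η, MemLp (X η) 2 P)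
    (hZ : ∀ η, MemLp (Z η) 2 P)
    (cX : ∀ η₀ ∈ s, Tendsto (fun η => eLpNorm (X η - X η₀) 2 P) (𝓝[s] η₀) (𝓝 0))
    (cZ : ∀ η₀ ∈ s, Tendsto (fun η => eLpNorm (Z η - Z η₀) 2 P) (𝓝[s] η₀) (𝓝 0)) :
    ContinuousOn (fun p : ℝ × ℝ => complexCov (X p.1) (Z p.2) P) (s ×ˢ s) := by
  set x : ℝ → Lp ℂ 2 P := fun η => (hX η).toLp (X η) with hx
  set z : ℝ → Lp ℂ 2 P := fun η => (hZ η).toLp (Z η) with hz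
  have cx : ContinuousOn x s := fun η₀ hη₀ =>
    (Lp.tendsto_Lp_iff_tendsto_eLpNorm'' X hX (X η₀) (hX η₀)).mpr (cX η₀ hη₀)
  have cz : ContinuousOn z s := fun η₀ hη₀ =>
    (Lp.tendsto_Lp_iff_tendsto_eLpNorm'' Z hZ (Z η₀) (hZ η₀)).mpr (cZ η₀ hη₀)
  have h1 : MemLp (fun _ : Ω => (1 : ℂ)) 2 P := memLp_const 1
  set one : Lp ℂ 2 P := h1.toLp _ with hone
  have cx1 : ContinuousOn (fun p : ℝ × ℝ => x p.1) (s ×ˢ s) :=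
    cx.comp continuousOn_fst fun p hp => hp.1
  have cz2 : ContinuousOn (fun p : ℝ × ℝ => z p.2) (s ×ˢ s) :=
    cz.comp continuousOn_snd fun p hp => hp.2
  have e1 : ∀ p : ℝ × ℝ, complexCov (X p.1) (Z p.2) P =
      inner ℂ (z p.2) (x p.1) - inner ℂ one (x p.1) * inner ℂ (z p.2) one := by
    intro p
    have g1 : inner ℂ (z p.2) (x p.1) = ∫ ω, X p.1 ω * conj (Z p.2 ω) ∂P := by
      rw [L2.inner_def]
      refine integral_congr_ae ?_
      filter_upwards [(hX p.1).coeFn_toLp, (hZ p.2).coeFn_toLp] with ω u1 u2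
      rw [hx, hz, u1, u2, RCLike.inner_apply]
    have g2 : inner ℂ one (x p.1) = ∫ ω, X p.1 ω ∂P := by
      rw [L2.inner_def]
      refine integral_congr_ae ?_
      filter_upwards [(hX p.1).coeFn_toLp, h1.coeFn_toLp] with ω u1 u2
      rw [hx, hone, u1, u2, RCLike.inner_apply, map_one, mul_one]
    have g3 : inner ℂ (z p.2) one = conj (∫ ω, Z p.2 ω ∂P) := by
      rw [L2.inner_def, ← integral_conj]
      refine integral_congr_ae ?_
      filter_upwards [(hZ p.2).coeFn_toLp, h1.coeFn_toLp] with ω u1 u2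
      rw [hz, hone, u1, u2, RCLike.inner_apply, one_mul]
    rw [g1, g2, g3, complexCov]
    set m := ∫ ω, X p.1 ω ∂P with hm
    set n := ∫ ω, Z p.2 ω ∂P with hn
    have i1 : Integrable (fun ω => X p.1 ω * conj (Z p.2 ω)) P :=
      (hX p.1).integrable_mul (hZ p.2).star
    have i2 : Integrable (X p.1) P := (hX p.1).integrable one_le_two
    have i3 : Integrable (fun ω => conj (Z p.2 ω - n)) P :=
      (((hZ p.2).sub (memLp_const n)).star).integrable one_le_two
    have e2 : ∀ ω, (X p.1 ω - m) * conj (Z p.2 ω - n) =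
        X p.1 ω * conj (Z p.2 ω) - X p.1 ω * conj n - m * conj (Z p.2 ω - n) := fun ω => by
      rw [map_sub]
      ring
    have e3 : ∫ ω, conj (Z p.2 ω - n) ∂P = 0 := by
      rw [integral_conj, integral_sub ((hZ p.2).integrable one_le_two) (integrable_const _)]
      simp [hn]
    simp_rw [e2]
    rw [integral_sub (f := fun ω => X p.1 ω * conj (Z p.2 ω) - X p.1 ω * conj n)
      (i1.sub (i2.mul_const _)) (i3.const_mul m), integral_sub i1 (i2.mul_const _),
      integral_mul_const, integral_const_mul, e3, ← hm]
    ring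
  simp_rw [e1]
  exact (cz2.inner cx1).sub ((continuousOn_const.inner cx1).mul (cz2.inner continuousOn_const))

/-- `L²` continuity of `V` and `W` is inherited by the synchrosqueezing integrand. -/
theorem tendsto_eLpNorm_sstValue {V W : ℝ → Ω → ℂ} {l : Filter ℝ} [l.IsCountablyGenerated]
    {η₀ : ℝ} (hV : ∀ η, MemLp (V η) 2 P) (hW : ∀ η, MemLp (W η) 2 P)
    (cV : Tendsto (fun η => eLpNorm (V η - V η₀) 2 P) l (𝓝 0))
    (cW : Tendsto (fun η => eLpNorm (W η - W η₀) 2 P) l (𝓝 0))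
    (h0 : ∀ᵐ ω ∂P, V η₀ ω ≠ 0) {α : ℝ} (hα : 0 < α) (ξ : ℝ) :
    Tendsto (fun η => eLpNorm ((fun ω => sstValue α ξ (V η ω) (W η ω)) -
      fun ω => sstValue α ξ (V η₀ ω) (W η₀ ω)) 2 P) l (𝓝 0) := by
  have mY : ∀ η, AEStronglyMeasurable (fun ω => sstValue α ξ (V η ω) (W η ω)) P := fun η =>
    ((measurable_sstValue α ξ).comp_aemeasurable
      ((hV η).aemeasurable.prodMk (hW η).aemeasurable)).aestronglyMeasurable
  set C : ℂ := ((1 / (Real.pi * α) : ℝ) : ℂ) with hC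
  have hle : ∀ η ω, ‖sstValue α ξ (V η ω) (W η ω)‖ ≤ ‖C * V η ω‖ := fun η ω => by
    rw [norm_mul, hC, Complex.norm_real, Real.norm_of_nonneg (by have := Real.pi_pos; positivity)]
    exact norm_sstValue_le hα ξ _ _
  have hCV : ∀ η, MemLp (fun ω => C * V η ω) 2 P := fun η => (hV η).const_mul C
  have hY : ∀ η, MemLp (fun ω => sstValue α ξ (V η ω) (W η ω)) 2 P := fun η =>
    (hCV η).mono (mY η) (.of_forall (hle η))
  -- Two successive subsequences make `V` and then `W` converge almost surely. Vitali's theorem then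
  -- applies: uniform integrability is inherited from `C * V` by domination, and `sstValue` is
  -- continuous where the limit of `V` is nonzero.
  refine tendsto_of_subseq_tendsto fun ns hns => ?_
  have tV := cV.comp hns
  have tW := cW.comp hns
  obtain ⟨m₁, hm₁, a₁⟩ := (tendstoInMeasure_of_tendsto_eLpNorm two_ne_zero
    (fun n => (hV (ns n)).1) (hV η₀).1 tV).exists_seq_tendsto_ae
  obtain ⟨m₂, hm₂, a₂⟩ := (tendstoInMeasure_of_tendsto_eLpNorm two_ne_zero
    (fun n => (hW (ns (m₁ n))).1) (hW η₀).1
    (tW.comp hm₁.tendsto_atTop)).exists_seq_tendsto_ae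
  refine ⟨fun n => m₁ (m₂ n), ?_⟩
  have tCV : Tendsto (fun n => eLpNorm ((fun ω => C * V (ns (m₁ (m₂ n))) ω) -
      fun ω => C * V η₀ ω) 2 P) atTop (𝓝 0) := by
    have h1 := (tV.comp hm₁.tendsto_atTop).comp hm₂.tendsto_atTop
    have h2 := ENNReal.Tendsto.const_mul h1 (Or.inr (enorm_ne_top (x := C)))
    rw [mul_zero] at h2
    refine h2.congr fun n => ?_
    simp only [Function.comp_apply]
    rw [← eLpNorm_const_smul]
    congr 1
    ext ω
    simp [mul_sub]
  have hUI : UnifIntegrable (fun n ω => C * V (ns (m₁ (m₂ n))) ω) 2 P :=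
    unifIntegrable_of_tendsto_Lp one_le_two (by simp) (fun n => hCV _) (hCV η₀) tCV
  refine tendsto_Lp_finite_of_tendsto_ae one_le_two (by simp)
    (f := fun n ω => sstValue α ξ (V (ns (m₁ (m₂ n))) ω) (W (ns (m₁ (m₂ n))) ω))
    (fun n => mY _) (hY η₀) ?_ ?_
  · intro ε hε
    obtain ⟨δ, hδ, h⟩ := hUI hε
    refine ⟨δ, hδ, fun n s hs hsδ => (eLpNorm_mono fun ω => ?_).trans (h n s hs hsδ)⟩
    by_cases hω : ω ∈ s
    · rw [indicator_of_mem hω, indicator_of_mem hω]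
      exact hle _ _
    · rw [indicator_of_notMem hω, indicator_of_notMem hω]
  · filter_upwards [a₁, a₂, h0] with ω u1 u2 u3
    exact (continuousAt_sstValue α ξ u3 (W η₀ ω)).tendsto.comp
      ((u1.comp hm₂.tendsto_atTop).prodMk_nhds u2)

variable {Φ : 𝓢(ℝ, ℂ) → Ω → ℂ} {M : ℝ} {ψ : ℝ → ℝ}

/-- The white noise isometry: the covariance functional on the diagonal, with the phase cancelled.
-/
theorem IsComplexGaussianWhiteNoise.eLpNorm_eq (hΦ : IsComplexGaussianWhiteNoise Φ P) {t : ℝ}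
    {φ : 𝓢(ℝ, ℂ)} {a : ℝ → ℝ} (hφ : IsPhasedFourier t φ a) :
    eLpNorm (Φ φ) 2 P = ENNReal.ofReal √(∫ x, a x * a x) := by
  rw [(hΦ.memLp φ (by simp)).eLpNorm_eq_integral_rpow_norm two_ne_zero (by simp)]
  have h1 := hΦ.covariance_eq φ φ
  rw [hφ.integral_mul_conj hφ] at h1
  have h2 : ∀ ω, Φ φ ω * conj (Φ φ ω) = ((‖Φ φ ω‖ ^ 2 : ℝ) : ℂ) := fun ω => by
    rw [Complex.mul_conj, Complex.normSq_eq_norm_sq]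
  simp_rw [h2] at h1
  rw [integral_complex_ofReal, Complex.ofReal_inj] at h1
  simp only [ENNReal.toReal_ofNat, Real.rpow_two]
  rw [h1, Real.sqrt_eq_rpow]
  norm_num

/-- If the Fourier transforms of the test functions depend continuously on a parameter, then so
do the values of the noisy signal, in `L²`. -/
theorem tendsto_eLpNorm_noisySignal (hΦ : IsComplexGaussianWhiteNoise Φ P) (A ξ₀ : ℝ) {t R : ℝ}
    {φ : ℝ → 𝓢(ℝ, ℂ)} {a : ℝ → ℝ → ℝ} (hφ : ∀ η, IsPhasedFourier t (φ η) (a η))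
    (ha : Continuous (Function.uncurry a)) (ha0 : ∀ η x, R + |η| < |x| → a η x = 0) (η₀ : ℝ) :
    Tendsto (fun η => eLpNorm (noisySignal A ξ₀ Φ (φ η) - noisySignal A ξ₀ Φ (φ η₀)) 2 P)
      (𝓝 η₀) (𝓝 0) := by
  have hd : ∀ η, IsPhasedFourier t (φ η - φ η₀) (fun x => a η x - a η₀ x) := fun η x => by
    rw [sub_eq_add_neg, FourierTransform.fourier_add, FourierTransform.fourier_neg, add_apply,
      neg_apply, hφ η x, hφ η₀ x]
    push_cast
    ring
  have ca : ∀ x, Continuous fun η => a η x := fun x =>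
    ha.comp (by fun_prop : Continuous fun η => (η, x))
  have ca' : Continuous (a η₀) := ha.comp (by fun_prop : Continuous fun x => (η₀, x))
  have cd : Continuous (Function.uncurry fun η x => a η x - a η₀ x) := by
    unfold Function.uncurry at *
    fun_prop
  have hI : ContinuousOn (fun η => ∫ x, (a η x - a η₀ x) * (a η x - a η₀ x)) (Icc (η₀ - 1) (η₀ + 1)) := by
    refine continuousOn_integral_mul (R := R + (|η₀| + 1)) cd cd fun η hη x hx => ?_
    have h1 : |η| ≤ |η₀| + 1 := by
      have h2 := le_abs_self η₀
      have h3 := neg_abs_le η₀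
      rw [abs_le]
      constructor <;> linarith [hη.1, hη.2]
    rw [ha0 η x (by linarith), ha0 η₀ x (by linarith), sub_zero]
  have hI0 := (hI.continuousAt (Icc_mem_nhds (by linarith) (by linarith))).tendsto
  simp only [sub_self, mul_zero, integral_zero] at hI0
  have t1 : Tendsto (fun η => ENNReal.ofReal √(∫ x, (a η x - a η₀ x) * (a η x - a η₀ x)))
      (𝓝 η₀) (𝓝 0) := by
    have := (ENNReal.continuous_ofReal.comp Real.continuous_sqrt).continuousAt.tendsto.comp hI0
    simpa [Function.comp_def] using this
  have t2 : Tendsto (fun η => ‖(A : ℂ) * (𝓕 (φ η - φ η₀)) (-ξ₀)‖ₑ) (𝓝 η₀) (𝓝 0) := by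
    have : Continuous fun η => ‖(A : ℂ) * (𝓕 (φ η - φ η₀)) (-ξ₀)‖ₑ := by
      simp_rw [hd _ (-ξ₀)]
      have := ca (-ξ₀)
      fun_prop
    have := this.tendsto η₀
    simpa [sub_self, FourierTransform.fourier_zero] using this
  have t3 := t2.add t1
  rw [add_zero] at t3
  refine tendsto_of_tendsto_of_tendsto_of_le_of_le tendsto_const_nhds t3 (fun _ => zero_le) fun η => ?_
  have e : noisySignal A ξ₀ Φ (φ η) - noisySignal A ξ₀ Φ (φ η₀) =ᵐ[P]
      (fun _ => (A : ℂ) * (𝓕 (φ η - φ η₀)) (-ξ₀)) + Φ (φ η - φ η₀) := by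
    filter_upwards [noisySignal_sub hΦ.isGRP A ξ₀ (φ η) (φ η₀)] with ω hω
    rw [Pi.sub_apply, ← hω, noisySignal_eq, Pi.add_apply]
  dsimp only
  rw [eLpNorm_congr_ae e]
  refine (eLpNorm_add_le aestronglyMeasurable_const
    (hΦ.memLp (φ η - φ η₀) (p := 2) (by simp)).1 one_le_two).trans ?_
  rw [hΦ.eLpNorm_eq (hd η), eLpNorm_const _ two_ne_zero (NeZero.ne P)]
  simp

theorem tendsto_eLpNorm_sstIntegrand (hΦ : IsComplexGaussianWhiteNoise Φ P) (hM : 0 < M)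
    (hψ : IsCutoff M ψ) (A ξ₀ : ℝ) {α : ℝ} (hα : 0 < α) (ξ t : ℝ) {η₀ : ℝ} (hη₀ : 0 < η₀) :
    Tendsto (fun η =>
      eLpNorm (sstIntegrand (noisySignal A ξ₀ Φ) (truncatedWindow ψ) α ξ t η -
        sstIntegrand (noisySignal A ξ₀ Φ) (truncatedWindow ψ) α ξ t η₀) 2 P) (𝓝 η₀) (𝓝 0) := by
  have hq := continuous_windowHat hψ
  have t1 := tendsto_eLpNorm_noisySignal (R := 2 * M) hΦ A ξ₀ (isPhasedFourier_atom hψ t)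
    (by unfold Function.uncurry; fun_prop) (fun η x hx => windowHat_translate_eq_zero hψ hx) η₀
  have t2 := tendsto_eLpNorm_noisySignal (R := 2 * M) hΦ A ξ₀ (isPhasedFourier_freqAtom hψ t)
    (by unfold Function.uncurry; fun_prop)
    (fun η x hx => by rw [windowHat_translate_eq_zero hψ hx, mul_zero]) η₀
  have hs := isSplitGaussian_noisySignal hΦ hM hψ A ξ₀ t hη₀
  -- `Re V` is a nondegenerate real Gaussian, so it has no atom at `0`.
  have h0 : ∀ᵐ ω ∂P, noisySignal A ξ₀ Φ (atom (truncatedWindow ψ) t η₀) ω ≠ 0 := by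
    have h1 : P.map (fun ω => (noisySignal A ξ₀ Φ (atom (truncatedWindow ψ) t η₀) ω).re) {0} = 0 := by
      rw [hs.re_V.map_eq_gaussianReal]
      have := nullSingletonClass_gaussianReal
        (μ := ∫ ω, (noisySignal A ξ₀ Φ (atom (truncatedWindow ψ) t η₀) ω).re ∂P)
        (Real.toNNReal_pos.mpr hs.var_re_V_pos).ne'
      exact measure_singleton 0
    rw [Measure.map_apply_of_aemeasurable hs.re_V.aemeasurable (measurableSet_singleton 0)] at h1
    filter_upwards [measure_eq_zero_iff_ae_notMem.mp h1] with ω hω h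
    exact hω (by simp [h])
  have t3 := tendsto_eLpNorm_sstValue
    (fun η => memLp_noisySignal hΦ A ξ₀ (atom (truncatedWindow ψ) t η) (by simp))
    (fun η => memLp_noisySignal hΦ A ξ₀ (freqAtom (truncatedWindow ψ) t η) (by simp))
    t1 t2 h0 hα ξ
  refine t3.congr fun η => eLpNorm_congr_ae ?_
  exact ((sstIntegrand_ae_eq hΦ.isGRP A ξ₀ _ α ξ t η).sub
    (sstIntegrand_ae_eq hΦ.isGRP A ξ₀ _ α ξ t η₀)).symm

end Continuity

/-! ### Vanishing means and decorrelation -/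

/-- A centred Gaussian characteristic functional depends only on the variances of the linear forms,
which ignore signs. -/
theorem HasGaussianLaw.identDistrib_neg {E Ω : Type*} [NormedAddCommGroup E] [NormedSpace ℝ E]
    [CompleteSpace E] [SecondCountableTopology E] [MeasurableSpace E] [BorelSpace E]
    [MeasurableSpace Ω] {P : Measure Ω} {X : Ω → E} (hX : HasGaussianLaw X P)
    (h0 : ∫ ω, X ω ∂P = 0) : IdentDistrib X (fun ω => -X ω) P P := by
  have hX' : HasGaussianLaw (fun ω => -X ω) P := hX.neg
  have hm : ∀ L : StrongDual ℝ E, ∫ ω, L (X ω) ∂P = 0 := fun L => by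
    rw [L.integral_comp_comm hX.integrable, h0, map_zero]
  have := hX.isProbabilityMeasure
  refine ⟨hX.aemeasurable, hX'.aemeasurable, Measure.ext_of_charFunDual ?_⟩
  ext L
  rw [hX.charFunDual_map_eq_fun, hX'.charFunDual_map_eq_fun]
  simp only [map_neg]
  rw [integral_neg, hm, variance_fun_neg]
  simp

section Final

variable {Ω : Type*} [MeasurableSpace Ω] {P : Measure Ω} [IsProbabilityMeasure P]
  {Φ : 𝓢(ℝ, ℂ) → Ω → ℂ} {M : ℝ} {ψ : ℝ → ℝ}

theorem integral_noisySignal (hΦ : IsComplexGaussianWhiteNoise Φ P) (A ξ₀ : ℝ) (φ : 𝓢(ℝ, ℂ)) :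
    ∫ ω, noisySignal A ξ₀ Φ φ ω ∂P = A * (𝓕 φ) (-ξ₀) := by
  simp only [noisySignal_eq]
  rw [integral_add (integrable_const _) ((hΦ.memLp φ (p := 1) (by simp)).integrable le_rfl),
    hΦ.mean_zero]
  simp

theorem integral_sstIntegrand_eq_zero (hΦ : IsComplexGaussianWhiteNoise Φ P) (A ξ₀ : ℝ)
    (h : 𝓢(ℝ, ℂ)) (α ξ t η : ℝ) (h1 : (A : ℂ) * (𝓕 (atom h t η)) (-ξ₀) = 0)
    (h2 : (A : ℂ) * (𝓕 (freqAtom h t η)) (-ξ₀) = 0) :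
    ∫ ω, sstIntegrand (noisySignal A ξ₀ Φ) h α ξ t η ω ∂P = 0 := by
  have hG := hΦ.hasGaussianLaw_noisySignal A ξ₀ (atom h t η) (freqAtom h t η)
  have h0 : ∫ ω, (noisySignal A ξ₀ Φ (atom h t η) ω, noisySignal A ξ₀ Φ (freqAtom h t η) ω) ∂P =
      0 := by
    rw [integral_pair hG.fst.integrable hG.snd.integrable, integral_noisySignal hΦ,
      integral_noisySignal hΦ, h1, h2]
    rfl
  have hI := ((HasGaussianLaw.identDistrib_neg hG h0).comp (measurable_sstValue α ξ)).integral_eq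
  simp only [Function.comp_apply, Prod.neg_mk, sstValue_neg] at hI
  rw [integral_neg] at hI
  rw [integral_congr_ae (sstIntegrand_ae_eq hΦ.isGRP A ξ₀ h α ξ t η)]
  exact self_eq_neg.mp hI

theorem indepFun_sstIntegrand (hΦ : IsComplexGaussianWhiteNoise Φ P) (hψ : IsCutoff M ψ)
    (A ξ₀ α ξ t : ℝ) {η η' : ℝ} (hη : 0 < η) (hη' : 0 < η') (hηη' : 4 * M < |η - η'|) :
    IndepFun (sstIntegrand (noisySignal A ξ₀ Φ) (truncatedWindow ψ) α ξ t η)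
      (sstIntegrand (noisySignal A ξ₀ Φ) (truncatedWindow ψ) α ξ t η') P := by
  set u : ℝ → Fin 2 → 𝓢(ℝ, ℂ) := fun η =>
    ![atom (truncatedWindow ψ) t η, freqAtom (truncatedWindow ψ) t η] with hu
  set a : ℝ → Fin 2 → ℝ → ℝ := fun η =>
    ![fun x => windowHat ψ (x + η), fun x => -x * windowHat ψ (x + η)] with ha
  have hua : ∀ η i, IsPhasedFourier t (u η i) (a η i) := fun η i => by
    fin_cases i
    · exact isPhasedFourier_atom hψ t η
    · exact isPhasedFourier_freqAtom hψ t η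
  have ha0 : ∀ η i x, 2 * M < |x + η| → a η i x = 0 := fun η i x hx => by
    fin_cases i <;> simp [ha, windowHat_eq_zero hψ hx]
  have hdisj : ∀ x, 2 * M < |x + η| ∨ 2 * M < |x + η'| := fun x => by
    by_contra! h
    have := abs_sub (x + η) (x + η')
    rw [add_sub_add_left_eq_sub] at this
    linarith
  -- Disjointness from the reflected support, needed for the pseudocovariance. Positivity of both
  -- frequencies enters through `|η - η'| ≤ η + η'`.
  have hdisj' : ∀ x, 2 * M < |x + η| ∨ 2 * M < |-x + η'| := fun x => by
    by_contra! h
    have h1 := abs_add_le (x + η) (-x + η')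
    have h2 : |η - η'| ≤ x + η + (-x + η') := by
      rw [abs_le]
      constructor <;> linarith
    linarith [le_abs_self (x + η + (-x + η'))]
  have hcov : ∀ i j c d,
      cov[fun ω => (c * Φ (u η i) ω).re, fun ω => (d * Φ (u η' j) ω).re; P] = 0 := by
    intro i j c d
    have e1 : ∀ x, a η i x * a η' j x = 0 := fun x => by
      rcases hdisj x with hx | hx <;> simp [ha0 _ _ x hx]
    have e2 : ∀ x, a η i x * a η' j (-x) = 0 := fun x => by
      rcases hdisj' x with hx | hx
      · simp [ha0 _ _ x hx]
      · simp [ha0 _ _ (-x) hx]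
    rw [hΦ.cov_re_mul, (hua η i).integral_mul_conj (hua η' j),
      (hua η i).integral_mul_neg (hua η' j)]
    simp_rw [e1, e2]
    simp
  have hGP : IsGaussianProcess (Sum.elim (fun i => Φ (u η i)) (fun j => Φ (u η' j))) P := by
    have e : Sum.elim (fun i => Φ (u η i)) (fun j => Φ (u η' j)) =
        Φ ∘ Sum.elim (u η) (u η') := by
      funext i
      rcases i with i | i <;> rfl
    rw [e]
    exact hΦ.isGaussian.comp_right _
  have hind := hGP.indepFun_of_covariance_inner (fun i => hΦ.isGRP.aemeasurable _)
    (fun j => hΦ.isGRP.aemeasurable _) fun i j x y => by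
      have e : ∀ (x z : ℂ), inner ℝ x z = (conj x * z).re := fun x z => by
        rw [Complex.inner, mul_comm]
      simp_rw [e]
      exact hcov i j _ _
  have hval : ∀ η, sstIntegrand (noisySignal A ξ₀ Φ) (truncatedWindow ψ) α ξ t η =ᵐ[P]
      (fun y : Fin 2 → ℂ => sstValue α ξ (A * (𝓕 (u η 0)) (-ξ₀) + y 0)
        (A * (𝓕 (u η 1)) (-ξ₀) + y 1)) ∘ fun ω i => Φ (u η i) ω := fun η => by
    filter_upwards [sstIntegrand_ae_eq hΦ.isGRP A ξ₀ (truncatedWindow ψ) α ξ t η] with ω hω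
    rw [hω, noisySignal_eq, noisySignal_eq]
    rfl
  have hmeas : ∀ c d : ℂ, Measurable fun y : Fin 2 → ℂ => sstValue α ξ (c + y 0) (d + y 1) :=
    fun c d => (measurable_sstValue α ξ).comp
      (by fun_prop : Measurable fun y : Fin 2 → ℂ => (c + y 0, d + y 1))
  exact (hind.comp (hmeas _ _) (hmeas _ _)).congr (hval η).symm (hval η').symm

theorem complexCov_sstIntegrand_eq_zero (hΦ : IsComplexGaussianWhiteNoise Φ P)
    (hψ : IsCutoff M ψ) (A ξ₀ : ℝ) {α : ℝ} (hα : 0 < α) (ξ t : ℝ) {η η' : ℝ} (hη : 0 < η)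
    (hη' : 0 < η') (hηη' : 4 * M < |η - η'|) :
    complexCov (sstIntegrand (noisySignal A ξ₀ Φ) (truncatedWindow ψ) α ξ t η)
      (sstIntegrand (noisySignal A ξ₀ Φ) (truncatedWindow ψ) α ξ t η') P = 0 ∧
    complexCov (sstIntegrand (noisySignal A ξ₀ Φ) (truncatedWindow ψ) α ξ t η)
      (fun ω => conj (sstIntegrand (noisySignal A ξ₀ Φ) (truncatedWindow ψ) α ξ t η' ω)) P = 0 := by
  have hI := indepFun_sstIntegrand hΦ hψ A ξ₀ α ξ t hη hη' hηη'
  have hm : ∀ η, Integrable (sstIntegrand (noisySignal A ξ₀ Φ) (truncatedWindow ψ) α ξ t η) P :=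
    fun η => (memLp_sstIntegrand hΦ A ξ₀ _ hα ξ t η (p := 1) (by simp)).integrable le_rfl
  have hm' : Integrable
      (fun ω => conj (sstIntegrand (noisySignal A ξ₀ Φ) (truncatedWindow ψ) α ξ t η' ω)) P :=
    ((memLp_sstIntegrand hΦ A ξ₀ _ hα ξ t η' (p := 1) (by simp)).star).integrable le_rfl
  exact ⟨complexCov_eq_zero_of_indepFun (hm η) (hm η') hI,
    complexCov_eq_zero_of_indepFun (hm η) hm'
      (hI.comp measurable_id Complex.continuous_conj.measurable)⟩

/-- Two-sided bounds for the variance of the synchrosqueezing integrand. -/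
theorem exists_variance_bounds (hΦ : IsComplexGaussianWhiteNoise Φ P) (hM : 0 < M)
    (hψ : IsCutoff M ψ) (A ξ₀ t : ℝ) {ξ : ℝ} (hξ : 0 < ξ) :
    ∃ c C : ℝ → ℝ, (∀ η > 0, 0 < c η ∧ ∀ᶠ α : ℝ in 𝓝[>] 0,
        c η * α⁻¹ ≤
          complexVar (sstIntegrand (noisySignal A ξ₀ Φ) (truncatedWindow ψ) α ξ t η) P ∧
        complexVar (sstIntegrand (noisySignal A ξ₀ Φ) (truncatedWindow ψ) α ξ t η) P ≤
          C η * α⁻¹) ∧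
      ∃ K δ : ℝ, 0 < δ ∧ ∀ η ∈ Ioo 0 δ, C η ≤ K * η ^ (-(1 / 2) : ℝ) := by
  obtain ⟨c, C, hcC, hK⟩ := exists_moment_bounds hΦ hM hψ A ξ₀ t hξ (k := 2) (by norm_num)
  obtain ⟨_, D, hD, -⟩ := exists_moment_bounds hΦ hM hψ A ξ₀ t hξ (k := 1) le_rfl
  refine ⟨fun η => c η / 2, C, fun η hη => ⟨half_pos (hcC η hη).1, ?_⟩, hK⟩
  have hc := (hcC η hη).1
  -- For `α ≤ ε`, the squared mean, at most `D η ^ 2`, is less than half of the lower bound `c η /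
  -- α` for the second moment.
  set ε := min 1 (c η / (2 * (D η ^ 2 + 1))) with hε
  have hε0 : 0 < ε := lt_min one_pos (by positivity)
  filter_upwards [Ioc_mem_nhdsGT hε0] with α hα
  have hα0 : 0 < α := hα.1
  have hα1 : α ≤ 1 := hα.2.trans (min_le_left _ _)
  have h1 := (hcC η hη).2 α hα0 hα1
  have h2 := ((hD η hη).2 α hα0 hα1).2
  have e1 : (-((2 : ℕ) : ℤ) + 1) = -1 := by norm_num
  have e2 : (-((1 : ℕ) : ℤ) + 1) = 0 := by norm_num
  rw [e1, zpow_neg_one] at h1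
  rw [e2, zpow_zero, mul_one] at h2
  simp only [pow_one] at h2
  rw [complexVar_eq (memLp_sstIntegrand hΦ A ξ₀ _ hα0 ξ t η (by simp))]
  set m := ‖∫ ω, sstIntegrand (noisySignal A ξ₀ Φ) (truncatedWindow ψ) α ξ t η ω ∂P‖ with hm
  have h3 : m ≤ D η := (norm_integral_le_integral_norm _).trans h2
  have h4 : m ^ 2 ≤ D η ^ 2 := by gcongr
  have h5 : D η ^ 2 + 1 ≤ c η / 2 * α⁻¹ := by
    have := hα.2.trans (min_le_right _ _)
    rw [le_div_iff₀ (by positivity)] at this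
    rw [← div_eq_mul_inv, le_div_iff₀ hα0]
    linarith
  exact ⟨by linarith [h1.1], by linarith [h1.2, sq_nonneg m]⟩

theorem continuousOn_complexCov_sstIntegrand (hΦ : IsComplexGaussianWhiteNoise Φ P) (hM : 0 < M)
    (hψ : IsCutoff M ψ) (A ξ₀ : ℝ) {α : ℝ} (hα : 0 < α) (ξ t : ℝ) :
    ContinuousOn (fun p : ℝ × ℝ =>
      complexCov (sstIntegrand (noisySignal A ξ₀ Φ) (truncatedWindow ψ) α ξ t p.1)
        (sstIntegrand (noisySignal A ξ₀ Φ) (truncatedWindow ψ) α ξ t p.2) P) (Ioi 0 ×ˢ Ioi 0) ∧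
    ContinuousOn (fun p : ℝ × ℝ =>
      complexCov (sstIntegrand (noisySignal A ξ₀ Φ) (truncatedWindow ψ) α ξ t p.1)
        (fun ω => conj (sstIntegrand (noisySignal A ξ₀ Φ) (truncatedWindow ψ) α ξ t p.2 ω)) P)
      (Ioi 0 ×ˢ Ioi 0) := by
  have hm : ∀ η, MemLp (sstIntegrand (noisySignal A ξ₀ Φ) (truncatedWindow ψ) α ξ t η) 2 P :=
    fun η => memLp_sstIntegrand hΦ A ξ₀ _ hα ξ t η (by simp)
  have ht : ∀ η₀ ∈ Ioi (0 : ℝ), Tendsto (fun η =>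
      eLpNorm (sstIntegrand (noisySignal A ξ₀ Φ) (truncatedWindow ψ) α ξ t η -
        sstIntegrand (noisySignal A ξ₀ Φ) (truncatedWindow ψ) α ξ t η₀) 2 P)
      (𝓝[Ioi 0] η₀) (𝓝 0) := fun η₀ hη₀ =>
    (tendsto_eLpNorm_sstIntegrand hΦ hM hψ A ξ₀ hα ξ t hη₀).mono_left nhdsWithin_le_nhds
  refine ⟨continuousOn_complexCov hm hm ht ht,
    continuousOn_complexCov (Z := fun η ω => conj (sstIntegrand (noisySignal A ξ₀ Φ)
      (truncatedWindow ψ) α ξ t η ω)) hm (fun η => (hm η).star) ht fun η₀ hη₀ => ?_⟩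
  refine (ht η₀ hη₀).congr fun η => eLpNorm_congr_norm_ae (.of_forall fun ω => ?_)
  rw [Pi.sub_apply, Pi.sub_apply, ← map_sub, RCLike.norm_conj]

end Final

end SST

end

/-! ### Assembly of the theorem -/

theorem mainTheorem7 {Ω : Type*} [MeasurableSpace Ω] (P : Measure Ω) [IsProbabilityMeasure P]
    (Φ : 𝓢(ℝ, ℂ) → Ω → ℂ) (hΦ : SST.IsComplexGaussianWhiteNoise Φ P)
    (A ξ₀ : ℝ) (hA : 0 ≤ A) (hξ₀ : 0 < ξ₀)
    (M : ℝ) (hM : 0 < M) (ψ : ℝ → ℝ) (hψ : SST.IsCutoff M ψ)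
    (t ξ : ℝ) (hξ : 0 < ξ) (k : ℕ) (hk : 1 ≤ k)
    (Y : ℝ → ℝ → Ω → ℂ)
    (hY : ∀ α η, Y α η =
      SST.sstIntegrand (SST.noisySignal A ξ₀ Φ) (SST.truncatedWindow ψ) α ξ t η) :
    -- finite absolute moments and finite variance
    (∀ α > 0, ∀ η > 0, MemLp (Y α η) (k : ENNReal) P ∧ MemLp (Y α η) 2 P) ∧
    -- absolute moments
    (∃ c C : ℝ → ℝ,
      (∀ η > 0, 0 < c η ∧ ∀ᶠ α : ℝ in 𝓝[>] 0,
        c η * α ^ (-(k : ℤ) + 1) ≤ ∫ ω, ‖Y α η ω‖ ^ k ∂P ∧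
        ∫ ω, ‖Y α η ω‖ ^ k ∂P ≤ C η * α ^ (-(k : ℤ) + 1)) ∧
      (∃ K δ : ℝ, 0 < δ ∧ ∀ η ∈ Ioo 0 δ, C η ≤ K * η ^ (-(1 / 2) : ℝ))) ∧
    -- variance
    (∃ c C : ℝ → ℝ,
      (∀ η > 0, 0 < c η ∧ ∀ᶠ α : ℝ in 𝓝[>] 0,
        c η * α⁻¹ ≤ SST.complexVar (Y α η) P ∧ SST.complexVar (Y α η) P ≤ C η * α⁻¹) ∧
      (∃ K δ : ℝ, 0 < δ ∧ ∀ η ∈ Ioo 0 δ, C η ≤ K * η ^ (-(1 / 2) : ℝ))) ∧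
    -- mean, null case
    (A = 0 → ∀ α > 0, ∀ η > 0, ∫ ω, Y α η ω ∂P = 0) ∧
    -- mean, non-null case
    (0 < A → ∃ K R : ℝ, ∀ α > 0, ∀ η > 0, R ≤ |η - ξ₀| →
      ‖∫ ω, Y α η ω ∂P‖ ≤ K * Real.exp (-|η - ξ₀| ^ 2)) ∧
    -- continuity of the covariance and of the pseudocovariance
    (∀ α > 0,
      ContinuousOn (fun p : ℝ × ℝ => SST.complexCov (Y α p.1) (Y α p.2) P) (Ioi 0 ×ˢ Ioi 0) ∧
      ContinuousOn (fun p : ℝ × ℝ => SST.complexCov (Y α p.1) (fun ω => conj (Y α p.2 ω)) P)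
        (Ioi 0 ×ˢ Ioi 0)) ∧
    -- bounds on the covariance and on the pseudocovariance
    (∃ B : ℝ → ℝ → ℝ,
      (∀ η > 0, ∀ η' > 0, η ≠ η' → ∀ᶠ α : ℝ in 𝓝[>] 0,
        ‖SST.complexCov (Y α η) (Y α η') P‖ ≤ B η η' * α⁻¹ ∧
        ‖SST.complexCov (Y α η) (fun ω => conj (Y α η' ω)) P‖ ≤ B η η' * α⁻¹) ∧
      (∀ δ > 0, ∃ K D : ℝ, ∀ η ≥ δ, ∀ η' ≥ δ, D ≤ |η - η'| →
        B η η' ≤ K * ((η + η') ^ 2 * Real.exp (-(η - η') ^ 2))) ∧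
      (∃ K D δ : ℝ, 0 < δ ∧ ∀ η ∈ Ioo 0 δ, ∀ η' > 0, D ≤ |η - η'| →
        B η η' ≤ K * ((η + η') ^ 2 * η ^ (-(1 / 2) : ℝ) * Real.exp (-(η - η') ^ 2))) ∧
      (∃ K D δ : ℝ, 0 < δ ∧ ∀ η > 0, ∀ η' ∈ Ioo 0 δ, D ≤ |η - η'| →
        B η η' ≤ K * ((η + η') ^ 2 * η' ^ (-(1 / 2) : ℝ) * Real.exp (-(η - η') ^ 2)))) ∧
    -- exact decorrelation
    (∀ α > 0, ∀ η > 0, ∀ η' > 0, 4 * M < |η - η'| →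
      SST.complexCov (Y α η) (Y α η') P = 0 ∧
      SST.complexCov (Y α η) (fun ω => conj (Y α η' ω)) P = 0) := by
  obtain rfl : Y = fun α η => SST.sstIntegrand (SST.noisySignal A ξ₀ Φ)
      (SST.truncatedWindow ψ) α ξ t η := by
    ext α η : 2
    exact hY α η
  have hmem : ∀ α > 0, ∀ (η : ℝ) (p : ENNReal), p ≠ ⊤ →
      MemLp (SST.sstIntegrand (SST.noisySignal A ξ₀ Φ) (SST.truncatedWindow ψ) α ξ t η) p P :=
    fun α hα η p hp => SST.memLp_sstIntegrand hΦ A ξ₀ _ hα ξ t η hp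
  have hdec : ∀ α : ℝ, α > 0 → ∀ η : ℝ, η > 0 → ∀ η' : ℝ, η' > 0 → 4 * M < |η - η'| → _ :=
    fun α hα η hη η' hη' h =>
      SST.complexCov_sstIntegrand_eq_zero hΦ hψ A ξ₀ hα ξ t hη hη' h
  obtain ⟨c, C, hcC, hC⟩ := SST.exists_moment_bounds hΦ hM hψ A ξ₀ t hξ hk
  have hvar := SST.exists_variance_bounds hΦ hM hψ A ξ₀ t hξ
  refine ⟨fun α hα η _ => ⟨hmem α hα η k (by simp), hmem α hα η 2 (by simp)⟩,
    ⟨c, C, fun η hη => ⟨(hcC η hη).1, ?_⟩, hC⟩, hvar, ?_, ?_,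
    fun α hα => SST.continuousOn_complexCov_sstIntegrand hΦ hM hψ A ξ₀ hα ξ t, ?_, hdec⟩
  · filter_upwards [Ioc_mem_nhdsGT one_pos] with α hα
    exact (hcC η hη).2 α hα.1 hα.2
  · rintro rfl α - η -
    exact SST.integral_sstIntegrand_eq_zero hΦ 0 ξ₀ _ α ξ t η (by simp) (by simp)
  -- The constant is `0`: beyond distance `2M` the signal frequency lies outside the window's
  -- spectrum, and the mean vanishes exactly.
  · refine fun _ => ⟨0, 2 * M + 1, fun α _ η _ h => ?_⟩
    have h0 : SST.windowHat ψ (-ξ₀ + η) = 0 := SST.windowHat_eq_zero hψ (by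
      rw [neg_add_eq_sub]
      linarith)
    have h1 := SST.isPhasedFourier_atom hψ t η (-ξ₀)
    have h2 := SST.isPhasedFourier_freqAtom hψ t η (-ξ₀)
    simp only [h0, mul_zero, Complex.ofReal_zero, zero_mul] at h1 h2
    have := SST.integral_sstIntegrand_eq_zero hΦ A ξ₀ _ α ξ t η (by rw [h1, mul_zero])
      (by rw [h2, mul_zero])
    simp [this]
  · obtain ⟨_, D, hD, -⟩ := hvar
    have hB : ∀ η η' : ℝ, 4 * M + 1 ≤ |η - η'| →
        (if 4 * M < |η - η'| then 0 else (D η + D η') / 2) = 0 := fun η η' h =>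
      if_pos (by linarith)
    -- Far apart, exact decorrelation allows `B = 0`, so all three decay claims hold with `K = 0`;
    -- nearby, the variance constants suffice.
    refine ⟨fun η η' => if 4 * M < |η - η'| then 0 else (D η + D η') / 2,
      fun η hη η' hη' _ => ?_,
      fun δ _ => ⟨0, 4 * M + 1, fun η _ η' _ h => by simp only [hB η η' h, zero_mul, le_refl]⟩,
      ⟨0, 4 * M + 1, 1, one_pos, fun η _ η' _ h => by simp only [hB η η' h, zero_mul, le_refl]⟩,
      ⟨0, 4 * M + 1, 1, one_pos, fun η _ η' _ h => by simp only [hB η η' h, zero_mul, le_refl]⟩⟩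
    filter_upwards [(hD η hη).2, (hD η' hη').2, self_mem_nhdsWithin] with α h1 h2 hα
    have hα0 : 0 < α := hα
    split_ifs with h
    · rw [(hdec α hα0 η hη η' hη' h).1, (hdec α hα0 η hη η' hη' h).2]
      simp
    · have m1 := hmem α hα0 η 2 (by simp)
      have m2 := hmem α hα0 η' 2 (by simp)
      have b1 := SST.norm_complexCov_le m1 m2
      have b2 := SST.norm_complexCov_le m1 m2.star
      have e := SST.complexVar_conj (P := P)
        (SST.sstIntegrand (SST.noisySignal A ξ₀ Φ) (SST.truncatedWindow ψ) α ξ t η')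
      change _ ≤ (_ + SST.complexVar (fun ω => conj (SST.sstIntegrand (SST.noisySignal A ξ₀ Φ)
        (SST.truncatedWindow ψ) α ξ t η' ω)) P) / 2 at b2
      rw [e] at b2
      constructor
      · linarith [h1.2, h2.2]
      · refine b2.trans ?_
        linarith [h1.2, h2.2]
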